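/- **Setting.** For real $q\neq 0$ put $$K'(q)=\int_0^1\frac{dx}{\sqrt{(1-x^2)(1-(1-q^2)x^2)}},\qquad E'(q)=\int_0^1\sqrt{\frac{1-(1-q^2)x^2}{1-x^2}}\,dx .$$ For $0<|q|<1$ let $X_q$ be the elliptic curve $4\nu^2=(\lambda-q)(\lambda^{-1}-q)$, with $y^+$ over $\lambda=0$ and $y^-$ over $\lambda=\infty$, with the involutions $\sigma(\lambda,\nu)=(\lambda,-\nu)$, $\eta(\lambda,\nu)=(\bar\lambda^{-1},-\bar\nu)$, $\varrho=\eta\sigma$. A *spectral genus one CMC torus in $\mathbb S^3$* is described by its spectral data: a modulus $0<|q|<1$ (the branch points being normalised by a rotation of $\lambda$ to $0,\infty,q,q^{-1}$), two distinct sym points $\lambda_1=e^{2i\theta_1}\neq\lambda_2=e^{2i\theta_2}$ on the unit circle, and two nowhere vanishing holomorphic functions $\mu_1,\mu_2$ on $X_q\setminus\{y^\pm\}$ such that for $i=1,2$ 1. $\mu_i\circ\sigma=\mu_i^{-1}$, $\mu_i\circ\eta=\bar\mu_i$, $\mu_i\circ\varrho=\bar\mu_i^{-1}$; 2. $d\ln\mu_i$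 are meromorphic differentials of the second kind with double poles at $y^\pm$, and their singular parts at $y^+$, respectively at $y^-$, are linearly independent over $\mathbb R$; 3. $\mu_i=\pm1$ at each of the four points of $X_q$ over $\lambda_1$ and $\lambda_2$. Its coordinates are $(q,k,h)$ with $k=\tfrac12\bigl(\sqrt{\lambda_1\lambda_2}+1/\sqrt{\lambda_1\lambda_2}\bigr)=\cos(\theta_1+\theta_2)$ and $h=\tfrac12\bigl(\sqrt{\lambda_1/\lambda_2}+\sqrt{\lambda_2/\lambda_1}\bigr)=\cos(\theta_1-\theta_2)$, where $\sqrt{\lambda_j}=e^{i\theta_j}$. **Theorem.** Let $D=\{(q,k,h)\in\mathbb R^3: q\neq0\}$. The vector field $$\begin{pmatrix}\dot q\\ \dot k\\ \dot h\end{pmatrix}=\begin{pmatrix} q\,(E'k-qK'h)\\[2pt] \frac{1-k^2}{1-q^2}\bigl((1+q^2)E'-2q^2K'\bigr)\\[2pt] q\,\frac{1-h^2}{1-q^2}\bigl(2E'-(1+q^2)K'\bigr)\end{pmatrix},\qquad K'=K'(q),\ E'=E'(q),$$ defined by this formula on $D\cap\{q^2\neq1\}$, extends to a real analytic vector field $V$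 on $D$. The zero set of $V$ in $D$ is $\{(q,k,h)\in D: q^2=1,\ k=qh\}$. Every spectral genus one CMC torus in $\mathbb S^3$ lies on an integral curve of $V$ that consists of spectral genus one CMC tori: for given spectral data $(q_0,\theta_1^0,\theta_2^0,\mu_1^0,\mu_2^0)$ there are $\varepsilon>0$, smooth functions $q,\theta_1,\theta_2$ on $(-\varepsilon,\varepsilon)$, and functions $\mu_1^t,\mu_2^t$ for each $t$ in this interval, which at $t=0$ are the given data, such that $t\mapsto(q(t),\cos(\theta_1(t)+\theta_2(t)),\cos(\theta_1(t)-\theta_2(t)))$ is an integral curve of $V$, for every $t$ the data $(q(t),\theta_1(t),\theta_2(t),\mu_1^t,\mu_2^t)$ are the spectral data of a spectral genus one CMC torus, the values $\pm1$ of $\mu_1^t,\mu_2^t$ over the two sym points do not depend on $t$, and the singular parts of $d\ln\mu_i^t$ at $y^+$ (written as $c_i(t)\,d\nu$) depend smoothly on $t$. -/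

import Mathlib

open Set Topology
open scoped ContDiff

noncomputable section

/-! ### Complete elliptic integrals -/

/-- Complete elliptic integral of the first kind as a function of the squared modulus `m = k²`:
`K = ∫₀¹ dx / √((1 - x²)(1 - m x²))`. -/
def completeEllipticK (m : ℝ) : ℝ :=
  ∫ x in (0 : ℝ)..1, 1 / √((1 - x ^ 2) * (1 - m * x ^ 2))

/-- Complete elliptic integral of the second kind as a function of the squared modulus `m = k²`:
`E = ∫₀¹ √((1 - m x²) / (1 - x²)) dx`. -/
def completeEllipticE (m : ℝ) : ℝ :=
  ∫ x in (0 : ℝ)..1, √((1 - m * x ^ 2) / (1 - x ^ 2))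

/-- `K'(q) = K(√(1 - q²))`, the squared modulus being `1 - q²` (also when `|q| > 1`). -/
def ellipticK' (q : ℝ) : ℝ := completeEllipticK (1 - q ^ 2)

/-- `E'(q) = E(√(1 - q²))`, the squared modulus being `1 - q²` (also when `|q| > 1`). -/
def ellipticE' (q : ℝ) : ℝ := completeEllipticE (1 - q ^ 2)

/-! ### The vector field -/

/-- The formula of the vector field in the coordinates `(q, k, h)`.  It is meaningful for
`q ≠ 0`, `q² ≠ 1`; at `q² = 1` only its continuous extension will be used. -/
def torusFlow (p : ℝ × ℝ × ℝ) : ℝ × ℝ × ℝ :=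
  let q := p.1
  let k := p.2.1
  let h := p.2.2
  (q * (ellipticE' q * k - q * ellipticK' q * h),
    (1 - k ^ 2) / (1 - q ^ 2) * ((1 + q ^ 2) * ellipticE' q - 2 * q ^ 2 * ellipticK' q),
    q * ((1 - h ^ 2) / (1 - q ^ 2)) * (2 * ellipticE' q - (1 + q ^ 2) * ellipticK' q))

/-! ### Spectral curves of genus one -/

/-- The elliptic curve `4 ν² = (l - q)(l⁻¹ - q)` in the variables `(l, ν)`, without the two points
`y⁺` over `l = 0` and `y⁻` over `l = ∞`.  For `0 < |q| < 1` it is smooth of genus one,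
branched over `0, ∞, q, q⁻¹`. -/
def spectralCurve (q : ℝ) : Set (ℂ × ℂ) :=
  {p | p.1 ≠ 0 ∧ 4 * p.2 ^ 2 = (p.1 - q) * (p.1⁻¹ - q)}

/-- The hyperelliptic involution `σ (l, ν) = (l, -ν)`. -/
def sigmaInv (p : ℂ × ℂ) : ℂ × ℂ := (p.1, -p.2)

/-- The antiholomorphic involution `η (l, ν) = (1 / conj l, -conj ν)`, which exchanges `y⁺` and
`y⁻` and has no fixed points on the curve. -/
def etaInv (p : ℂ × ℂ) : ℂ × ℂ := ((star p.1)⁻¹, -star p.2)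

/-- The antiholomorphic involution `ϱ = η ∘ σ`, whose fixed points are the points with
`|l| = 1`. -/
def rhoInv (p : ℂ × ℂ) : ℂ × ℂ := ((star p.1)⁻¹, star p.2)

/-- `μ` is holomorphic on the (smooth) curve: it is locally the restriction of a holomorphic
function of two variables. -/
def HolomorphicOnCurve (q : ℝ) (μ : ℂ × ℂ → ℂ) : Prop :=
  ∀ p ∈ spectralCurve q, ∃ F : ℂ × ℂ → ℂ,
    AnalyticAt ℂ F p ∧ ∀ᶠ z in 𝓝[spectralCurve q] p, μ z = F z

/-- The differential `d ln μ` extends meromorphically to `y⁺` with singular part `c dν` and no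
residue.  As `w = 1 / ν` is a local coordinate that vanishes at `y⁺`, this says that
`ln μ = c ν + G(w)` near `y⁺` with `G` holomorphic at `0`; for `c ≠ 0` the differential has a
double pole. -/
def HasSingularPartAtZero (q : ℝ) (μ : ℂ × ℂ → ℂ) (c : ℂ) : Prop :=
  ∃ G : ℂ → ℂ, AnalyticAt ℂ G 0 ∧ ∃ δ > (0 : ℝ), ∀ p ∈ spectralCurve q,
    ‖p.1‖ < δ → μ p = Complex.exp (c * p.2 + G p.2⁻¹)

/-- The same at `y⁻`, where `w = 1 / ν` is a local coordinate, too. -/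
def HasSingularPartAtInfinity (q : ℝ) (μ : ℂ × ℂ → ℂ) (c : ℂ) : Prop :=
  ∃ G : ℂ → ℂ, AnalyticAt ℂ G 0 ∧ ∃ R > (0 : ℝ), ∀ p ∈ spectralCurve q,
    R < ‖p.1‖ → μ p = Complex.exp (c * p.2 + G p.2⁻¹)

/-- The sym point `exp (2 i θ)` on the unit circle; `exp (i θ)` is a choice of its square root. -/
def symPoint (θ : ℝ) : ℂ := Complex.exp (2 * θ * Complex.I)

/-- Spectral data of a constant mean curvature torus of spectral genus one in the 3-sphere:
the modulus `q` of the spectral curve, the sym points `exp (2 i θ j)`, and the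
eigenvalue functions `μ 0`, `μ 1` of the monodromy along two periods of the torus. -/
structure IsSpectralGenusOneCMCTorus (q : ℝ) (θ : Fin 2 → ℝ) (μ : Fin 2 → ℂ × ℂ → ℂ) :
    Prop where
  q_ne_zero : q ≠ 0
  abs_q_lt_one : |q| < 1
  symPoint_ne : symPoint (θ 0) ≠ symPoint (θ 1)
  holomorphic : ∀ i, HolomorphicOnCurve q (μ i)
  ne_zero : ∀ i, ∀ p ∈ spectralCurve q, μ i p ≠ 0
  sigma_eq : ∀ i, ∀ p ∈ spectralCurve q, μ i (sigmaInv p) = (μ i p)⁻¹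
  eta_eq : ∀ i, ∀ p ∈ spectralCurve q, μ i (etaInv p) = star (μ i p)
  rho_eq : ∀ i, ∀ p ∈ spectralCurve q, μ i (rhoInv p) = (star (μ i p))⁻¹
  /-- the differentials `d ln μ i` are of the second kind with double poles at `y⁺`, with
  linearly independent singular parts -/
  singular_zero : ∃ c : Fin 2 → ℂ, LinearIndependent ℝ c ∧
    ∀ i, HasSingularPartAtZero q (μ i) (c i)
  /-- the same at `y⁻` -/
  singular_infinity : ∃ c : Fin 2 → ℂ, LinearIndependent ℝ c ∧
    ∀ i, HasSingularPartAtInfinity q (μ i) (c i)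
  /-- both functions are `1` or `-1` at the four points over the sym points -/
  closing : ∀ i j, ∀ p ∈ spectralCurve q, p.1 = symPoint (θ j) → μ i p = 1 ∨ μ i p = -1

/-- The coordinates `(q, k, h)`, with `2 k = √(l₁ l₂) + 1 / √(l₁ l₂)` and
`2 h = √(l₁ / l₂) + √(l₂ / l₁)` for the sym points `l_j = exp (2 i θ_j)` and their square roots
`exp (i θ_j)`. -/
def torusCoords (q : ℝ) (θ : Fin 2 → ℝ) : ℝ × ℝ × ℝ :=
  (q, Real.cos (θ 0 + θ 1), Real.cos (θ 0 - θ 1))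

end

open Filter MeasureTheory
open scoped Real Interval

/-! ### Parametric integrals -/

/-! Vector field. With m = 1 - q², the integrals I_i = ∫₀^{π/2} sin^{2i} x (1 - m sin² x)^{-3/2} dx
span K', E' and their derivatives, and satisfy one relation, I₀ - 2I₁ + m I₂ = 0
(`sinDeltaIntegral_relation`). It turns the numerators of the k- and h-components into (1 - q²)² q²
I₂ and (1 - q²)² (I₂ - I₁). So after division by 1 - q² the field is analytic, and the two
coefficients vanish exactly at q² = 1, where moreover E' = K'. For q² ≠ 1 a zero would need k² = h²
= 1 and hence E' = |q| K', against `mul_completeEllipticK_lt_completeEllipticE`.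

Spectral data as numbers, for 0 < q < 1. Write d ln μ = ξ dl/(lν). Then ξ is holomorphic on ℂ \ {0}
with at most simple poles at 0 and ∞; it is real on the unit circle because |μ| = 1 there, and the
real part of its period along the cycle over [q, q⁻¹] vanishes because μ = ±1 at the branch points.
What remains is `torusForm q s n` with two real numbers s, n (`exists_torusForm`). Over e^{iφ}, on
the sheet ν = R/2 > 0, one has μ = κ exp(i(s R(φ)/2 + n Φ(φ))) with κ = ±1, where R is
`circleRadius` and Φ is `circlePhase`. The closing conditions become conditions on these exponents
at the two sym points, and single-valuedness along the circle says 2nΦ(π) ∈ 2πℤ. Conversely, any s,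
n with this integrality come from some μ (`exists_isLogPrimitive_torusForm`).

Deformation. Lift the field to q, α = θ₁ + θ₂, β = θ₁ - θ₂; the sym points lie at the angles α ± β.
Three facts hold along the lifted flow: Φ(π) is constant; the logarithmic derivative of R(α + β) is
even in β, so R(α - β)/R(α + β) is a constant r; and Φ(α + β)' / R(α + β) is even in β, so Φ(α - β)
- rΦ(α + β) is constant. Keeping n fixed and choosing s(t) so that the exponent at the first sym
point is constant, the exponent at the second is then constant too. All closing values and periods
are preserved, and the existence result supplies the functions μ.

Negative q reduces to positive q by l ↦ -l, which reverses the field and hence time. -/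

theorem hasDerivAt_intervalIntegral_of_continuousOn {𝕜 E : Type*} [RCLike 𝕜]
    [NormedAddCommGroup E] [NormedSpace ℝ E] [NormedSpace 𝕜 E]
    {U : Set 𝕜} (hU : IsOpen U) {F F' : 𝕜 → ℝ → E} {a b : ℝ}
    (hF : ∀ x ∈ U, ContinuousOn (F x) [[a, b]])
    (hF' : ContinuousOn (Function.uncurry F') (U ×ˢ [[a, b]]))
    (h : ∀ x ∈ U, ∀ t ∈ [[a, b]], HasDerivAt (fun y => F y t) (F' x t) x) {x₀ : 𝕜} (hx : x₀ ∈ U) :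
    HasDerivAt (fun x => ∫ t in a..b, F x t) (∫ t in a..b, F' x₀ t) x₀ := by
  obtain ⟨r, hr, hrU⟩ := Metric.nhds_basis_closedBall.mem_iff.1 (hU.mem_nhds hx)
  have hK : IsCompact (Metric.closedBall x₀ r ×ˢ [[a, b]]) :=
    (isCompact_closedBall _ _).prod isCompact_uIcc
  obtain ⟨C, hC⟩ := hK.exists_bound_of_continuousOn (hF'.mono (prod_mono hrU subset_rfl))
  have hsub : Ι a b ⊆ [[a, b]] := uIoc_subset_uIcc
  have hc' : ContinuousOn (F' x₀) [[a, b]] :=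
    hF'.comp (f := fun t => (x₀, t)) (by fun_prop) (fun t ht => ⟨hx, ht⟩)
  refine (intervalIntegral.hasDerivAt_integral_of_dominated_loc_of_deriv_le
    (Metric.closedBall_mem_nhds x₀ hr) (bound := fun _ => C) ?_ ?_ ?_ ?_ ?_ ?_).2
  · filter_upwards [hU.mem_nhds hx] with y hy
    exact ((hF y hy).mono hsub).aestronglyMeasurable measurableSet_uIoc
  · exact (hF x₀ hx).intervalIntegrable
  · exact (hc'.mono hsub).aestronglyMeasurable measurableSet_uIoc
  · exact ae_of_all _ fun t ht y hy => hC (y, t) ⟨hy, hsub ht⟩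
  · exact intervalIntegrable_const
  · exact ae_of_all _ fun t ht y hy => h y (hrU hy) t (hsub ht)

/-! ### Complete elliptic integrals in trigonometric form -/

/-- The integral `∫₀^{π/2} g(x) (1 - m sin² x) ^ p dx`. -/
noncomputable def deltaIntegral (g : ℝ → ℝ) (p m : ℝ) : ℝ :=
  ∫ x in (0 : ℝ)..π / 2, g x * (1 - m * Real.sin x ^ 2) ^ p

theorem one_sub_mul_sin_sq_pos {m : ℝ} (hm : m < 1) (x : ℝ) : 0 < 1 - m * Real.sin x ^ 2 := by
  have h1 := Real.sin_sq_add_cos_sq x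
  rcases (sq_nonneg (Real.sin x)).eq_or_lt with h | h
  · rw [← h]; norm_num
  · nlinarith [sq_nonneg (Real.cos x)]

theorem continuous_delta_rpow {m : ℝ} (hm : m < 1) (p : ℝ) :
    Continuous fun x => (1 - m * Real.sin x ^ 2) ^ p :=
  Continuous.rpow_const (by fun_prop) fun x => Or.inl (one_sub_mul_sin_sq_pos hm x).ne'

theorem one_sub_mul_sin_sq_mem_slitPlane {m : ℂ} (hm : m.re < 1) (x : ℝ) :
    1 - m * ((Real.sin x ^ 2 : ℝ) : ℂ) ∈ Complex.slitPlane := by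
  left
  have := one_sub_mul_sin_sq_pos hm x
  rwa [Complex.sub_re, Complex.one_re, Complex.re_mul_ofReal]

/-- The integral makes sense and is holomorphic for complex m with Re m < 1, since 1 - m sin² x then
stays in the slit plane. Holomorphy gives analyticity, and the real function is the real part of the
restriction. -/
theorem analyticAt_deltaIntegral {g : ℝ → ℝ} (hg : Continuous g) (p : ℝ) {m : ℝ} (hm : m < 1) :
    AnalyticAt ℝ (deltaIntegral g p) m := by
  set f : ℂ → ℂ := fun z => ∫ x in (0 : ℝ)..π / 2,
    (g x : ℂ) * (1 - z * ((Real.sin x ^ 2 : ℝ) : ℂ)) ^ (p : ℂ) with hf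
  have hU : IsOpen {z : ℂ | z.re < 1} := isOpen_lt Complex.continuous_re continuous_const
  have hd : DifferentiableOn ℂ f {z : ℂ | z.re < 1} := by
    intro z hz
    refine (hasDerivAt_intervalIntegral_of_continuousOn (𝕜 := ℂ) hU
      (F' := fun z x => (g x : ℂ) * ((p : ℂ) * (1 - z * ((Real.sin x ^ 2 : ℝ) : ℂ)) ^ ((p : ℂ) - 1)
        * (-((Real.sin x ^ 2 : ℝ) : ℂ)))) ?_ ?_ ?_ hz).differentiableAt.differentiableWithinAt
    · intro y hy x _
      refine ContinuousAt.continuousWithinAt ?_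
      refine ContinuousAt.mul (by fun_prop) (ContinuousAt.cpow (by fun_prop) (by fun_prop) ?_)
      exact one_sub_mul_sin_sq_mem_slitPlane hy x
    · rintro ⟨y, x⟩ ⟨hy, _⟩
      refine ContinuousAt.continuousWithinAt ?_
      refine ContinuousAt.mul (by fun_prop) (ContinuousAt.mul (ContinuousAt.mul (by fun_prop)
        (ContinuousAt.cpow (by fun_prop) (by fun_prop) ?_)) (by fun_prop))
      exact one_sub_mul_sin_sq_mem_slitPlane hy x
    · intro y hy x _
      have h1 : HasDerivAt (fun z : ℂ => 1 - z * ((Real.sin x ^ 2 : ℝ) : ℂ))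
          (-((Real.sin x ^ 2 : ℝ) : ℂ)) y := by
        simpa only [id, one_mul] using
          ((hasDerivAt_id y).mul_const ((Real.sin x ^ 2 : ℝ) : ℂ)).const_sub 1
      exact (h1.cpow_const (one_sub_mul_sin_sq_mem_slitPlane hy x)).const_mul _
  have han : AnalyticAt ℂ f (m : ℂ) :=
    hd.analyticAt (hU.mem_nhds (by simpa using hm))
  refine han.re_ofReal.congr ?_
  filter_upwards [Iio_mem_nhds hm] with y hy
  have : f y = ((deltaIntegral g p y : ℝ) : ℂ) := by
    rw [hf, deltaIntegral, ← intervalIntegral.integral_ofReal]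
    refine intervalIntegral.integral_congr fun x _ => ?_
    have := one_sub_mul_sin_sq_pos (m := y) hy x
    push_cast [Complex.ofReal_cpow this.le]
    rfl
  rw [this, Complex.ofReal_re]

theorem hasDerivAt_deltaIntegral {g : ℝ → ℝ} (hg : Continuous g) (p : ℝ) {m : ℝ} (hm : m < 1) :
    HasDerivAt (deltaIntegral g p)
      (-p * deltaIntegral (fun x => g x * Real.sin x ^ 2) (p - 1) m) m := by
  have := hasDerivAt_intervalIntegral_of_continuousOn (𝕜 := ℝ) (isOpen_Iio (a := (1 : ℝ)))
    (a := 0) (b := π / 2)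
    (F := fun m x => g x * (1 - m * Real.sin x ^ 2) ^ p)
    (F' := fun m x => g x * (-(Real.sin x ^ 2) * p * (1 - m * Real.sin x ^ 2) ^ (p - 1)))
    ?_ ?_ ?_ (mem_Iio.2 hm)
  · refine HasDerivAt.congr_deriv (f := deltaIntegral g p) this ?_
    rw [deltaIntegral, ← intervalIntegral.integral_const_mul]
    refine intervalIntegral.integral_congr fun x _ => ?_
    ring
  · intro y hy
    exact (hg.mul (continuous_delta_rpow hy p)).continuousOn
  · rintro ⟨y, x⟩ ⟨hy, _⟩
    refine ContinuousAt.continuousWithinAt ?_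
    refine ContinuousAt.mul (by fun_prop) (ContinuousAt.mul (by fun_prop)
      (ContinuousAt.rpow_const (by fun_prop) (Or.inl (one_sub_mul_sin_sq_pos hy x).ne')))
  · intro y hy x _
    have h1 : HasDerivAt (fun z : ℝ => 1 - z * Real.sin x ^ 2) (-(Real.sin x ^ 2)) y := by
      simpa using ((hasDerivAt_id y).mul_const (Real.sin x ^ 2)).const_sub 1
    exact (h1.rpow_const (Or.inl (one_sub_mul_sin_sq_pos hy x).ne')).const_mul _

theorem deltaIntegral_add {g₁ g₂ : ℝ → ℝ} (h₁ : Continuous g₁) (h₂ : Continuous g₂) (p : ℝ)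
    {m : ℝ} (hm : m < 1) :
    deltaIntegral (fun x => g₁ x + g₂ x) p m = deltaIntegral g₁ p m + deltaIntegral g₂ p m := by
  rw [deltaIntegral, deltaIntegral, deltaIntegral, ← intervalIntegral.integral_add]
  · simp only [add_mul]
  · exact (h₁.mul (continuous_delta_rpow hm p)).intervalIntegrable _ _
  · exact (h₂.mul (continuous_delta_rpow hm p)).intervalIntegrable _ _

theorem deltaIntegral_const_mul (c : ℝ) (g : ℝ → ℝ) (p m : ℝ) :
    deltaIntegral (fun x => c * g x) p m = c * deltaIntegral g p m := by
  rw [deltaIntegral, deltaIntegral, ← intervalIntegral.integral_const_mul]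
  simp only [mul_assoc]

/-- Raising the exponent by one. -/
theorem deltaIntegral_add_one (g : ℝ → ℝ) (p : ℝ) {m : ℝ} (hm : m < 1) :
    deltaIntegral g (p + 1) m = deltaIntegral (fun x => g x * (1 - m * Real.sin x ^ 2)) p m := by
  rw [deltaIntegral, deltaIntegral]
  refine intervalIntegral.integral_congr fun x _ => ?_
  have := one_sub_mul_sin_sq_pos hm x
  simp only [Real.rpow_add_one this.ne']; ring

theorem deltaIntegral_pos {g : ℝ → ℝ} (hg : Continuous g) (h0 : ∀ x, 0 ≤ g x)
    (h1 : ∃ x ∈ Icc 0 (π / 2), 0 < g x) (p : ℝ) {m : ℝ} (hm : m < 1) :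
    0 < deltaIntegral g p m := by
  obtain ⟨x, hx, hgx⟩ := h1
  refine intervalIntegral.integral_pos (by positivity)
    (hg.mul (continuous_delta_rpow hm p)).continuousOn
    (fun y _ => mul_nonneg (h0 y) (Real.rpow_nonneg (one_sub_mul_sin_sq_pos hm y).le _))
    ⟨x, hx, mul_pos hgx (Real.rpow_pos_of_pos (one_sub_mul_sin_sq_pos hm x) _)⟩

theorem completeEllipticK_eq {m : ℝ} (hm : m < 1) :
    completeEllipticK m = deltaIntegral (fun _ => 1) (-1 / 2) m := by
  have hcos : ∀ x ∈ Ioo (min 0 (π / 2)) (max 0 (π / 2)), 0 < Real.cos x := by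
    intro x hx
    rw [min_eq_left (by positivity), max_eq_right (by positivity)] at hx
    exact Real.cos_pos_of_mem_Ioo ⟨by linarith [hx.1, Real.pi_pos], hx.2⟩
  have := intervalIntegral.integral_comp_mul_deriv_of_deriv_nonneg (a := 0) (b := π / 2)
    (f := Real.sin) (f' := Real.cos) (g := fun x => 1 / √((1 - x ^ 2) * (1 - m * x ^ 2)))
    Real.continuous_sin.continuousOn (fun x _ => Real.hasDerivAt_sin x)
    (fun x hx => (hcos x hx).le)
  rw [Real.sin_zero, Real.sin_pi_div_two] at this
  rw [completeEllipticK, ← this, deltaIntegral]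
  refine intervalIntegral.integral_congr_uIoo fun x hx => ?_
  have hc := hcos x (by simpa [uIoo] using hx)
  have hd := one_sub_mul_sin_sq_pos hm x
  simp only [Function.comp]
  rw [← Real.cos_sq', Real.sqrt_mul (sq_nonneg _), Real.sqrt_sq hc.le, one_mul, neg_div,
    Real.rpow_neg hd.le, ← Real.sqrt_eq_rpow]
  field_simp

theorem completeEllipticE_eq {m : ℝ} (hm : m < 1) :
    completeEllipticE m = deltaIntegral (fun _ => 1) (1 / 2) m := by
  have hcos : ∀ x ∈ Ioo (min 0 (π / 2)) (max 0 (π / 2)), 0 < Real.cos x := by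
    intro x hx
    rw [min_eq_left (by positivity), max_eq_right (by positivity)] at hx
    exact Real.cos_pos_of_mem_Ioo ⟨by linarith [hx.1, Real.pi_pos], hx.2⟩
  have := intervalIntegral.integral_comp_mul_deriv_of_deriv_nonneg (a := 0) (b := π / 2)
    (f := Real.sin) (f' := Real.cos) (g := fun x => √((1 - m * x ^ 2) / (1 - x ^ 2)))
    Real.continuous_sin.continuousOn (fun x _ => Real.hasDerivAt_sin x)
    (fun x hx => (hcos x hx).le)
  rw [Real.sin_zero, Real.sin_pi_div_two] at this
  rw [completeEllipticE, ← this, deltaIntegral]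
  refine intervalIntegral.integral_congr_uIoo fun x hx => ?_
  have hc := hcos x (by simpa [uIoo] using hx)
  have hd := one_sub_mul_sin_sq_pos hm x
  simp only [Function.comp]
  rw [← Real.cos_sq', Real.sqrt_div' _ (sq_nonneg _), Real.sqrt_sq hc.le, one_mul,
    ← Real.sqrt_eq_rpow]
  field_simp

/-! ### Relations between complete elliptic integrals -/

/-- The integrals `∫₀^{π/2} sin x ^ (2 i) (1 - m sin² x) ^ (-3/2) dx`. -/
noncomputable def sinDeltaIntegral (i : ℕ) (m : ℝ) : ℝ :=
  deltaIntegral (fun x => Real.sin x ^ (2 * i)) (-3 / 2) m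

theorem analyticAt_sinDeltaIntegral (i : ℕ) {m : ℝ} (hm : m < 1) :
    AnalyticAt ℝ (sinDeltaIntegral i) m :=
  analyticAt_deltaIntegral (by fun_prop) _ hm

theorem completeEllipticK_eq_sinDeltaIntegral {m : ℝ} (hm : m < 1) :
    completeEllipticK m = sinDeltaIntegral 0 m - m * sinDeltaIntegral 1 m := by
  rw [completeEllipticK_eq hm, show (-1 / 2 : ℝ) = -3 / 2 + 1 by norm_num,
    deltaIntegral_add_one _ _ hm]
  have := deltaIntegral_add (g₁ := fun x => Real.sin x ^ (2 * 0))
    (g₂ := fun x => -m * Real.sin x ^ (2 * 1)) (by fun_prop) (by fun_prop) (-3 / 2) hm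
  rw [deltaIntegral_const_mul] at this
  rw [sinDeltaIntegral, sinDeltaIntegral, sub_eq_add_neg, ← neg_mul, ← this]
  congr 1; funext x; ring

theorem completeEllipticE_eq_sinDeltaIntegral {m : ℝ} (hm : m < 1) :
    completeEllipticE m =
      sinDeltaIntegral 0 m - 2 * m * sinDeltaIntegral 1 m + m ^ 2 * sinDeltaIntegral 2 m := by
  rw [completeEllipticE_eq hm, show (1 / 2 : ℝ) = -3 / 2 + 1 + 1 by norm_num,
    deltaIntegral_add_one _ _ hm, deltaIntegral_add_one _ _ hm]
  have h1 := deltaIntegral_add (g₁ := fun x => Real.sin x ^ (2 * 0))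
    (g₂ := fun x => -2 * m * Real.sin x ^ (2 * 1)) (by fun_prop) (by fun_prop) (-3 / 2) hm
  have h2 := deltaIntegral_add
    (g₁ := fun x => Real.sin x ^ (2 * 0) + -2 * m * Real.sin x ^ (2 * 1))
    (g₂ := fun x => m ^ 2 * Real.sin x ^ (2 * 2)) (by fun_prop) (by fun_prop) (-3 / 2) hm
  rw [deltaIntegral_const_mul] at h1 h2
  rw [h1] at h2
  rw [sinDeltaIntegral, sinDeltaIntegral, sinDeltaIntegral, sub_eq_add_neg, ← neg_mul, ← neg_mul,
    ← h2]
  congr 1; funext x; ring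

/-- The integral of the derivative of `sin x cos x / √(1 - m sin² x)` vanishes. -/
theorem sinDeltaIntegral_relation {m : ℝ} (hm : m < 1) :
    sinDeltaIntegral 0 m - 2 * sinDeltaIntegral 1 m + m * sinDeltaIntegral 2 m = 0 := by
  have h1 := deltaIntegral_add (g₁ := fun x => Real.sin x ^ (2 * 0))
    (g₂ := fun x => -2 * Real.sin x ^ (2 * 1)) (by fun_prop) (by fun_prop) (-3 / 2) hm
  have h2 := deltaIntegral_add
    (g₁ := fun x => Real.sin x ^ (2 * 0) + -2 * Real.sin x ^ (2 * 1))
    (g₂ := fun x => m * Real.sin x ^ (2 * 2)) (by fun_prop) (by fun_prop) (-3 / 2) hm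
  rw [deltaIntegral_const_mul] at h1 h2
  rw [h1] at h2
  rw [sinDeltaIntegral, sinDeltaIntegral, sinDeltaIntegral, sub_eq_add_neg, ← neg_mul, ← h2,
    deltaIntegral]
  have hd : ∀ x ∈ [[0, π / 2]], HasDerivAt
      (fun x => Real.sin x * Real.cos x * (1 - m * Real.sin x ^ 2) ^ (-1 / 2 : ℝ))
      ((Real.sin x ^ (2 * 0) + -2 * Real.sin x ^ (2 * 1) + m * Real.sin x ^ (2 * 2)) *
        (1 - m * Real.sin x ^ 2) ^ (-3 / 2 : ℝ)) x := by
    intro x _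
    have hD := one_sub_mul_sin_sq_pos hm x
    have h3 := ((((Real.hasDerivAt_sin x).pow 2).const_mul m).const_sub 1).rpow_const
      (p := -1 / 2) (Or.inl hD.ne')
    refine (((Real.hasDerivAt_sin x).mul (Real.hasDerivAt_cos x)).mul h3).congr_deriv ?_
    have h4 : (1 - m * Real.sin x ^ 2) ^ (-1 / 2 : ℝ) =
        (1 - m * Real.sin x ^ 2) ^ (-3 / 2 : ℝ) * (1 - m * Real.sin x ^ 2) := by
      rw [← Real.rpow_add_one hD.ne']; norm_num
    have hc := Real.cos_sq' x
    simp only [Pi.pow_apply, Pi.mul_apply, h4, show (-1 / 2 - 1 : ℝ) = -3 / 2 by norm_num]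
    generalize (1 - m * Real.sin x ^ 2) ^ (-3 / 2 : ℝ) = D
    push_cast
    linear_combination D * hc
  rw [intervalIntegral.integral_eq_sub_of_hasDerivAt hd]
  · simp
  · exact ((Continuous.mul (by fun_prop) (continuous_delta_rpow hm _))).intervalIntegrable _ _

/-! ### Derivatives and inequalities for complete elliptic integrals -/

theorem hasDerivAt_completeEllipticK {m : ℝ} (hm : m < 1) :
    HasDerivAt completeEllipticK (sinDeltaIntegral 1 m / 2) m := by
  have h := hasDerivAt_deltaIntegral (g := fun _ => 1) continuous_const (-1 / 2) hm
  refine (h.congr_of_eventuallyEq ?_).congr_deriv ?_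
  · filter_upwards [Iio_mem_nhds hm] with y hy using completeEllipticK_eq hy
  · rw [sinDeltaIntegral]; norm_num; ring

theorem hasDerivAt_completeEllipticE {m : ℝ} (hm : m < 1) :
    HasDerivAt completeEllipticE (-(sinDeltaIntegral 1 m - m * sinDeltaIntegral 2 m) / 2) m := by
  have h := hasDerivAt_deltaIntegral (g := fun _ => 1) continuous_const (1 / 2) hm
  refine (h.congr_of_eventuallyEq ?_).congr_deriv ?_
  · filter_upwards [Iio_mem_nhds hm] with y hy using completeEllipticE_eq hy
  · rw [show (1 / 2 - 1 : ℝ) = -3 / 2 + 1 by norm_num, deltaIntegral_add_one _ _ hm]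
    have := deltaIntegral_add (g₁ := fun x => Real.sin x ^ (2 * 1))
      (g₂ := fun x => -m * Real.sin x ^ (2 * 2)) (by fun_prop) (by fun_prop) (-3 / 2) hm
    rw [deltaIntegral_const_mul] at this
    rw [sinDeltaIntegral, sinDeltaIntegral, sub_eq_add_neg, ← neg_mul, ← this]
    rw [show (fun x : ℝ => 1 * Real.sin x ^ 2 * (1 - m * Real.sin x ^ 2)) =
      fun x => Real.sin x ^ (2 * 1) + -m * Real.sin x ^ (2 * 2) by funext x; ring]
    ring

theorem completeEllipticK_pos {m : ℝ} (hm : m < 1) : 0 < completeEllipticK m := by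
  rw [completeEllipticK_eq hm]
  exact deltaIntegral_pos continuous_const (fun _ => zero_le_one)
    ⟨0, ⟨le_rfl, by positivity⟩, one_pos⟩ _ hm

theorem sinDeltaIntegral_pos (i : ℕ) {m : ℝ} (hm : m < 1) : 0 < sinDeltaIntegral i m := by
  refine deltaIntegral_pos (by fun_prop) (fun x => ?_) ⟨π / 2, ⟨by positivity, le_rfl⟩, ?_⟩ _ hm
  · rw [pow_mul]; positivity
  · simp

theorem sinDeltaIntegral_two_lt_one {m : ℝ} (hm : m < 1) :
    sinDeltaIntegral 2 m < sinDeltaIntegral 1 m := by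
  have h1 := deltaIntegral_add (g₁ := fun x => Real.sin x ^ (2 * 1))
    (g₂ := fun x => -1 * Real.sin x ^ (2 * 2)) (by fun_prop) (by fun_prop) (-3 / 2) hm
  rw [deltaIntegral_const_mul] at h1
  have h2 : 0 < deltaIntegral (fun x => Real.sin x ^ (2 * 1) + -1 * Real.sin x ^ (2 * 2))
      (-3 / 2) m := by
    -- The integrand is sin² x cos² x times a positive factor; any interior point shows strictness,
    -- and π/4 has an explicit sine.
    refine deltaIntegral_pos (by fun_prop) (fun x => ?_)
      ⟨π / 4, ⟨by positivity, by linarith [Real.pi_pos]⟩, ?_⟩ _ hm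
    · have := mul_nonneg (sq_nonneg (Real.sin x)) (sq_nonneg (Real.cos x))
      rw [Real.cos_sq'] at this
      linarith [show Real.sin x ^ (2 * 1) + -1 * Real.sin x ^ (2 * 2) =
        Real.sin x ^ 2 * (1 - Real.sin x ^ 2) by ring]
    · have h : (√2 / 2) ^ 2 = (1 / 2 : ℝ) := by rw [div_pow, Real.sq_sqrt (by norm_num)]; norm_num
      rw [Real.sin_pi_div_four, pow_mul, pow_mul, h]; norm_num
  rw [h1] at h2
  unfold sinDeltaIntegral
  linarith

/-- Modulo the relation between the I_i, 2(E - rK) is the integral of (1 - r - m sin² x)² (1 - m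
sin² x)^{-3/2}, a square with positive weight that does not vanish at x = 0 when r ≠ 1. -/
theorem mul_completeEllipticK_lt_completeEllipticE {m r : ℝ} (hr : r ^ 2 = 1 - m) (h0 : 0 < r)
    (h1 : r ≠ 1) : r * completeEllipticK m < completeEllipticE m := by
  have hm : m < 1 := by nlinarith
  have hE := completeEllipticE_eq_sinDeltaIntegral hm
  have hK := completeEllipticK_eq_sinDeltaIntegral hm
  have hrel := sinDeltaIntegral_relation hm
  -- The coefficients are those of the square (1 - r - m sin² x)², divided by (1 - r)² to make the
  -- constant term 1.
  have h3 := deltaIntegral_add (g₁ := fun x => Real.sin x ^ (2 * 0))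
    (g₂ := fun x => 2 * m * (r - 1) / (1 - r) ^ 2 * Real.sin x ^ (2 * 1)) (by fun_prop)
    (by fun_prop) (-3 / 2) hm
  have h4 := deltaIntegral_add
    (g₁ := fun x => Real.sin x ^ (2 * 0) + 2 * m * (r - 1) / (1 - r) ^ 2 * Real.sin x ^ (2 * 1))
    (g₂ := fun x => m ^ 2 / (1 - r) ^ 2 * Real.sin x ^ (2 * 2)) (by fun_prop)
    (by fun_prop) (-3 / 2) hm
  rw [deltaIntegral_const_mul] at h3 h4
  rw [h3] at h4
  have hr1 : 1 - r ≠ 0 := sub_ne_zero.2 h1.symm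
  have h5 : (fun x => Real.sin x ^ (2 * 0) +
      2 * m * (r - 1) / (1 - r) ^ 2 * Real.sin x ^ (2 * 1) +
      m ^ 2 / (1 - r) ^ 2 * Real.sin x ^ (2 * 2)) =
      fun x => ((1 - r - m * Real.sin x ^ 2) / (1 - r)) ^ 2 := by
    funext x; field_simp; ring
  have h2 : 0 < deltaIntegral (fun x => ((1 - r - m * Real.sin x ^ 2) / (1 - r)) ^ 2)
      (-3 / 2) m :=
    deltaIntegral_pos (by fun_prop) (fun x => sq_nonneg _)
      ⟨0, ⟨le_rfl, by positivity⟩, by simp [hr1]⟩ _ hm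
  rw [← h5, h4] at h2
  have h6 : 0 < (1 - r) ^ 2 * (sinDeltaIntegral 0 m + 2 * m * (r - 1) / (1 - r) ^ 2 *
      sinDeltaIntegral 1 m + m ^ 2 / (1 - r) ^ 2 * sinDeltaIntegral 2 m) := by
    unfold sinDeltaIntegral; positivity
  have h7 : (1 - r) ^ 2 * (sinDeltaIntegral 0 m + 2 * m * (r - 1) / (1 - r) ^ 2 *
      sinDeltaIntegral 1 m + m ^ 2 / (1 - r) ^ 2 * sinDeltaIntegral 2 m) =
      (1 - r) ^ 2 * sinDeltaIntegral 0 m + 2 * m * (r - 1) *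
      sinDeltaIntegral 1 m + m ^ 2 * sinDeltaIntegral 2 m := by field_simp
  rw [h7] at h6
  have h8 : 2 * (completeEllipticE m - r * completeEllipticK m) =
      (1 - r) ^ 2 * sinDeltaIntegral 0 m + 2 * m * (r - 1) *
      sinDeltaIntegral 1 m + m ^ 2 * sinDeltaIntegral 2 m := by
    rw [hE, hK]
    linear_combination (-sinDeltaIntegral 0 m) * hr + m * hrel
  linarith

/-! ### The extended vector field -/

/-- The analytic extension of `((1 + q²) E' - 2 q² K') / (1 - q²)`. -/
noncomputable def kCoeff (q : ℝ) : ℝ := (1 - q ^ 2) * q ^ 2 * sinDeltaIntegral 2 (1 - q ^ 2)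

/-- The analytic extension of `(2 E' - (1 + q²) K') / (1 - q²)`. -/
noncomputable def hCoeff (q : ℝ) : ℝ :=
  (1 - q ^ 2) * (sinDeltaIntegral 2 (1 - q ^ 2) - sinDeltaIntegral 1 (1 - q ^ 2))

/-- The analytic extension of `torusFlow` to `q² = 1`. -/
noncomputable def extendedTorusFlow (p : ℝ × ℝ × ℝ) : ℝ × ℝ × ℝ :=
  (p.1 * (ellipticE' p.1 * p.2.1 - p.1 * ellipticK' p.1 * p.2.2),
    (1 - p.2.1 ^ 2) * kCoeff p.1, p.1 * (1 - p.2.2 ^ 2) * hCoeff p.1)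

theorem one_sub_sq_lt_one {q : ℝ} (hq : q ≠ 0) : 1 - q ^ 2 < 1 := by
  have : 0 < q ^ 2 := by positivity
  linarith

/-- The singularity of the field at q² = 1 is removable because the relation between the I_i
produces a factor (1 - q²)² in the numerator. One power is cancelled by the denominator; the other
makes the component vanish at q² = 1. -/
theorem one_sub_sq_mul_kCoeff {q : ℝ} (hq : q ≠ 0) :
    (1 - q ^ 2) * kCoeff q = (1 + q ^ 2) * ellipticE' q - 2 * q ^ 2 * ellipticK' q := by
  have hm := one_sub_sq_lt_one hq
  rw [ellipticE', ellipticK', completeEllipticE_eq_sinDeltaIntegral hm,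
    completeEllipticK_eq_sinDeltaIntegral hm, kCoeff]
  linear_combination (-(1 - q ^ 2)) * sinDeltaIntegral_relation hm

theorem one_sub_sq_mul_hCoeff {q : ℝ} (hq : q ≠ 0) :
    (1 - q ^ 2) * hCoeff q = 2 * ellipticE' q - (1 + q ^ 2) * ellipticK' q := by
  have hm := one_sub_sq_lt_one hq
  rw [ellipticE', ellipticK', completeEllipticE_eq_sinDeltaIntegral hm,
    completeEllipticK_eq_sinDeltaIntegral hm, hCoeff]
  linear_combination (-(1 - q ^ 2)) * sinDeltaIntegral_relation hm

theorem extendedTorusFlow_eq {p : ℝ × ℝ × ℝ} (h0 : p.1 ≠ 0) (h1 : p.1 ^ 2 ≠ 1) :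
    extendedTorusFlow p = torusFlow p := by
  have h2 : 1 - p.1 ^ 2 ≠ 0 := sub_ne_zero.2 h1.symm
  rw [extendedTorusFlow, torusFlow, ← one_sub_sq_mul_kCoeff h0, ← one_sub_sq_mul_hCoeff h0]
  congr 2 <;> field_simp

theorem ellipticK'_pos {q : ℝ} (hq : q ≠ 0) : 0 < ellipticK' q :=
  completeEllipticK_pos (one_sub_sq_lt_one hq)

theorem analyticAt_sinDeltaIntegral_one_sub_sq (i : ℕ) {q : ℝ} (hq : q ≠ 0) :
    AnalyticAt ℝ (fun q => sinDeltaIntegral i (1 - q ^ 2)) q :=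
  (analyticAt_sinDeltaIntegral i (one_sub_sq_lt_one hq)).fun_comp
    (f := fun q : ℝ => 1 - q ^ 2) (by fun_prop)

theorem analyticAt_ellipticK' {q : ℝ} (hq : q ≠ 0) : AnalyticAt ℝ ellipticK' q := by
  have h0 := analyticAt_sinDeltaIntegral_one_sub_sq 0 hq
  have h1 := analyticAt_sinDeltaIntegral_one_sub_sq 1 hq
  refine (h0.sub (AnalyticAt.mul (f := fun q : ℝ => 1 - q ^ 2) (by fun_prop) h1)).congr ?_
  filter_upwards [isOpen_ne.mem_nhds hq] with y hy
  exact (completeEllipticK_eq_sinDeltaIntegral (one_sub_sq_lt_one hy)).symm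

theorem analyticAt_ellipticE' {q : ℝ} (hq : q ≠ 0) : AnalyticAt ℝ ellipticE' q := by
  have h0 := analyticAt_sinDeltaIntegral_one_sub_sq 0 hq
  have h1 := analyticAt_sinDeltaIntegral_one_sub_sq 1 hq
  have h2 := analyticAt_sinDeltaIntegral_one_sub_sq 2 hq
  refine ((h0.sub (AnalyticAt.mul (f := fun q : ℝ => 2 * (1 - q ^ 2)) (by fun_prop) h1)).add
    (AnalyticAt.mul (f := fun q : ℝ => (1 - q ^ 2) ^ 2) (by fun_prop) h2)).congr ?_
  filter_upwards [isOpen_ne.mem_nhds hq] with y hy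
  exact (completeEllipticE_eq_sinDeltaIntegral (one_sub_sq_lt_one hy)).symm

theorem analyticAt_kCoeff {q : ℝ} (hq : q ≠ 0) : AnalyticAt ℝ kCoeff q :=
  AnalyticAt.mul (f := fun q : ℝ => (1 - q ^ 2) * q ^ 2) (by fun_prop)
    (analyticAt_sinDeltaIntegral_one_sub_sq 2 hq)

theorem analyticAt_hCoeff {q : ℝ} (hq : q ≠ 0) : AnalyticAt ℝ hCoeff q :=
  AnalyticAt.mul (f := fun q : ℝ => 1 - q ^ 2) (by fun_prop)
    ((analyticAt_sinDeltaIntegral_one_sub_sq 2 hq).sub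
      (analyticAt_sinDeltaIntegral_one_sub_sq 1 hq))

theorem analyticOnNhd_extendedTorusFlow :
    AnalyticOnNhd ℝ extendedTorusFlow {p : ℝ × ℝ × ℝ | p.1 ≠ 0} := by
  intro p hp
  have hfst : AnalyticAt ℝ (fun p : ℝ × ℝ × ℝ => p.1) p := analyticAt_fst
  have hsnd : AnalyticAt ℝ (fun p : ℝ × ℝ × ℝ => p.2.1) p := analyticAt_fst.comp analyticAt_snd
  have htrd : AnalyticAt ℝ (fun p : ℝ × ℝ × ℝ => p.2.2) p := analyticAt_snd.comp analyticAt_snd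
  have hE := (analyticAt_ellipticE' hp).fun_comp hfst
  have hK := (analyticAt_ellipticK' hp).fun_comp hfst
  have hA := (analyticAt_kCoeff hp).fun_comp hfst
  have hB := (analyticAt_hCoeff hp).fun_comp hfst
  refine AnalyticAt.prod (hfst.mul ((hE.mul hsnd).sub ((hfst.mul hK).mul htrd))) ?_
  exact AnalyticAt.prod ((analyticAt_const.sub (hsnd.pow 2)).mul hA)
    ((hfst.mul (analyticAt_const.sub (htrd.pow 2))).mul hB)

/-! ### Zeros of the extended vector field -/

theorem ellipticE'_eq_ellipticK'_of_sq_eq_one {q : ℝ} (hq : q ^ 2 = 1) :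
    ellipticE' q = ellipticK' q := by
  have h0 : (1 : ℝ) - q ^ 2 < 1 := by linarith
  rw [ellipticE', ellipticK', completeEllipticE_eq_sinDeltaIntegral h0,
    completeEllipticK_eq_sinDeltaIntegral h0, hq]
  ring

theorem abs_mul_ellipticK'_lt {q : ℝ} (hq : q ≠ 0) (h1 : q ^ 2 ≠ 1) :
    |q| * ellipticK' q < ellipticE' q := by
  refine mul_completeEllipticK_lt_completeEllipticE (by rw [sq_abs]; ring) (abs_pos.2 hq) ?_
  intro h
  rw [← sq_abs, h] at h1
  norm_num at h1

theorem kCoeff_ne_zero {q : ℝ} (hq : q ≠ 0) (h1 : q ^ 2 ≠ 1) : kCoeff q ≠ 0 :=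
  mul_ne_zero (mul_ne_zero (sub_ne_zero.2 h1.symm) (pow_ne_zero 2 hq))
    (sinDeltaIntegral_pos 2 (one_sub_sq_lt_one hq)).ne'

theorem hCoeff_ne_zero {q : ℝ} (hq : q ≠ 0) (h1 : q ^ 2 ≠ 1) : hCoeff q ≠ 0 :=
  mul_ne_zero (sub_ne_zero.2 h1.symm)
    (sub_ne_zero.2 (sinDeltaIntegral_two_lt_one (one_sub_sq_lt_one hq)).ne)

theorem zeros_extendedTorusFlow :
    {p : ℝ × ℝ × ℝ | p.1 ≠ 0 ∧ extendedTorusFlow p = 0} =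
      {p : ℝ × ℝ × ℝ | p.1 ≠ 0 ∧ p.1 ^ 2 = 1 ∧ p.2.1 = p.1 * p.2.2} := by
  ext ⟨q, k, h⟩
  simp only [mem_ofPred_eq, extendedTorusFlow, Prod.mk_eq_zero]
  refine and_congr_right fun hq => ?_
  by_cases h1 : q ^ 2 = 1
  · have hA : kCoeff q = 0 := by simp [kCoeff, h1]
    have hB : hCoeff q = 0 := by simp [hCoeff, h1]
    have hK := (ellipticK'_pos hq).ne'
    rw [ellipticE'_eq_ellipticK'_of_sq_eq_one h1,
      show ellipticK' q * k - q * ellipticK' q * h = ellipticK' q * (k - q * h) by ring]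
    simp [hA, hB, hK, hq, h1, sub_eq_zero]
  · have hA := kCoeff_ne_zero hq h1
    have hB := hCoeff_ne_zero hq h1
    simp only [mul_eq_zero, hq, hA, hB, h1, or_false, false_or, false_and, iff_false]
    rintro ⟨h2, h3, h4⟩
    -- Since both coefficients are nonzero, the last two components force k² = h² = 1; taking
    -- absolute values in the first then gives E' = |q| K', which the strict inequality excludes.
    have hk : |k| = 1 := (sq_eq_sq₀ (abs_nonneg _) zero_le_one).1 (by rw [sq_abs]; linarith)
    have hh : |h| = 1 := (sq_eq_sq₀ (abs_nonneg _) zero_le_one).1 (by rw [sq_abs]; linarith)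
    have h5 := abs_mul_ellipticK'_lt hq h1
    have hK := ellipticK'_pos hq
    have hE : 0 < ellipticE' q := lt_of_le_of_lt (by positivity) h5
    have h6 := congrArg abs (sub_eq_zero.1 h2)
    rw [abs_mul, abs_mul, abs_mul, hk, hh, abs_of_pos hE, abs_of_pos hK, mul_one, mul_one] at h6
    exact h5.ne' h6

/-! ### Derivatives of E' and K' with respect to q -/

theorem hasDerivAt_ellipticE' {q : ℝ} (hq : q ≠ 0) (h1 : q ^ 2 ≠ 1) :
    HasDerivAt ellipticE' (q * (ellipticK' q - ellipticE' q) / (1 - q ^ 2)) q := by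
  have hm := one_sub_sq_lt_one hq
  have h2 : 1 - q ^ 2 ≠ 0 := sub_ne_zero.2 h1.symm
  have h3 : HasDerivAt (fun q : ℝ => 1 - q ^ 2) (-(2 * q)) q := by
    simpa using (hasDerivAt_pow 2 q).const_sub 1
  refine ((hasDerivAt_completeEllipticE hm).comp q h3).congr_deriv ?_
  rw [ellipticE', ellipticK', completeEllipticE_eq_sinDeltaIntegral hm,
    completeEllipticK_eq_sinDeltaIntegral hm]
  field_simp
  ring

theorem hasDerivAt_ellipticK' {q : ℝ} (hq : q ≠ 0) (h1 : q ^ 2 ≠ 1) :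
    HasDerivAt ellipticK' ((q ^ 2 * ellipticK' q - ellipticE' q) / (q * (1 - q ^ 2))) q := by
  have hm := one_sub_sq_lt_one hq
  have h2 : 1 - q ^ 2 ≠ 0 := sub_ne_zero.2 h1.symm
  have h3 : HasDerivAt (fun q : ℝ => 1 - q ^ 2) (-(2 * q)) q := by
    simpa using (hasDerivAt_pow 2 q).const_sub 1
  refine ((hasDerivAt_completeEllipticK hm).comp q h3).congr_deriv ?_
  have hrel := sinDeltaIntegral_relation hm
  rw [ellipticE', ellipticK', completeEllipticE_eq_sinDeltaIntegral hm,
    completeEllipticK_eq_sinDeltaIntegral hm]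
  field_simp
  linear_combination (1 - q ^ 2) * hrel

/-! ### The phase function on the unit circle -/

/-- Twice the value of `|ν|` over the point `exp (i φ)` of the unit circle. -/
noncomputable def circleRadius (q φ : ℝ) : ℝ := √(1 - 2 * q * Real.cos φ + q ^ 2)

/-- The primitive over the unit circle of the normalised differential of the second kind. -/
noncomputable def circlePhase (q φ : ℝ) : ℝ :=
  ∫ x in (0 : ℝ)..φ, (q * ellipticK' q * Real.cos x - ellipticE' q) / circleRadius q x

theorem circleRadius_sq_pos {q : ℝ} (hq : |q| < 1) (φ : ℝ) :
    0 < 1 - 2 * q * Real.cos φ + q ^ 2 := by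
  have h1 := abs_lt.1 hq
  have h2 := Real.sin_sq_add_cos_sq φ
  have h3 : q * Real.cos φ < 1 := by
    refine lt_of_le_of_lt (le_abs_self _) ?_
    rw [abs_mul]
    exact lt_of_le_of_lt (mul_le_of_le_one_right (abs_nonneg _) (Real.abs_cos_le_one φ)) hq
  have h4 : 1 - 2 * q * Real.cos φ + q ^ 2 =
      (1 - q * Real.cos φ) ^ 2 + (q * Real.sin φ) ^ 2 := by linear_combination (-q ^ 2) * h2
  rw [h4]
  have : 0 < (1 - q * Real.cos φ) ^ 2 := pow_pos (sub_pos.2 h3) 2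
  positivity

theorem circleRadius_pos {q : ℝ} (hq : |q| < 1) (φ : ℝ) : 0 < circleRadius q φ :=
  Real.sqrt_pos.2 (circleRadius_sq_pos hq φ)

theorem sq_circleRadius {q : ℝ} (hq : |q| < 1) (φ : ℝ) :
    circleRadius q φ ^ 2 = 1 - 2 * q * Real.cos φ + q ^ 2 :=
  Real.sq_sqrt (circleRadius_sq_pos hq φ).le

theorem continuous_circleRadius : Continuous fun p : ℝ × ℝ => circleRadius p.1 p.2 := by
  unfold circleRadius; fun_prop

theorem hasDerivAt_circleRadius_comp {q φ : ℝ → ℝ} {q' φ' t : ℝ} (hq : HasDerivAt q q' t)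
    (hφ : HasDerivAt φ φ' t) (h : |q t| < 1) :
    HasDerivAt (fun t => circleRadius (q t) (φ t))
      (((q t - Real.cos (φ t)) * q' + q t * Real.sin (φ t) * φ') / circleRadius (q t) (φ t)) t := by
  have h1 : HasDerivAt (fun t => 1 - 2 * q t * Real.cos (φ t) + q t ^ 2)
      (2 * ((q t - Real.cos (φ t)) * q' + q t * Real.sin (φ t) * φ')) t := by
    refine ((((hq.const_mul 2).mul hφ.cos).const_sub 1).add (hq.pow 2)).congr_deriv ?_
    push_cast; ring
  refine (h1.sqrt (circleRadius_sq_pos h _).ne').congr_deriv ?_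
  rw [circleRadius]
  field_simp

/-- Up to the factor `-hCoeff q`, this derivative is the q-derivative of the integrand of
`circlePhase`, so that the q-derivative of the phase can be integrated in closed form. -/
theorem hasDerivAt_sin_div_circleRadius {q : ℝ} (hq : |q| < 1) (x : ℝ) :
    HasDerivAt (fun x => Real.sin x / circleRadius q x)
      ((Real.cos x - q) * (1 - q * Real.cos x) / circleRadius q x ^ 3) x := by
  have h0 := circleRadius_pos hq x
  have h2 := sq_circleRadius hq x
  refine ((Real.hasDerivAt_sin x).div (hasDerivAt_circleRadius_comp (hasDerivAt_const x q)
    (hasDerivAt_id x) hq) h0.ne').congr_deriv ?_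
  simp only [id]
  have hs := Real.sin_sq_add_cos_sq x
  field_simp
  rw [h2]
  linear_combination (-q) * hs

theorem hasDerivAt_circlePhase_right {q : ℝ} (hq : |q| < 1) (φ : ℝ) :
    HasDerivAt (circlePhase q)
      ((q * ellipticK' q * Real.cos φ - ellipticE' q) / circleRadius q φ) φ := by
  have hc : Continuous fun x => (q * ellipticK' q * Real.cos x - ellipticE' q) /
      circleRadius q x :=
    Continuous.div (by fun_prop) (continuous_circleRadius.comp (by fun_prop : Continuous
      fun x : ℝ => (q, x))) fun x => (circleRadius_pos hq x).ne'
  exact intervalIntegral.integral_hasDerivAt_right (hc.intervalIntegrable _ _)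
    (hc.stronglyMeasurableAtFilter _ _) hc.continuousAt

/-- Changing q changes the normalised differential by an exact one, a multiple of d(sin x / R). In
particular the change vanishes at φ = π, which is why the period over the circle does not depend on
q. -/
theorem hasDerivAt_circlePhase_left {q : ℝ} (h0 : 0 < q) (h1 : q < 1) (φ : ℝ) :
    HasDerivAt (fun q => circlePhase q φ) (-hCoeff q * (Real.sin φ / circleRadius q φ)) q := by
  have hU : ∀ y ∈ Ioo (0 : ℝ) 1, y ≠ 0 ∧ y ^ 2 ≠ 1 ∧ |y| < 1 := fun y hy =>
    ⟨hy.1.ne', by nlinarith [hy.1, hy.2], by rw [abs_of_pos hy.1]; exact hy.2⟩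
  have hcB : ContinuousOn hCoeff (Ioo 0 1) := fun y hy =>
    (analyticAt_hCoeff (hU y hy).1).continuousAt.continuousWithinAt
  have h := hasDerivAt_intervalIntegral_of_continuousOn (𝕜 := ℝ) (isOpen_Ioo (a := (0 : ℝ)) (b := 1))
    (a := 0) (b := φ)
    (F := fun q x => (q * ellipticK' q * Real.cos x - ellipticE' q) / circleRadius q x)
    (F' := fun q x => -hCoeff q *
      ((Real.cos x - q) * (1 - q * Real.cos x) / circleRadius q x ^ 3)) ?_ ?_ ?_ ⟨h0, h1⟩
  · refine h.congr_deriv ?_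
    have hq := (hU q ⟨h0, h1⟩).2.2
    rw [intervalIntegral.integral_const_mul, intervalIntegral.integral_eq_sub_of_hasDerivAt
      (fun x _ => hasDerivAt_sin_div_circleRadius hq x)]
    · simp
    · refine Continuous.intervalIntegrable (Continuous.div (by fun_prop) ?_ fun x => ?_) _ _
      · exact (continuous_circleRadius.comp (by fun_prop : Continuous fun x : ℝ => (q, x))).pow 3
      · exact (pow_pos (circleRadius_pos hq x) 3).ne'
  · intro y hy
    refine (Continuous.div (by fun_prop) (continuous_circleRadius.comp (by fun_prop : Continuous
      fun x : ℝ => (y, x))) fun x => (circleRadius_pos (hU y hy).2.2 x).ne').continuousOn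
  · refine ContinuousOn.mul (hcB.comp continuousOn_fst fun p hp => hp.1).neg ?_
    refine ContinuousOn.div (by fun_prop) (continuous_circleRadius.pow 3).continuousOn ?_
    exact fun p hp => (pow_pos (circleRadius_pos (hU p.1 hp.1).2.2 p.2) 3).ne'
  · intro y hy x _
    obtain ⟨hy0, hy1, hy2⟩ := hU y hy
    have hw := circleRadius_pos hy2 x
    have hw2 := sq_circleRadius hy2 x
    have hm : 1 - y ^ 2 ≠ 0 := sub_ne_zero.2 hy1.symm
    have hB : hCoeff y = (2 * ellipticE' y - (1 + y ^ 2) * ellipticK' y) / (1 - y ^ 2) := by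
      rw [← one_sub_sq_mul_hCoeff hy0]; field_simp
    refine ((((hasDerivAt_id y).mul (hasDerivAt_ellipticK' hy0 hy1)).mul_const
      (Real.cos x)).sub (hasDerivAt_ellipticE' hy0 hy1) |>.div
      (hasDerivAt_circleRadius_comp (hasDerivAt_id y) (hasDerivAt_const y x) hy2) hw.ne').congr_deriv ?_
    simp only [id, Pi.mul_apply, Pi.sub_apply]
    rw [hB]
    field_simp
    rw [hw2]
    ring

/-- Both partial derivatives of the phase are jointly continuous, hence it is differentiable in the
pair (q, φ) and the chain rule applies. -/
theorem hasDerivAt_circlePhase_comp {q φ : ℝ → ℝ} {q' φ' t : ℝ} (hq : HasDerivAt q q' t)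
    (hφ : HasDerivAt φ φ' t) (h0 : 0 < q t) (h1 : q t < 1) :
    HasDerivAt (fun t => circlePhase (q t) (φ t))
      (((q t * ellipticK' (q t) * Real.cos (φ t) - ellipticE' (q t)) * φ' -
        hCoeff (q t) * Real.sin (φ t) * q') / circleRadius (q t) (φ t)) t := by
  have hev : ∀ᶠ v : ℝ × ℝ in 𝓝 (q t, φ t), 0 < v.1 ∧ v.1 < 1 :=
    (continuousAt_fst.eventually (lt_mem_nhds h0)).and (continuousAt_fst.eventually (gt_mem_nhds h1))
  have habs : ∀ {y : ℝ}, 0 < y → y < 1 → |y| < 1 := fun ha hb => by rwa [abs_of_pos ha]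
  have hr : ContinuousAt (fun v : ℝ × ℝ => circleRadius v.1 v.2) (q t, φ t) :=
    continuous_circleRadius.continuousAt
  have hr0 := (circleRadius_pos (habs h0 h1) (φ t)).ne'
  have hcB : ContinuousAt (fun v : ℝ × ℝ => hCoeff v.1) (q t, φ t) :=
    ContinuousAt.comp (g := hCoeff) (f := Prod.fst) (analyticAt_hCoeff h0.ne').continuousAt continuousAt_fst
  have hcE : ContinuousAt (fun v : ℝ × ℝ => ellipticE' v.1) (q t, φ t) :=
    ContinuousAt.comp (g := ellipticE') (f := Prod.fst) (analyticAt_ellipticE' h0.ne').continuousAt continuousAt_fst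
  have hcK : ContinuousAt (fun v : ℝ × ℝ => ellipticK' v.1) (q t, φ t) :=
    ContinuousAt.comp (g := ellipticK') (f := Prod.fst) (analyticAt_ellipticK' h0.ne').continuousAt continuousAt_fst
  have hS := hasStrictFDerivAt_uncurry_coprod (u := (q t, φ t)) (f := circlePhase)
    (f₁ := fun a b => ContinuousLinearMap.toSpanSingleton ℝ
      (-hCoeff a * (Real.sin b / circleRadius a b)))
    (f₂ := fun a b => ContinuousLinearMap.toSpanSingleton ℝ
      ((a * ellipticK' a * Real.cos b - ellipticE' a) / circleRadius a b)) ?_ ?_ ?_ ?_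
  · have := hS.hasFDerivAt.comp_hasDerivAt t (hq.prodMk hφ)
    refine this.congr_deriv ?_
    simp only [ContinuousLinearMap.coprod_apply, Function.HasUncurry.uncurry, id,
      ContinuousLinearMap.toSpanSingleton_apply, smul_eq_mul]
    ring
  · filter_upwards [hev] with v hv using (hasDerivAt_circlePhase_left hv.1 hv.2 v.2).hasFDerivAt
  · filter_upwards [hev] with v hv using
      (hasDerivAt_circlePhase_right (habs hv.1 hv.2) v.2).hasFDerivAt
  · exact (ContinuousLinearMap.toSpanSingletonCLE (𝕜 := ℝ) (E := ℝ)).continuous.continuousAt.comp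
      (hcB.neg.mul (ContinuousAt.div (by fun_prop) hr hr0))
  · exact (ContinuousLinearMap.toSpanSingletonCLE (𝕜 := ℝ) (E := ℝ)).continuous.continuousAt.comp
      (ContinuousAt.div (((continuousAt_fst.mul hcK).mul (by fun_prop)).sub hcE) hr hr0)

theorem circlePhase_neg (q φ : ℝ) : circlePhase q (-φ) = -circlePhase q φ := by
  have h := intervalIntegral.integral_comp_neg (a := 0) (b := φ)
    (fun x => (q * ellipticK' q * Real.cos x - ellipticE' q) / circleRadius q x)
  simp only [circleRadius, Real.cos_neg, neg_zero] at h
  rw [circlePhase, circlePhase, intervalIntegral.integral_symm]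
  simp only [circleRadius]
  rw [← h]

/-! ### The flow -/

/-- Picard–Lindelöf gives a differentiable solution that stays in U for short time. Bootstrapping
makes it smooth: if γ is C^n, then so is γ' = f ∘ γ, hence γ is C^{n+1}. -/
theorem exists_contDiffOn_integralCurve {E : Type*} [NormedAddCommGroup E] [NormedSpace ℝ E]
    [CompleteSpace E] {f : E → E} {U : Set E} (hU : IsOpen U) (hf : ContDiffOn ℝ ∞ f U) {x₀ : E}
    (hx : x₀ ∈ U) : ∃ ε > (0 : ℝ), ∃ γ : ℝ → E, γ 0 = x₀ ∧ ContDiffOn ℝ ∞ γ (Ioo (-ε) ε) ∧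
      ∀ t ∈ Ioo (-ε) ε, γ t ∈ U ∧ HasDerivAt γ (f (γ t)) t := by
  have hf1 : ContDiffAt ℝ 1 f x₀ :=
    ((hf.contDiffAt (hU.mem_nhds hx)).of_le (by exact_mod_cast le_top))
  obtain ⟨γ, hγ0, ε₁, hε₁, hγ⟩ :=
    hf1.exists_forall_mem_closedBall_exists_eq_forall_mem_Ioo_hasDerivAt₀ 0
  rw [zero_sub, zero_add] at hγ
  have hc : ContinuousAt γ 0 := (hγ 0 ⟨by linarith, hε₁⟩).continuousAt
  obtain ⟨ε₂, hε₂, hball⟩ := Metric.mem_nhds_iff.1 (hc (hU.mem_nhds (hγ0 ▸ hx)))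
  rw [Real.ball_eq_Ioo, zero_sub, zero_add] at hball
  have hd : ∀ t ∈ Ioo (-(min ε₁ ε₂)) (min ε₁ ε₂), γ t ∈ U ∧ HasDerivAt γ (f (γ t)) t := by
    intro t ht
    have h1 := min_le_left ε₁ ε₂
    have h2 := min_le_right ε₁ ε₂
    exact ⟨hball ⟨by linarith [ht.1], by linarith [ht.2]⟩,
      hγ t ⟨by linarith [ht.1], by linarith [ht.2]⟩⟩
  refine ⟨min ε₁ ε₂, lt_min hε₁ hε₂, γ, hγ0, ?_, hd⟩
  rw [contDiffOn_infty]
  intro n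
  induction n with
  | zero => exact contDiffOn_zero.2 fun t ht => (hd t ht).2.continuousAt.continuousWithinAt
  | succ n ih =>
    have : ((n + 1 : ℕ) : WithTop ℕ∞) = (n : WithTop ℕ∞) + 1 := by push_cast; rfl
    rw [this, contDiffOn_succ_iff_deriv_of_isOpen isOpen_Ioo]
    refine ⟨fun t ht => (hd t ht).2.differentiableAt.differentiableWithinAt, by simp, ?_⟩
    refine ((hf.of_le (by exact_mod_cast le_top)).comp ih fun t ht => (hd t ht).1).congr ?_
    exact fun t ht => (hd t ht).2.deriv

/-- Solutions of the lift of the flow to the modulus `q` and the sum `α` and the difference `β` of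
the angles of the sym points. -/
structure IsAngleFlow (q α β : ℝ → ℝ) (s : Set ℝ) : Prop where
  pos : ∀ t ∈ s, 0 < q t
  lt_one : ∀ t ∈ s, q t < 1
  deriv_q : ∀ t ∈ s, HasDerivAt q
    (q t * (ellipticE' (q t) * Real.cos (α t) - q t * ellipticK' (q t) * Real.cos (β t))) t
  deriv_α : ∀ t ∈ s, HasDerivAt α (-(Real.sin (α t) * kCoeff (q t))) t
  deriv_β : ∀ t ∈ s, HasDerivAt β (-(Real.sin (β t) * (q t * hCoeff (q t)))) t

theorem exists_angleFlow {q₀ : ℝ} (h0 : 0 < q₀) (h1 : q₀ < 1) (α₀ β₀ : ℝ) :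
    ∃ ε > (0 : ℝ), ∃ q α β : ℝ → ℝ, q 0 = q₀ ∧ α 0 = α₀ ∧ β 0 = β₀ ∧
      ContDiffOn ℝ ∞ q (Ioo (-ε) ε) ∧ ContDiffOn ℝ ∞ α (Ioo (-ε) ε) ∧
      ContDiffOn ℝ ∞ β (Ioo (-ε) ε) ∧ IsAngleFlow q α β (Ioo (-ε) ε) := by
  set U : Set (ℝ × ℝ × ℝ) := {p | 0 < p.1 ∧ p.1 < 1} with hUdef
  have hU : IsOpen U :=
    (isOpen_lt continuous_const continuous_fst).inter (isOpen_lt continuous_fst continuous_const)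
  set f : ℝ × ℝ × ℝ → ℝ × ℝ × ℝ := fun p =>
    (p.1 * (ellipticE' p.1 * Real.cos p.2.1 - p.1 * ellipticK' p.1 * Real.cos p.2.2),
      -(Real.sin p.2.1 * kCoeff p.1), -(Real.sin p.2.2 * (p.1 * hCoeff p.1))) with hfdef
  have hf : ContDiffOn ℝ ∞ f U := by
    intro p hp
    refine ContDiffAt.contDiffWithinAt ?_
    have hp0 : p.1 ≠ 0 := hp.1.ne'
    have hE : ContDiffAt ℝ ∞ (fun p : ℝ × ℝ × ℝ => ellipticE' p.1) p :=
      (analyticAt_ellipticE' hp0).contDiffAt.comp p contDiffAt_fst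
    have hK : ContDiffAt ℝ ∞ (fun p : ℝ × ℝ × ℝ => ellipticK' p.1) p :=
      (analyticAt_ellipticK' hp0).contDiffAt.comp p contDiffAt_fst
    have hA : ContDiffAt ℝ ∞ (fun p : ℝ × ℝ × ℝ => kCoeff p.1) p :=
      (analyticAt_kCoeff hp0).contDiffAt.comp p contDiffAt_fst
    have hB : ContDiffAt ℝ ∞ (fun p : ℝ × ℝ × ℝ => hCoeff p.1) p :=
      (analyticAt_hCoeff hp0).contDiffAt.comp p contDiffAt_fst
    have hc1 : ContDiffAt ℝ ∞ (fun p : ℝ × ℝ × ℝ => Real.cos p.2.1) p := by fun_prop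
    have hc2 : ContDiffAt ℝ ∞ (fun p : ℝ × ℝ × ℝ => Real.cos p.2.2) p := by fun_prop
    have hs1 : ContDiffAt ℝ ∞ (fun p : ℝ × ℝ × ℝ => Real.sin p.2.1) p := by fun_prop
    have hs2 : ContDiffAt ℝ ∞ (fun p : ℝ × ℝ × ℝ => Real.sin p.2.2) p := by fun_prop
    exact (contDiffAt_fst.mul ((hE.mul hc1).sub ((contDiffAt_fst.mul hK).mul hc2))).prodMk
      ((hs1.mul hA).neg.prodMk (hs2.mul (contDiffAt_fst.mul hB)).neg)
  obtain ⟨ε, hε, γ, hγ0, hγ, hd⟩ :=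
    exists_contDiffOn_integralCurve hU hf (x₀ := (q₀, α₀, β₀)) ⟨h0, h1⟩
  have hd1 : ∀ t ∈ Ioo (-ε) ε, HasDerivAt (fun t => (γ t).1) (f (γ t)).1 t := fun t ht =>
    (ContinuousLinearMap.fst ℝ ℝ (ℝ × ℝ)).hasFDerivAt.comp_hasDerivAt t (hd t ht).2
  have hd2 : ∀ t ∈ Ioo (-ε) ε, HasDerivAt (fun t => (γ t).2) (f (γ t)).2 t := fun t ht =>
    (ContinuousLinearMap.snd ℝ ℝ (ℝ × ℝ)).hasFDerivAt.comp_hasDerivAt t (hd t ht).2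
  refine ⟨ε, hε, fun t => (γ t).1, fun t => (γ t).2.1, fun t => (γ t).2.2, by simp [hγ0], by simp [hγ0],
    by simp [hγ0], contDiff_fst.comp_contDiffOn hγ,
    contDiff_fst.comp_contDiffOn (contDiff_snd.comp_contDiffOn hγ),
    contDiff_snd.comp_contDiffOn (contDiff_snd.comp_contDiffOn hγ), fun t ht => (hd t ht).1.1,
    fun t ht => (hd t ht).1.2, hd1, fun t ht => ?_, fun t ht => ?_⟩
  · exact (ContinuousLinearMap.fst ℝ ℝ ℝ).hasFDerivAt.comp_hasDerivAt t (hd2 t ht)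
  · exact (ContinuousLinearMap.snd ℝ ℝ ℝ).hasFDerivAt.comp_hasDerivAt t (hd2 t ht)

theorem hasDerivAt_cos_of_angleFlow {α : ℝ → ℝ} {a t : ℝ}
    (h : HasDerivAt α (-(Real.sin (α t) * a)) t) :
    HasDerivAt (fun t => Real.cos (α t)) ((1 - Real.cos (α t) ^ 2) * a) t := by
  refine h.cos.congr_deriv ?_
  rw [← Real.sin_sq]; ring

theorem eq_of_hasDerivAt_zero {f : ℝ → ℝ} {ε : ℝ}
    (h : ∀ t ∈ Ioo (-ε) ε, HasDerivAt f 0 t) {t : ℝ} (ht : t ∈ Ioo (-ε) ε) : f t = f 0 := by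
  have hε : 0 < ε := by linarith [ht.1, ht.2]
  refine isOpen_Ioo.is_const_of_deriv_eq_zero isPreconnected_Ioo
    (fun x hx => (h x hx).differentiableAt.differentiableWithinAt) (fun x hx => (h x hx).deriv) ht
    ⟨by linarith, hε⟩

/-! ### Conserved quantities along the lifted flow -/

namespace IsAngleFlow

variable {q α β : ℝ → ℝ} {ε : ℝ}

theorem abs_lt_one (h : IsAngleFlow q α β (Ioo (-ε) ε)) {t : ℝ} (ht : t ∈ Ioo (-ε) ε) :
    |q t| < 1 := by
  rw [abs_of_pos (h.pos t ht)]; exact h.lt_one t ht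

/-- Exchanging the two sym points is a symmetry of the lifted flow, so every formula at the angle α
+ β also gives one at α - β. -/
theorem neg_right (h : IsAngleFlow q α β (Ioo (-ε) ε)) :
    IsAngleFlow q α (fun t => -β t) (Ioo (-ε) ε) where
  pos := h.pos
  lt_one := h.lt_one
  deriv_q t ht := by simpa only [Real.cos_neg] using h.deriv_q t ht
  deriv_α := h.deriv_α
  deriv_β t ht := by simpa only [Real.sin_neg, neg_mul] using (h.deriv_β t ht).fun_neg

/-- The point of this form is that the logarithmic derivative involves β only through cos β. It is
therefore the same at α + β and α - β. -/
theorem hasDerivAt_circleRadius (h : IsAngleFlow q α β (Ioo (-ε) ε)) {t : ℝ}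
    (ht : t ∈ Ioo (-ε) ε) :
    HasDerivAt (fun t => circleRadius (q t) (α t + β t))
      (q t * (q t * (ellipticK' (q t) - ellipticE' (q t)) * Real.cos (α t) +
        (q t ^ 2 * ellipticK' (q t) - ellipticE' (q t)) * Real.cos (β t)) / (1 - q t ^ 2) *
        circleRadius (q t) (α t + β t)) t := by
  have hq := h.abs_lt_one ht
  have hq0 := h.pos t ht
  have hp := circleRadius_pos hq (α t + β t)
  have hp2 := sq_circleRadius hq (α t + β t)
  have hm : 1 - q t ^ 2 ≠ 0 := by nlinarith [h.lt_one t ht]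
  refine (hasDerivAt_circleRadius_comp (h.deriv_q t ht) ((h.deriv_α t ht).fun_add (h.deriv_β t ht))
    hq).congr_deriv ?_
  rw [div_mul_eq_mul_div, div_eq_div_iff hp.ne' hm, mul_assoc _ (circleRadius _ _), ← sq, hp2,
    Real.cos_add, Real.sin_add]
  have h1 := Real.sin_sq_add_cos_sq (α t)
  have h2 := Real.sin_sq_add_cos_sq (β t)
  have hA := one_sub_sq_mul_kCoeff hq0.ne'
  have hB := one_sub_sq_mul_hCoeff hq0.ne'
  -- The coefficients replace (1 - q²) times each coefficient of the field by its expression in E'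
  -- and K', and then remove the squares of sines.
  linear_combination
    (-q t * Real.sin (α t) * (Real.sin (α t) * Real.cos (β t) + Real.cos (α t) * Real.sin (β t))) *
      hA + (-q t ^ 2 * Real.sin (β t) * (Real.sin (α t) * Real.cos (β t) +
        Real.cos (α t) * Real.sin (β t))) * hB +
    (-q t * Real.cos (β t) * ((1 + q t ^ 2) * ellipticE' (q t) - 2 * q t ^ 2 * ellipticK' (q t))) *
      h1 + (-q t ^ 2 * Real.cos (α t) *
        (2 * ellipticE' (q t) - (1 + q t ^ 2) * ellipticK' (q t))) * h2

/-- Divided by the radius at the same angle, this derivative no longer contains β, so the phases at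
the two sym points move proportionally to the radii. -/
theorem hasDerivAt_circlePhase (h : IsAngleFlow q α β (Ioo (-ε) ε)) {t : ℝ}
    (ht : t ∈ Ioo (-ε) ε) :
    HasDerivAt (fun t => circlePhase (q t) (α t + β t))
      (Real.sin (α t) * (ellipticE' (q t) ^ 2 - q t ^ 2 * ellipticK' (q t) ^ 2) / (1 - q t ^ 2) *
        circleRadius (q t) (α t + β t)) t := by
  have hq := h.abs_lt_one ht
  have hq0 := h.pos t ht
  have hp := circleRadius_pos hq (α t + β t)
  have hp2 := sq_circleRadius hq (α t + β t)
  have hm : 1 - q t ^ 2 ≠ 0 := by nlinarith [h.lt_one t ht]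
  refine (hasDerivAt_circlePhase_comp (h.deriv_q t ht) ((h.deriv_α t ht).fun_add (h.deriv_β t ht))
    hq0 (h.lt_one t ht)).congr_deriv ?_
  rw [div_mul_eq_mul_div, div_eq_div_iff hp.ne' hm, mul_assoc _ (circleRadius _ _), ← sq, hp2,
    Real.cos_add, Real.sin_add]
  have h1 := Real.sin_sq_add_cos_sq (α t)
  have h2 := Real.sin_sq_add_cos_sq (β t)
  have hA := one_sub_sq_mul_kCoeff hq0.ne'
  have hB := one_sub_sq_mul_hCoeff hq0.ne'
  linear_combination
    (-Real.sin (α t) * (q t * ellipticK' (q t) *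
      (Real.cos (α t) * Real.cos (β t) - Real.sin (α t) * Real.sin (β t)) - ellipticE' (q t))) *
      hA + (-q t * Real.sin (β t) * (q t * ellipticK' (q t) *
      (Real.cos (α t) * Real.cos (β t) - Real.sin (α t) * Real.sin (β t)) - ellipticE' (q t)) -
      (Real.sin (α t) * Real.cos (β t) + Real.cos (α t) * Real.sin (β t)) * (q t *
      (ellipticE' (q t) * Real.cos (α t) - q t * ellipticK' (q t) * Real.cos (β t)))) * hB +
    (-q t * Real.sin (β t) * ellipticE' (q t) *
      (2 * ellipticE' (q t) - (1 + q t ^ 2) * ellipticK' (q t))) * h1 +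
    (q t ^ 2 * Real.sin (α t) * ellipticK' (q t) *
      (2 * ellipticE' (q t) - (1 + q t ^ 2) * ellipticK' (q t))) * h2

/-- Along the flow, the quotient of the values of `ν` over the two sym points is constant. -/
theorem circleRadius_div (h : IsAngleFlow q α β (Ioo (-ε) ε)) {t : ℝ} (ht : t ∈ Ioo (-ε) ε) :
    circleRadius (q t) (α t - β t) / circleRadius (q t) (α t + β t) =
      circleRadius (q 0) (α 0 - β 0) / circleRadius (q 0) (α 0 + β 0) := by
  refine eq_of_hasDerivAt_zero
    (f := fun t => circleRadius (q t) (α t - β t) / circleRadius (q t) (α t + β t))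
    (fun t ht => ?_) ht
  refine ((h.neg_right.hasDerivAt_circleRadius ht).div (h.hasDerivAt_circleRadius ht)
    (circleRadius_pos (h.abs_lt_one ht) _).ne').congr_deriv ?_
  simp only [Real.cos_neg]
  ring

/-- Along the flow, the two phases at the sym points change proportionally to the values of `ν`. -/
theorem circlePhase_sub (h : IsAngleFlow q α β (Ioo (-ε) ε)) {r t : ℝ} (ht : t ∈ Ioo (-ε) ε)
    (hr : ∀ t ∈ Ioo (-ε) ε, circleRadius (q t) (α t - β t) = r * circleRadius (q t) (α t + β t)) :
    circlePhase (q t) (α t - β t) - r * circlePhase (q t) (α t + β t) =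
      circlePhase (q 0) (α 0 - β 0) - r * circlePhase (q 0) (α 0 + β 0) := by
  refine eq_of_hasDerivAt_zero
    (f := fun t => circlePhase (q t) (α t - β t) - r * circlePhase (q t) (α t + β t))
    (fun t ht => ?_) ht
  refine ((h.neg_right.hasDerivAt_circlePhase ht).sub
    ((h.hasDerivAt_circlePhase ht).const_mul r)).congr_deriv ?_
  rw [← sub_eq_add_neg, hr t ht]
  ring

/-- The angle π is fixed and the q-derivative of the phase carries the factor sin φ, so the period
over the unit circle is conserved; this plays the role of Legendre's relation. -/
theorem circlePhase_pi (h : IsAngleFlow q α β (Ioo (-ε) ε)) {t : ℝ} (ht : t ∈ Ioo (-ε) ε) :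
    circlePhase (q t) π = circlePhase (q 0) π := by
  refine eq_of_hasDerivAt_zero (f := fun t => circlePhase (q t) π) (fun t ht => ?_) ht
  refine (hasDerivAt_circlePhase_comp (h.deriv_q t ht) (hasDerivAt_const t π) (h.pos t ht)
    (h.lt_one t ht)).congr_deriv ?_
  simp

end IsAngleFlow

theorem contDiffOn_circleRadius {q φ : ℝ → ℝ} {s : Set ℝ} (hq : ContDiffOn ℝ ∞ q s)
    (hφ : ContDiffOn ℝ ∞ φ s) (h : ∀ t ∈ s, |q t| < 1) :
    ContDiffOn ℝ ∞ (fun t => circleRadius (q t) (φ t)) s := by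
  refine ContDiffOn.sqrt ?_ fun t ht => (circleRadius_sq_pos (h t ht) _).ne'
  exact ((contDiffOn_const.sub ((contDiffOn_const.mul hq).mul hφ.cos)).add (hq.pow 2))

theorem contDiffOn_ellipticK' {q : ℝ → ℝ} {s : Set ℝ} (hq : ContDiffOn ℝ ∞ q s)
    (h : ∀ t ∈ s, q t ≠ 0) : ContDiffOn ℝ ∞ (fun t => ellipticK' (q t)) s := fun t ht =>
  (analyticAt_ellipticK' (h t ht)).contDiffAt.comp_contDiffWithinAt t (hq t ht)

theorem contDiffOn_ellipticE' {q : ℝ → ℝ} {s : Set ℝ} (hq : ContDiffOn ℝ ∞ q s)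
    (h : ∀ t ∈ s, q t ≠ 0) : ContDiffOn ℝ ∞ (fun t => ellipticE' (q t)) s := fun t ht =>
  (analyticAt_ellipticE' (h t ht)).contDiffAt.comp_contDiffWithinAt t (hq t ht)

/-- The explicit derivative along the flow is already smooth in t, so no joint smoothness of the
phase in (q, φ) is needed. -/
theorem IsAngleFlow.contDiffOn_circlePhase {q α β : ℝ → ℝ} {ε : ℝ}
    (h : IsAngleFlow q α β (Ioo (-ε) ε)) (hq : ContDiffOn ℝ ∞ q (Ioo (-ε) ε))
    (hα : ContDiffOn ℝ ∞ α (Ioo (-ε) ε)) (hβ : ContDiffOn ℝ ∞ β (Ioo (-ε) ε)) :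
    ContDiffOn ℝ ∞ (fun t => circlePhase (q t) (α t + β t)) (Ioo (-ε) ε) := by
  rw [contDiffOn_infty_iff_deriv_of_isOpen isOpen_Ioo]
  refine ⟨fun t ht => (h.hasDerivAt_circlePhase ht).differentiableAt.differentiableWithinAt, ?_⟩
  have hE := contDiffOn_ellipticE' hq fun t ht => (h.pos t ht).ne'
  have hK := contDiffOn_ellipticK' hq fun t ht => (h.pos t ht).ne'
  refine ContDiffOn.congr ?_ fun t ht => (h.hasDerivAt_circlePhase ht).deriv
  refine ((hα.sin.mul ((hE.pow 2).sub ((hq.pow 2).mul (hK.pow 2)))).div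
    (contDiffOn_const.sub (hq.pow 2)) fun t ht => ?_).mul
    (contDiffOn_circleRadius hq (hα.add hβ) fun t ht => h.abs_lt_one ht)
  nlinarith [h.lt_one t ht, h.pos t ht]

/-! ### Logarithmic primitives on the spectral curve -/

/-- The function `ν²` of `l` on the spectral curve. -/
noncomputable def curveSq (q : ℝ) (l : ℂ) : ℂ := (l - q) * (l⁻¹ - q) / 4

/-- The derivative of `curveSq`. -/
noncomputable def curveSqDeriv (q : ℝ) (l : ℂ) : ℂ := q * ((l ^ 2)⁻¹ - 1) / 4

theorem mem_spectralCurve_iff {q : ℝ} {p : ℂ × ℂ} :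
    p ∈ spectralCurve q ↔ p.1 ≠ 0 ∧ p.2 ^ 2 = curveSq q p.1 := by
  refine and_congr_right fun _ => ?_
  rw [curveSq, eq_div_iff (by norm_num), mul_comm]

theorem hasDerivAt_curveSq (q : ℝ) {l : ℂ} (hl : l ≠ 0) :
    HasDerivAt (curveSq q) (curveSqDeriv q l) l := by
  refine ((((hasDerivAt_id l).sub_const (q : ℂ)).mul
    ((hasDerivAt_inv hl).sub_const (q : ℂ))).div_const 4).congr_deriv ?_
  simp only [id, curveSqDeriv]
  field_simp
  ring

theorem analyticAt_curveSq (q : ℝ) {l : ℂ} (hl : l ≠ 0) : AnalyticAt ℂ (curveSq q) l := by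
  unfold curveSq
  fun_prop (disch := assumption)

theorem curveSq_inv (q : ℝ) (l : ℂ) : curveSq q l⁻¹ = curveSq q l := by
  simp only [curveSq, inv_inv]; ring

theorem curveSqDeriv_inv (q : ℝ) {l : ℂ} (hl : l ≠ 0) :
    curveSqDeriv q l⁻¹ = -l ^ 2 * curveSqDeriv q l := by
  simp only [curveSqDeriv]; field_simp; ring

theorem curveSq_star (q : ℝ) (l : ℂ) : curveSq q (star l) = star (curveSq q l) := by
  simp [curveSq]

theorem sigmaInv_mem {q : ℝ} {p : ℂ × ℂ} (hp : p ∈ spectralCurve q) :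
    sigmaInv p ∈ spectralCurve q := by
  rw [mem_spectralCurve_iff] at hp ⊢
  exact ⟨hp.1, by simpa [sigmaInv] using hp.2⟩

theorem exists_mem_spectralCurve (q : ℝ) {l : ℂ} (hl : l ≠ 0) :
    ∃ ν : ℂ, (l, ν) ∈ spectralCurve q := by
  obtain ⟨ν, hν⟩ := IsAlgClosed.exists_pow_nat_eq (curveSq q l) (n := 2) (by norm_num)
  exact ⟨ν, mem_spectralCurve_iff.2 ⟨hl, hν⟩⟩

theorem exists_local_branch {q : ℝ} {p : ℂ × ℂ} (hp : p ∈ spectralCurve q) (hν : p.2 ≠ 0) :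
    ∃ b : ℂ → ℂ, b p.1 = p.2 ∧ AnalyticAt ℂ b p.1 ∧ (∀ᶠ l in 𝓝 p.1, (l, b l) ∈ spectralCurve q) ∧
      HasDerivAt b (curveSqDeriv q p.1 / 2 * p.2⁻¹) p.1 := by
  rw [mem_spectralCurve_iff] at hp
  have hN : curveSq q p.1 ≠ 0 := hp.2 ▸ pow_ne_zero 2 hν
  have hone : curveSq q p.1 / curveSq q p.1 ∈ Complex.slitPlane := by
    rw [div_self hN]; exact Complex.one_mem_slitPlane
  -- Dividing by the value at the base point moves the argument of the root to 1, where the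
  -- principal square root is analytic; the factor `p.2` selects the sheet.
  have han : AnalyticAt ℂ (fun l => p.2 * (curveSq q l / curveSq q p.1) ^ (1 / 2 : ℂ)) p.1 :=
    analyticAt_const.mul ((analyticAt_curveSq q hp.1).div_const.cpow analyticAt_const hone)
  have h0 : p.2 * (curveSq q p.1 / curveSq q p.1) ^ (1 / 2 : ℂ) = p.2 := by
    rw [div_self hN, Complex.one_cpow, mul_one]
  have hsq : ∀ l, (p.2 * (curveSq q l / curveSq q p.1) ^ (1 / 2 : ℂ)) ^ 2 = curveSq q l := by
    intro l
    rw [mul_pow, ← Complex.cpow_nat_mul, hp.2]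
    norm_num
    field_simp
  refine ⟨_, h0, han, ?_, ?_⟩
  · filter_upwards [isOpen_ne.mem_nhds hp.1] with l hl
    exact mem_spectralCurve_iff.2 ⟨hl, hsq l⟩
  · have h1 := han.differentiableAt.hasDerivAt
    have h2 := (h1.pow 2).unique
      ((hasDerivAt_curveSq q hp.1).congr_of_eventuallyEq (Eventually.of_forall hsq))
    refine h1.congr_deriv ?_
    simp only [h0] at h2
    rw [← h2]
    push_cast
    field_simp

/-- On the spectral curve, `d ln μ = ξ dl / (l ν)`. The condition is expressed by the derivative of
local extensions of `μ` along the tangent vector `(ν, (ν²)' / 2)`. -/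
def IsLogPrimitive (q : ℝ) (ξ : ℂ → ℂ) (μ : ℂ × ℂ → ℂ) : Prop :=
  ∀ p ∈ spectralCurve q, ∃ F : ℂ × ℂ → ℂ, AnalyticAt ℂ F p ∧
    (∀ᶠ z in 𝓝[spectralCurve q] p, μ z = F z) ∧
    fderiv ℂ F p (p.2, curveSqDeriv q p.1 / 2) = ξ p.1 / p.1 * F p

theorem IsLogPrimitive.holomorphicOnCurve {q : ℝ} {ξ : ℂ → ℂ} {μ : ℂ × ℂ → ℂ}
    (h : IsLogPrimitive q ξ μ) : HolomorphicOnCurve q μ := fun p hp =>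
  let ⟨F, hF, hμ, _⟩ := h p hp
  ⟨F, hF, hμ⟩

/-- The factor r plays the role of dl/(ν du) along the parametrised curve. Writing velocities as
multiples of the tangent vector (ν, (ν²)'/2) keeps the statement valid at branch points. The field 𝕜
allows both real paths and complex local parameters. -/
theorem IsLogPrimitive.hasDerivAt {𝕜 : Type*} [NontriviallyNormedField 𝕜] [NormedAlgebra 𝕜 ℂ]
    {q : ℝ} {ξ : ℂ → ℂ} {μ : ℂ × ℂ → ℂ} (h : IsLogPrimitive q ξ μ) {x y : 𝕜 → ℂ} {u : 𝕜} {r : ℂ}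
    (hx : HasDerivAt x (y u * r) u) (hy : HasDerivAt y (curveSqDeriv q (x u) / 2 * r) u)
    (hc : ∀ᶠ v in 𝓝 u, (x v, y v) ∈ spectralCurve q) :
    HasDerivAt (fun v => μ (x v, y v)) (r * ξ (x u) / x u * μ (x u, y u)) u := by
  obtain ⟨F, hF, hμ, hD⟩ := h (x u, y u) hc.self_of_nhds
  have hxy := hx.prodMk hy
  have h1 := (hF.differentiableAt.hasFDerivAt.restrictScalars 𝕜).comp_hasDerivAt u hxy
  have h2 : ∀ᶠ v in 𝓝 u, μ (x v, y v) = F (x v, y v) :=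
    (tendsto_nhdsWithin_iff.2 ⟨hxy.continuousAt, hc⟩).eventually hμ
  refine (h1.congr_of_eventuallyEq h2).congr_deriv ?_
  have h3 : (y u * r, curveSqDeriv q (x u) / 2 * r) = r • (y u, curveSqDeriv q (x u) / 2) := by
    simp [mul_comm]
  rw [ContinuousLinearMap.coe_restrictScalars', h3, map_smul, hD, h2.self_of_nhds, smul_eq_mul]
  ring

/-- The map (l, ν) ↦ (l⁻¹, ν) preserves the curve, exchanges y⁺ and y⁻, and changes the sign of
dl/l. It transfers every statement at y⁺ to y⁻. -/
theorem IsLogPrimitive.inv {q : ℝ} {ξ : ℂ → ℂ} {μ : ℂ × ℂ → ℂ} (h : IsLogPrimitive q ξ μ) :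
    IsLogPrimitive q (fun l => -ξ l⁻¹) (fun p => μ (p.1⁻¹, p.2)) := by
  intro p hp
  rw [mem_spectralCurve_iff] at hp
  have hmem : ∀ z ∈ spectralCurve q, (z.1⁻¹, z.2) ∈ spectralCurve q := fun z hz => by
    rw [mem_spectralCurve_iff] at hz ⊢
    exact ⟨inv_ne_zero hz.1, hz.2.trans (curveSq_inv q z.1).symm⟩
  obtain ⟨F, hF, hμ, hD⟩ := h (p.1⁻¹, p.2) (hmem p (mem_spectralCurve_iff.2 hp))
  have hi : AnalyticAt ℂ (fun z : ℂ × ℂ => (z.1⁻¹, z.2)) p :=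
    (analyticAt_fst.inv hp.1).prod analyticAt_snd
  refine ⟨fun z => F (z.1⁻¹, z.2), AnalyticAt.comp_of_eq hF hi rfl, ?_, ?_⟩
  · refine (tendsto_nhdsWithin_iff.2 ⟨hi.continuousAt.continuousWithinAt, ?_⟩).eventually hμ
    filter_upwards [self_mem_nhdsWithin] with z hz using hmem z hz
  · have hinv : HasFDerivAt (fun z : ℂ × ℂ => z.1⁻¹)
        ((-(p.1 ^ 2)⁻¹) • ContinuousLinearMap.fst ℂ ℂ ℂ) p :=
      (hasDerivAt_inv hp.1).comp_hasFDerivAt p hasFDerivAt_fst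
    have h1 := hF.differentiableAt.hasFDerivAt.comp p (hinv.prodMk hasFDerivAt_snd)
    have h2 : fderiv ℂ (fun z : ℂ × ℂ => F (z.1⁻¹, z.2)) p = _ := h1.fderiv
    rw [h2]
    simp only [ContinuousLinearMap.comp_apply, ContinuousLinearMap.prod_apply,
      smul_apply, ContinuousLinearMap.coe_fst', ContinuousLinearMap.coe_snd',
      smul_eq_mul]
    have h3 : (-(p.1 ^ 2)⁻¹ * p.2, curveSqDeriv q p.1 / 2) =
        (-(p.1 ^ 2)⁻¹) • (p.2, curveSqDeriv q p.1⁻¹ / 2) := by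
      rw [curveSqDeriv_inv q hp.1]
      have := hp.1
      ext
      · simp
      · simp; field_simp
    rw [h3, map_smul, hD, smul_eq_mul]
    have := hp.1
    field_simp

theorem HasSingularPartAtInfinity.inv {q : ℝ} {μ : ℂ × ℂ → ℂ} {c : ℂ}
    (h : HasSingularPartAtInfinity q μ c) :
    HasSingularPartAtZero q (fun p => μ (p.1⁻¹, p.2)) c := by
  obtain ⟨G, hG, R, hR, h⟩ := h
  refine ⟨G, hG, R⁻¹, inv_pos.2 hR, fun p hp hpR => ?_⟩
  rw [mem_spectralCurve_iff] at hp
  refine h (p.1⁻¹, p.2) (mem_spectralCurve_iff.2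
    ⟨inv_ne_zero hp.1, hp.2.trans (curveSq_inv q p.1).symm⟩) ?_
  rw [norm_inv]
  exact (lt_inv_comm₀ hR (norm_pos_iff.2 hp.1)).2 hpR

theorem HasSingularPartAtZero.inv {q : ℝ} {μ : ℂ × ℂ → ℂ} {c : ℂ}
    (h : HasSingularPartAtZero q (fun p => μ (p.1⁻¹, p.2)) c) :
    HasSingularPartAtInfinity q μ c := by
  obtain ⟨G, hG, δ, hδ, h⟩ := h
  refine ⟨G, hG, δ⁻¹, inv_pos.2 hδ, fun p hp hpR => ?_⟩
  rw [mem_spectralCurve_iff] at hp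
  have := h (p.1⁻¹, p.2) (mem_spectralCurve_iff.2
    ⟨inv_ne_zero hp.1, hp.2.trans (curveSq_inv q p.1).symm⟩) ?_
  · simpa using this
  · rw [norm_inv]
    exact (inv_lt_comm₀ hδ (norm_pos_iff.2 hp.1)).1 hpR

theorem tendsto_curveSq_inv_zero {q : ℝ} (hq : q ≠ 0) :
    Tendsto (fun l => (curveSq q l)⁻¹) (𝓝[≠] 0) (𝓝 0) := by
  have h1 : Tendsto (fun l : ℂ => 4 * l / ((l - q) * (1 - q * l))) (𝓝 0) (𝓝 0) := by
    have : ContinuousAt (fun l : ℂ => 4 * l / ((l - q) * (1 - q * l))) 0 :=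
      ContinuousAt.div (by fun_prop) (by fun_prop) (by simpa using hq)
    simpa [ContinuousAt] using this
  refine (h1.mono_left nhdsWithin_le_nhds).congr' ?_
  filter_upwards [self_mem_nhdsWithin] with l hl
  have hl : l ≠ 0 := hl
  rw [curveSq, show l⁻¹ - (q : ℂ) = (1 - q * l) / l by field_simp]
  simp only [inv_div, mul_div_assoc', div_div_eq_mul_div]

/-- The singular part at `y⁺` determines the polar part of the differential. -/
theorem IsLogPrimitive.tendsto_of_hasSingularPartAtZero {q : ℝ} (hq : q ≠ 0) {ξ : ℂ → ℂ}
    {μ : ℂ × ℂ → ℂ} (h : IsLogPrimitive q ξ μ) {c : ℂ} (hc : HasSingularPartAtZero q μ c) :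
    Tendsto (fun l => l * ξ l) (𝓝[≠] 0) (𝓝 (q * c / 8)) := by
  obtain ⟨G, hG, δ, hδ, hμ⟩ := hc
  choose! s hs using fun (l : ℂ) (hl : l ≠ 0) => exists_mem_spectralCurve q hl
  have hN := tendsto_curveSq_inv_zero hq
  have hs0 : Tendsto (fun l => (s l)⁻¹) (𝓝[≠] 0) (𝓝 0) := by
    rw [tendsto_zero_iff_norm_tendsto_zero]
    have h1 : Tendsto (fun l => √‖(curveSq q l)⁻¹‖) (𝓝[≠] 0) (𝓝 0) := by
      simpa using (hN.norm).sqrt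
    refine h1.congr' ?_
    filter_upwards [self_mem_nhdsWithin] with l hl
    rw [← (mem_spectralCurve_iff.1 (hs l hl)).2, ← inv_pow, norm_pow, Real.sqrt_sq (norm_nonneg _)]
  have hN0 : ∀ᶠ l in 𝓝[≠] (0 : ℂ), curveSq q l ≠ 0 := by
    have : ∀ᶠ l : ℂ in 𝓝 (0 : ℂ), (l - q) * (1 - q * l) ≠ 0 :=
      ContinuousAt.eventually_ne (by fun_prop) (by simpa using hq)
    filter_upwards [this.filter_mono nhdsWithin_le_nhds, self_mem_nhdsWithin] with l hl hl0
    have hl0 : l ≠ 0 := hl0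
    rw [curveSq, show l⁻¹ - (q : ℂ) = (1 - q * l) / l by field_simp, mul_div_assoc']
    exact div_ne_zero (div_ne_zero hl hl0) (by norm_num)
  -- With w = 1/ν and dν = (q/8)(l⁻¹ - l) dl/(lν), differentiating c ν + G(w) gives exactly l ξ =
  -- (q/8)(1 - l²)(c - G'(w) w²). As w → 0, only q c / 8 survives.
  have hlim : Tendsto (fun l => q * (1 - l ^ 2) / 8 * (c - deriv G (s l)⁻¹ * (curveSq q l)⁻¹))
      (𝓝[≠] 0) (𝓝 (q * c / 8)) := by
    have h1 : Tendsto (fun l => deriv G (s l)⁻¹) (𝓝[≠] 0) (𝓝 (deriv G 0)) :=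
      hG.deriv.continuousAt.tendsto.comp hs0
    have h2 : Tendsto (fun l : ℂ => (q : ℂ) * (1 - l ^ 2) / 8) (𝓝[≠] 0)
        (𝓝 ((q : ℂ) * (1 - 0 ^ 2) / 8)) :=
      (Continuous.tendsto (by fun_prop) 0).mono_left nhdsWithin_le_nhds
    have h3 := h2.mul ((h1.mul hN).const_sub c)
    convert h3 using 2
    ring
  refine hlim.congr' ?_
  have hGd : ∀ᶠ l in 𝓝[≠] (0 : ℂ), DifferentiableAt ℂ G (s l)⁻¹ :=
    hs0.eventually (hG.eventually_analyticAt.mono fun _ h => h.differentiableAt)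
  have hδl : ∀ᶠ l in 𝓝[≠] (0 : ℂ), ‖l‖ < δ := by
    filter_upwards [nhdsWithin_le_nhds (Metric.ball_mem_nhds 0 hδ)] with l hl
    simpa using hl
  filter_upwards [hN0, hGd, hδl, self_mem_nhdsWithin] with l hNl hGl hl hl0
  have hl0 : l ≠ 0 := hl0
  have hmem := hs l hl0
  have hsq := (mem_spectralCurve_iff.1 hmem).2
  simp only at hsq
  have hsl : s l ≠ 0 := fun h0 => hNl (by rw [← hsq, h0]; norm_num)
  obtain ⟨b, hb0, -, hbc, hbd⟩ := exists_local_branch hmem hsl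
  simp only at hb0 hbc hbd
  have h1 : HasDerivAt (fun v => μ (v, b v)) _ l :=
    h.hasDerivAt (x := fun v => v) (y := b) (r := (s l)⁻¹)
    ((hasDerivAt_id' l).congr_deriv (by rw [hb0, mul_inv_cancel₀ hsl])) hbd hbc
  have h2 : (fun v => μ (v, b v)) =ᶠ[𝓝 l] fun v => Complex.exp (c * b v + G (b v)⁻¹) := by
    filter_upwards [hbc, (continuous_norm.continuousAt (x := l)).eventually (gt_mem_nhds hl)]
      with v hv hv' using hμ _ hv hv'
  have hGl' : HasDerivAt G (deriv G (s l)⁻¹) (b l)⁻¹ := by rw [hb0]; exact hGl.hasDerivAt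
  have h3 := ((hbd.const_mul c).add (hGl'.comp l (hbd.inv (by rwa [hb0])))).cexp
  have h4 := h1.unique (h3.congr_of_eventuallyEq h2)
  have h5 := h2.self_of_nhds
  simp only at h5
  rw [h5] at h4
  simp only [Function.comp, Pi.add_apply, Pi.inv_apply] at h4
  rw [mul_comm _ (Complex.exp _)] at h4
  have h6 := mul_left_cancel₀ (Complex.exp_ne_zero _) h4
  rw [← hsq]
  simp only [hb0, curveSqDeriv] at h6
  field_simp at h6 ⊢
  linear_combination -h6

/-! ### Descent of functions from the spectral curve to the `l`-plane -/

/-- Riemann's removable singularity theorem at all points at once: the extension is the limit over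
punctured neighbourhoods, which agrees with f wherever f is continuous. -/
theorem exists_differentiableOn_of_bounded {f : ℂ → ℂ} {U : Set ℂ}
    (h : ∀ z ∈ U, ∃ K : ℝ, ∀ᶠ w in 𝓝[≠] z, DifferentiableAt ℂ f w ∧ ‖f w‖ ≤ K) :
    ∃ g : ℂ → ℂ, (∀ z ∈ U, DifferentiableAt ℂ g z) ∧ ∀ w, ContinuousAt f w → g w = f w := by
  have hg : ∀ w, ContinuousAt f w → limUnder (𝓝[≠] w) f = f w := fun w hw =>
    (hw.tendsto.mono_left nhdsWithin_le_nhds).limUnder_eq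
  refine ⟨fun w => limUnder (𝓝[≠] w) f, fun z hz => ?_, hg⟩
  obtain ⟨K, hK⟩ := h z hz
  obtain ⟨s, hs, hsK⟩ : ∃ s ∈ 𝓝 z, ∀ w ∈ s \ {z}, DifferentiableAt ℂ f w ∧ ‖f w‖ ≤ K := by
    rw [eventually_nhdsWithin_iff] at hK
    exact ⟨_, hK, fun w hw => hw.1 hw.2⟩
  have hd := Complex.differentiableOn_update_limUnder_of_bddAbove hs
    (fun w hw => (hsK w hw).1.differentiableWithinAt)
    ⟨K, by rintro _ ⟨w, hw, rfl⟩; exact (hsK w hw).2⟩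
  refine (hd.differentiableAt hs).congr_of_eventuallyEq ?_
  filter_upwards [hs] with w hw
  by_cases hwz : w = z
  · simp [hwz]
  · rw [Function.update_of_ne hwz]
    exact hg w (hsK w ⟨hw, hwz⟩).1.continuousAt

theorem curveSq_eq_zero_iff {q : ℝ} {l : ℂ} : curveSq q l = 0 ↔ l = q ∨ l⁻¹ = q := by
  simp [curveSq, sub_eq_zero]

theorem eventually_curveSq_ne_zero (q : ℝ) {l : ℂ} (hl : l ≠ 0) :
    ∀ᶠ w in 𝓝[≠] l, w ≠ 0 ∧ curveSq q w ≠ 0 := by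
  have h : ({(q : ℂ), (q : ℂ)⁻¹} \ {l} : Set ℂ).Finite := ((finite_singleton _).insert _).sdiff
  filter_upwards [nhdsWithin_le_nhds (isOpen_ne.mem_nhds hl),
    nhdsWithin_le_nhds (h.isClosed.isOpen_compl.mem_nhds (fun hm => hm.2 rfl)),
    self_mem_nhdsWithin] with w hw0 hw hwl
  refine ⟨hw0, fun h0 => hw ⟨?_, hwl⟩⟩
  rcases curveSq_eq_zero_iff.1 h0 with h1 | h1
  · exact Or.inl h1
  · right; rw [mem_singleton_iff, ← h1, inv_inv]

/-- C and νS are the even and odd parts of μ under σ. Away from branch points they are holomorphic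
through a local branch of ν; at a branch point C is continuous and S is bounded, so both
singularities are removable. -/
theorem exists_descent {q : ℝ} {μ : ℂ × ℂ → ℂ} (hμ : HolomorphicOnCurve q μ) :
    ∃ C S : ℂ → ℂ, (∀ l, l ≠ 0 → DifferentiableAt ℂ C l) ∧ (∀ l, l ≠ 0 → DifferentiableAt ℂ S l) ∧
      ∀ p ∈ spectralCurve q, μ p = C p.1 + p.2 * S p.1 := by
  choose! s hs using fun (l : ℂ) (hl : l ≠ 0) => exists_mem_spectralCurve q hl
  set C₀ : ℂ → ℂ := fun l => (μ (l, s l) + μ (l, -s l)) / 2 with hC₀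
  set S₀ : ℂ → ℂ := fun l => (μ (l, s l) - μ (l, -s l)) / (2 * s l) with hS₀
  -- Both expressions are unchanged under ν ↦ -ν, so the arbitrary, possibly discontinuous choice s
  -- of a root may be replaced locally by an analytic branch.
  have hind : ∀ l ν, l ≠ 0 → (l, ν) ∈ spectralCurve q →
      C₀ l = (μ (l, ν) + μ (l, -ν)) / 2 ∧ S₀ l = (μ (l, ν) - μ (l, -ν)) / (2 * ν) := by
    intro l ν hl hν
    have h1 := (mem_spectralCurve_iff.1 (hs l hl)).2.trans (mem_spectralCurve_iff.1 hν).2.symm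
    rcases sq_eq_sq_iff_eq_or_eq_neg.1 h1 with h2 | h2 <;> simp only at h2
    · simp only [hC₀, hS₀, h2, and_self]
    · simp only [hC₀, hS₀, h2, neg_neg]
      exact ⟨by ring, by rw [mul_neg, div_neg, ← neg_div, neg_sub]⟩
  have hneg : ∀ l ν, (l, ν) ∈ spectralCurve q → (l, -ν) ∈ spectralCurve q :=
    fun l ν h => sigmaInv_mem h
  have hreg : ∀ l, l ≠ 0 → curveSq q l ≠ 0 →
      DifferentiableAt ℂ C₀ l ∧ DifferentiableAt ℂ S₀ l := by
    intro l hl hN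
    have hsl : s l ≠ 0 := fun h0 => hN (by
      have := (mem_spectralCurve_iff.1 (hs l hl)).2
      simp only [h0] at this
      rw [← this]; norm_num)
    obtain ⟨b, hb0, hban, hbc, -⟩ := exists_local_branch (hs l hl) hsl
    simp only at hb0 hban hbc
    obtain ⟨F₁, hF₁, hμ₁⟩ := hμ _ (hs l hl)
    obtain ⟨F₂, hF₂, hμ₂⟩ := hμ _ (hneg _ _ (hs l hl))
    have hd1 : DifferentiableAt ℂ (fun w => (w, b w)) l :=
      differentiableAt_id.prodMk hban.differentiableAt
    have hd2 : DifferentiableAt ℂ (fun w => (w, -b w)) l :=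
      differentiableAt_id.prodMk hban.differentiableAt.neg
    have he1 : ∀ᶠ w in 𝓝 l, μ (w, b w) = F₁ (w, b w) := by
      refine (tendsto_nhdsWithin_iff.2 ⟨?_, hbc⟩).eventually hμ₁
      have := hd1.continuousAt.tendsto
      rwa [hb0] at this
    have he2 : ∀ᶠ w in 𝓝 l, μ (w, -b w) = F₂ (w, -b w) := by
      refine (tendsto_nhdsWithin_iff.2 ⟨?_, hbc.mono fun w hw => hneg _ _ hw⟩).eventually hμ₂
      have := hd2.continuousAt.tendsto
      rwa [hb0] at this
    have hg1 : DifferentiableAt ℂ (fun w => F₁ (w, b w)) l :=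
      DifferentiableAt.comp (f := fun w => (w, b w)) l (by rw [hb0]; exact hF₁.differentiableAt) hd1
    have hg2 : DifferentiableAt ℂ (fun w => F₂ (w, -b w)) l :=
      DifferentiableAt.comp (f := fun w => (w, -b w)) l (by rw [hb0]; exact hF₂.differentiableAt)
        hd2
    constructor
    · refine ((hg1.add hg2).div_const 2).congr_of_eventuallyEq ?_
      filter_upwards [hbc, he1, he2, isOpen_ne.mem_nhds hl] with w hw h1 h2 hw0
      rw [(hind w (b w) hw0 hw).1, h1, h2]
      rfl
    · refine ((hg1.sub hg2).div (hban.differentiableAt.const_mul 2)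
        (by rw [hb0]; exact mul_ne_zero two_ne_zero hsl)).congr_of_eventuallyEq ?_
      filter_upwards [hbc, he1, he2, isOpen_ne.mem_nhds hl] with w hw h1 h2 hw0
      rw [(hind w (b w) hw0 hw).2, h1, h2]
      rfl
  -- behaviour at the branch points
  have hbranch : ∀ l, l ≠ 0 → curveSq q l = 0 →
      ContinuousAt C₀ l ∧ ∃ K : ℝ, ∀ᶠ w in 𝓝[≠] l, ‖S₀ w‖ ≤ K := by
    intro l hl hN
    have hmem : (l, (0 : ℂ)) ∈ spectralCurve q := mem_spectralCurve_iff.2 ⟨hl, by simp [hN]⟩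
    obtain ⟨F, hF, hμF⟩ := hμ _ hmem
    have hsl0 : s l = 0 := by
      have := (mem_spectralCurve_iff.1 (hs l hl)).2
      simpa [hN] using this
    have hs0 : Tendsto s (𝓝 l) (𝓝 0) := by
      rw [tendsto_zero_iff_norm_tendsto_zero]
      have h1 : Tendsto (fun w => √‖curveSq q w‖) (𝓝 l) (𝓝 0) := by
        have := (analyticAt_curveSq q hl).continuousAt.norm.sqrt.tendsto
        simpa [hN] using this
      refine h1.congr' ?_
      filter_upwards [isOpen_ne.mem_nhds hl] with w hw
      rw [← (mem_spectralCurve_iff.1 (hs w hw)).2, norm_pow, Real.sqrt_sq (norm_nonneg _)]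
    have ht1 : Tendsto (fun w => (w, s w)) (𝓝 l) (𝓝[spectralCurve q] (l, 0)) := by
      refine tendsto_nhdsWithin_iff.2 ⟨tendsto_id.prodMk_nhds hs0, ?_⟩
      filter_upwards [isOpen_ne.mem_nhds hl] with w hw using hs w hw
    have ht2 : Tendsto (fun w => (w, -s w)) (𝓝 l) (𝓝[spectralCurve q] (l, 0)) := by
      refine tendsto_nhdsWithin_iff.2 ⟨tendsto_id.prodMk_nhds (by simpa using hs0.neg), ?_⟩
      filter_upwards [isOpen_ne.mem_nhds hl] with w hw using hneg _ _ (hs w hw)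
    constructor
    · have hc1 := (hF.continuousAt.tendsto.mono_left nhdsWithin_le_nhds).comp ht1
      have hc2 := (hF.continuousAt.tendsto.mono_left nhdsWithin_le_nhds).comp ht2
      have h3 : C₀ l = (F (l, 0) + F (l, 0)) / 2 := by
        simp only [hC₀, hsl0, neg_zero, hμF.self_of_nhdsWithin hmem]
      rw [ContinuousAt, h3]
      refine ((hc1.add hc2).div_const 2).congr' ?_
      filter_upwards [ht1.eventually hμF, ht2.eventually hμF] with w h1 h2
      simp only [hC₀, h1, h2, Function.comp]
    -- The two points (w, ±s w) are at distance 2|s w|, which is the modulus of the denominator of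
    -- S₀; a Lipschitz bound for the local extension F therefore bounds S₀.
    · obtain ⟨K, t, ht, hLip⟩ := (hF.contDiffAt (n := 1)).exists_lipschitzOnWith
      refine ⟨K, ?_⟩
      have ht1' := ht1.eventually (nhdsWithin_le_nhds ht)
      have ht2' := ht2.eventually (nhdsWithin_le_nhds ht)
      filter_upwards [nhdsWithin_le_nhds (ht1.eventually hμF),
        nhdsWithin_le_nhds (ht2.eventually hμF), nhdsWithin_le_nhds ht1',
        nhdsWithin_le_nhds ht2'] with w h1 h2 h3 h4
      have h5 := hLip.dist_le_mul _ h3 _ h4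
      rw [dist_eq_norm, Prod.dist_eq, dist_self, dist_eq_norm, max_eq_right (norm_nonneg _),
        sub_neg_eq_add, ← two_mul] at h5
      simp only [hS₀, h1, h2, norm_div]
      exact div_le_of_le_mul₀ (norm_nonneg _) K.coe_nonneg h5
  have hCd : ∀ l, l ≠ 0 → DifferentiableAt ℂ C₀ l := by
    intro l hl
    by_cases hN : curveSq q l = 0
    · obtain ⟨t, ht, htd⟩ : ∃ t ∈ 𝓝 l, ∀ w ∈ t \ {l}, DifferentiableAt ℂ C₀ w := by
        have := (eventually_curveSq_ne_zero q hl).mono fun w hw => (hreg w hw.1 hw.2).1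
        rw [eventually_nhdsWithin_iff] at this
        exact ⟨_, this, fun w hw => hw.1 hw.2⟩
      exact ((Complex.differentiableOn_compl_singleton_and_continuousAt_iff ht).1
        ⟨fun w hw => (htd w hw).differentiableWithinAt, (hbranch l hl hN).1⟩).differentiableAt ht
    · exact (hreg l hl hN).1
  obtain ⟨S, hSd, hS⟩ := exists_differentiableOn_of_bounded (f := S₀) (U := {0}ᶜ) (by
    intro l hl
    have h0 := eventually_curveSq_ne_zero q hl
    by_cases hN : curveSq q l = 0
    · obtain ⟨K, hK⟩ := (hbranch l hl hN).2
      exact ⟨K, by filter_upwards [h0, hK] with w h1 h2 using ⟨(hreg w h1.1 h1.2).2, h2⟩⟩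
    · refine ⟨‖S₀ l‖ + 1, ?_⟩
      have h1 := (hreg l hl hN).2.continuousAt.norm.eventually (gt_mem_nhds (lt_add_one _))
      filter_upwards [h0, nhdsWithin_le_nhds h1] with w h2 h3
      exact ⟨(hreg w h2.1 h2.2).2, h3.le⟩)
  refine ⟨C₀, S, hCd, fun l hl => hSd l hl, fun p hp => ?_⟩
  have hp' := mem_spectralCurve_iff.1 hp
  have h1 := hind p.1 p.2 hp'.1 hp
  by_cases hν : p.2 = 0
  · rw [h1.1, hν, neg_zero, zero_mul, add_zero, add_self_div_two, ← hν]
  · have hN : curveSq q p.1 ≠ 0 := hp'.2 ▸ pow_ne_zero 2 hν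
    rw [hS p.1 (hreg p.1 hp'.1 hN).2.continuousAt, h1.1, h1.2]
    field_simp
    ring

/-- A nowhere vanishing holomorphic function with `μ ∘ σ = μ⁻¹` is a logarithmic primitive. -/
theorem exists_isLogPrimitive {q : ℝ} {μ : ℂ × ℂ → ℂ} (hμ : HolomorphicOnCurve q μ)
    (h0 : ∀ p ∈ spectralCurve q, μ p ≠ 0)
    (hσ : ∀ p ∈ spectralCurve q, μ (sigmaInv p) = (μ p)⁻¹) :
    ∃ ξ : ℂ → ℂ, (∀ l, l ≠ 0 → DifferentiableAt ℂ ξ l) ∧ IsLogPrimitive q ξ μ := by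
  obtain ⟨C, S, hC, hS, hCS⟩ := exists_descent hμ
  -- This is (C + νS)(C - νS) = μ · (μ ∘ σ) = 1.
  have hone : ∀ l, l ≠ 0 → C l ^ 2 - curveSq q l * S l ^ 2 = 1 := by
    intro l hl
    obtain ⟨ν, hν⟩ := exists_mem_spectralCurve q hl
    have h1 := hCS _ hν
    have h2 := hCS _ (sigmaInv_mem hν)
    rw [hσ _ hν, h1] at h2
    rw [← (mem_spectralCurve_iff.1 hν).2]
    have h3 : C l + ν * S l ≠ 0 := by have := h0 _ hν; rwa [h1] at this
    simp only [sigmaInv] at h2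
    have h4 := (inv_mul_cancel₀ h3)
    rw [h2] at h4
    linear_combination h4
  have hopen : IsOpen {l : ℂ | l ≠ 0} := isOpen_ne
  have hder : ∀ {f : ℂ → ℂ}, (∀ l, l ≠ 0 → DifferentiableAt ℂ f l) →
      ∀ l, l ≠ 0 → DifferentiableAt ℂ (deriv f) l := fun {f} hf l hl =>
    ((show DifferentiableOn ℂ f {l : ℂ | l ≠ 0} from
      fun w hw => (hf w hw).differentiableWithinAt).deriv hopen).differentiableAt (hopen.mem_nhds hl)
  -- Obtained from dμ/μ = (C - νS) d(C + νS): the derivative of C² - ν²S² = 1 cancels all terms odd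
  -- in ν, so the coefficient depends on l only.
  set ξ : ℂ → ℂ := fun l => l * (curveSq q l * (C l * deriv S l - deriv C l * S l) +
    curveSqDeriv q l / 2 * C l * S l) with hξ
  refine ⟨ξ, fun l hl => ?_, fun p hp => ?_⟩
  · have h1 := hC l hl
    have h2 := hS l hl
    have h3 := hder hC l hl
    have h4 := hder hS l hl
    have h5 := (analyticAt_curveSq q hl).differentiableAt
    have h6 : DifferentiableAt ℂ (curveSqDeriv q) l := by
      unfold curveSqDeriv
      fun_prop (disch := exact pow_ne_zero 2 hl)
    fun_prop
  · have hp' := mem_spectralCurve_iff.1 hp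
    have hdC := (hC p.1 hp'.1).hasDerivAt
    have hdS := (hS p.1 hp'.1).hasDerivAt
    have hCan : AnalyticAt ℂ C p.1 := (show DifferentiableOn ℂ C {l : ℂ | l ≠ 0} from
      fun w hw => (hC w hw).differentiableWithinAt).analyticAt (hopen.mem_nhds hp'.1)
    have hSan : AnalyticAt ℂ S p.1 := (show DifferentiableOn ℂ S {l : ℂ | l ≠ 0} from
      fun w hw => (hS w hw).differentiableWithinAt).analyticAt (hopen.mem_nhds hp'.1)
    have hderiv : 2 * C p.1 * deriv C p.1 = curveSqDeriv q p.1 * S p.1 ^ 2 +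
        2 * curveSq q p.1 * S p.1 * deriv S p.1 := by
      have h1 := (hdC.pow 2).sub ((hasDerivAt_curveSq q hp'.1).mul (hdS.pow 2))
      have h2 : HasDerivAt (fun _ : ℂ => (1 : ℂ)) _ p.1 := h1.congr_of_eventuallyEq (by
        filter_upwards [hopen.mem_nhds hp'.1] with l hl
        exact (hone l hl).symm)
      have h3 := h2.unique (hasDerivAt_const p.1 1)
      push_cast at h3
      simp only [Pi.pow_apply] at h3
      linear_combination h3
    refine ⟨fun z => C z.1 + z.2 * S z.1,
      (hCan.comp analyticAt_fst).add (analyticAt_snd.mul (hSan.comp analyticAt_fst)), ?_, ?_⟩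
    · filter_upwards [self_mem_nhdsWithin] with z hz using hCS z hz
    · have hF : HasFDerivAt (fun z : ℂ × ℂ => C z.1 + z.2 * S z.1) _ p :=
        (hdC.comp_hasFDerivAt p (hasFDerivAt_fst (𝕜 := ℂ) (p := p))).add
          (hasFDerivAt_snd.mul (hdS.comp_hasFDerivAt p (hasFDerivAt_fst (𝕜 := ℂ) (p := p))))
      rw [hF.fderiv]
      simp only [add_apply, smul_apply, ContinuousLinearMap.coe_fst',
        ContinuousLinearMap.coe_snd', smul_eq_mul, hξ]
      rw [mul_div_cancel_left₀ _ hp'.1]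
      have h1 := hone p.1 hp'.1
      have h2 := hp'.2
      linear_combination deriv S p.1 * h2 -
        (curveSq q p.1 * deriv S p.1 + curveSqDeriv q p.1 / 2 * S p.1 + p.2 * deriv C p.1) * h1 +
        (curveSq q p.1 * S p.1 / 2 + p.2 * C p.1 / 2) * hderiv

theorem IsLogPrimitive.congr {q : ℝ} {ξ ξ' : ℂ → ℂ} {μ : ℂ × ℂ → ℂ} (h : IsLogPrimitive q ξ μ)
    (hξ : ∀ l, l ≠ 0 → ξ l = ξ' l) : IsLogPrimitive q ξ' μ := by
  intro p hp
  rw [← hξ p.1 hp.1]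
  exact h p hp

/-- A holomorphic function on `ℂ \ {0}` with at most simple poles at `0` and `∞`. -/
theorem exists_eq_of_tendsto {ξ : ℂ → ℂ} (hξ : ∀ l, l ≠ 0 → DifferentiableAt ℂ ξ l) {a₀ a₁ : ℂ}
    (h0 : Tendsto (fun l => l * ξ l) (𝓝[≠] 0) (𝓝 a₀))
    (h1 : Tendsto (fun l => l * ξ l⁻¹) (𝓝[≠] 0) (𝓝 a₁)) :
    ∃ b : ℂ, ∀ l, l ≠ 0 → ξ l = a₁ * l + b + a₀ * l⁻¹ := by
  set g : ℂ → ℂ := Function.update (fun l => l * ξ l) 0 a₀ with hg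
  have hg0 : g 0 = a₀ := by simp [hg]
  have hgl : ∀ l, l ≠ 0 → g l = l * ξ l := fun l hl => by simp [hg, hl]
  have hgd : DifferentiableOn ℂ g univ := by
    rw [← Complex.differentiableOn_compl_singleton_and_continuousAt_iff (c := 0) univ_mem]
    refine ⟨fun l hl => ?_, continuousAt_update_same.2 h0⟩
    have hl0 : l ≠ 0 := hl.2
    refine DifferentiableAt.differentiableWithinAt ?_
    refine (differentiableAt_id.mul (hξ l hl0)).congr_of_eventuallyEq ?_
    filter_upwards [isOpen_ne.mem_nhds hl0] with w hw using hgl w hw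
  -- k is the entire function (g(l) - g(0) - g'(0) l)/l², where g extends l ξ. It tends to a₁ at
  -- infinity, so it is constant by Liouville.
  set k := dslope (dslope g 0) 0 with hk
  have hkd : Differentiable ℂ k := by
    rw [← differentiableOn_univ, hk, Complex.differentiableOn_dslope univ_mem,
      Complex.differentiableOn_dslope univ_mem]
    exact hgd
  have hkl : ∀ l, l ≠ 0 → k l = (l * ξ l - a₀) / l ^ 2 - deriv g 0 / l := by
    intro l hl
    rw [hk, dslope_of_ne _ hl, slope_def_field, dslope_of_ne _ hl, dslope_same, slope_def_field,
      hg0, hgl l hl]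
    field_simp
    ring
  have hlim : Tendsto k (cocompact ℂ) (𝓝 a₁) := by
    have hinv : Tendsto (fun l : ℂ => l⁻¹) (cocompact ℂ) (𝓝[≠] 0) := by
      rw [← Metric.cobounded_eq_cocompact]; exact Filter.tendsto_inv₀_cobounded'
    have h2 : Tendsto (fun l : ℂ => l * ξ l⁻¹ - a₀ * l ^ 2 - deriv g 0 * l) (𝓝[≠] 0)
        (𝓝 (a₁ - a₀ * 0 ^ 2 - deriv g 0 * 0)) := by
      refine (h1.sub ?_).sub ?_ <;>
      exact (Continuous.tendsto (by fun_prop) 0).mono_left nhdsWithin_le_nhds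
    have h3 := h2.comp hinv
    simp only [ne_eq, OfNat.ofNat_ne_zero, not_false_eq_true, zero_pow, mul_zero, sub_zero] at h3
    refine h3.congr' ?_
    have : ∀ᶠ l in cocompact ℂ, l ≠ 0 := (isCompact_singleton (x := (0 : ℂ))).compl_mem_cocompact
    filter_upwards [this] with l hl
    rw [hkl l hl]
    simp only [Function.comp, inv_inv]
    field_simp
  refine ⟨deriv g 0, fun l hl => ?_⟩
  have h4 := hkd.apply_eq_of_tendsto_cocompact l hlim
  rw [hkl l hl] at h4
  field_simp at h4 ⊢
  linear_combination h4

/-! ### The differentials on the real cycles -/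

/-- The differential of the second kind without period along the real cycle over `[q, q⁻¹]`, as a
multiple of `dl / (l ν)`. -/
noncomputable def normalizedForm (q : ℝ) (l : ℂ) : ℂ :=
  q * ellipticK' q * (l + l⁻¹) - 2 * ellipticE' q

/-- The differential with coordinates `s`, `n`: `i s dν` plus `n / 4` times the normalised
differential, as a multiple of `dl / (l ν)`. -/
noncomputable def torusForm (q s n : ℝ) (l : ℂ) : ℂ :=
  n / 4 * normalizedForm q l + Complex.I * (q * s / 8) * (l⁻¹ - l)

/-- The point of the spectral curve over `exp (i φ)` with `ν > 0`. -/
noncomputable def circlePoint (q φ : ℝ) : ℂ × ℂ :=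
  (Complex.exp (φ * Complex.I), ((circleRadius q φ / 2 : ℝ) : ℂ))

theorem exp_mul_I_add_inv (φ : ℝ) : Complex.exp (φ * Complex.I) + (Complex.exp (φ * Complex.I))⁻¹ =
    2 * (Real.cos φ : ℂ) := by
  rw [← Complex.exp_neg, Complex.ofReal_cos, Complex.cos, neg_mul]; ring

theorem inv_exp_mul_I_sub (φ : ℝ) : (Complex.exp (φ * Complex.I))⁻¹ - Complex.exp (φ * Complex.I) =
    -2 * Complex.I * (Real.sin φ : ℂ) := by
  rw [← Complex.exp_neg, Complex.ofReal_sin, Complex.sin]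
  simp only [neg_mul]
  linear_combination (Complex.exp (-(φ * Complex.I)) - Complex.exp (φ * Complex.I)) *
    Complex.I_sq

theorem curveSq_exp (q φ : ℝ) :
    curveSq q (Complex.exp (φ * Complex.I)) = ((1 - 2 * q * Real.cos φ + q ^ 2 : ℝ) : ℂ) / 4 := by
  have h := exp_mul_I_add_inv φ
  have h0 := mul_inv_cancel₀ (Complex.exp_ne_zero (φ * Complex.I))
  rw [curveSq]
  push_cast at h ⊢
  linear_combination h0 / 4 - q / 4 * h

theorem circlePoint_mem {q : ℝ} (hq : |q| < 1) (φ : ℝ) : circlePoint q φ ∈ spectralCurve q := by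
  rw [mem_spectralCurve_iff]
  refine ⟨Complex.exp_ne_zero _, ?_⟩
  rw [circlePoint, curveSq_exp, ← sq_circleRadius hq]
  push_cast; ring

theorem rhoInv_circlePoint (q φ : ℝ) : rhoInv (circlePoint q φ) = circlePoint q φ := by
  simp only [rhoInv, circlePoint, Prod.mk.injEq]
  constructor
  · rw [Complex.star_def, ← Complex.exp_conj, ← Complex.exp_neg]
    simp
  · exact Complex.conj_ofReal _

theorem hasDerivAt_exp_circle {q : ℝ} (hq : |q| < 1) (φ : ℝ) :
    HasDerivAt (fun φ : ℝ => Complex.exp (φ * Complex.I))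
      (((circleRadius q φ / 2 : ℝ) : ℂ) *
        (Complex.I * Complex.exp (φ * Complex.I) * (2 / circleRadius q φ))) φ := by
  have hR : (circleRadius q φ : ℂ) ≠ 0 := by exact_mod_cast (circleRadius_pos hq φ).ne'
  have h1 := (((hasDerivAt_id φ).ofReal_comp).mul_const Complex.I).cexp
  refine h1.congr_deriv ?_
  push_cast
  simp only [id]
  field_simp

theorem hasDerivAt_circleRadius_div_two {q : ℝ} (hq : |q| < 1) (φ : ℝ) :
    HasDerivAt (fun φ : ℝ => ((circleRadius q φ / 2 : ℝ) : ℂ))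
      (curveSqDeriv q (Complex.exp (φ * Complex.I)) / 2 *
        (Complex.I * Complex.exp (φ * Complex.I) * (2 / circleRadius q φ))) φ := by
  have he := Complex.exp_ne_zero (φ * Complex.I)
  have h1 := ((hasDerivAt_circleRadius_comp (hasDerivAt_const φ q) (hasDerivAt_id φ)
    hq).div_const 2).ofReal_comp
  refine h1.congr_deriv ?_
  have h2 := inv_exp_mul_I_sub φ
  simp only [id, curveSqDeriv]
  push_cast at h2 ⊢
  have h3 : Complex.exp (φ * Complex.I) * (((Complex.exp (φ * Complex.I)) ^ 2)⁻¹ - 1) =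
    -2 * Complex.I * Complex.sin φ := by rw [← h2]; field_simp
  rw [show (q : ℂ) * ((Complex.exp (φ * Complex.I) ^ 2)⁻¹ - 1) / 4 / 2 *
    (Complex.I * Complex.exp (φ * Complex.I) * (2 / circleRadius q φ)) =
    q * Complex.I / (4 * circleRadius q φ) *
    (Complex.exp (φ * Complex.I) * ((Complex.exp (φ * Complex.I) ^ 2)⁻¹ - 1)) by ring, h3]
  linear_combination (q * Complex.sin φ / (2 * circleRadius q φ)) * Complex.I_sq

theorem IsLogPrimitive.hasDerivAt_circlePoint {q : ℝ} (hq : |q| < 1) {ξ : ℂ → ℂ} {μ : ℂ × ℂ → ℂ}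
    (h : IsLogPrimitive q ξ μ) (φ : ℝ) :
    HasDerivAt (fun φ => μ (circlePoint q φ))
      (Complex.I * (ξ (Complex.exp (φ * Complex.I)) * 2 / circleRadius q φ) *
        μ (circlePoint q φ)) φ := by
  have hR : (circleRadius q φ : ℂ) ≠ 0 := by exact_mod_cast (circleRadius_pos hq φ).ne'
  have he := Complex.exp_ne_zero (φ * Complex.I)
  have := h.hasDerivAt (x := fun φ : ℝ => Complex.exp (φ * Complex.I))
    (y := fun φ : ℝ => ((circleRadius q φ / 2 : ℝ) : ℂ))
    (hasDerivAt_exp_circle hq φ) (hasDerivAt_circleRadius_div_two hq φ)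
    (Eventually.of_forall fun v => circlePoint_mem hq v)
  refine HasDerivAt.congr_deriv (f := fun φ : ℝ => μ (circlePoint q φ)) this ?_
  rw [circlePoint]
  generalize μ (Complex.exp (φ * Complex.I), ((circleRadius q φ / 2 : ℝ) : ℂ)) = m
  generalize ξ (Complex.exp (φ * Complex.I)) = w
  field_simp

theorem torusForm_exp (q s n φ : ℝ) : torusForm q s n (Complex.exp (φ * Complex.I)) =
    ((n / 2 * (q * ellipticK' q * Real.cos φ - ellipticE' q) + q * s / 4 * Real.sin φ : ℝ) : ℂ) := by
  rw [torusForm, normalizedForm, exp_mul_I_add_inv, inv_exp_mul_I_sub]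
  push_cast
  linear_combination (-(q * s * Complex.sin φ / 4)) * Complex.I_sq

/-- The values over the unit circle of a function with logarithmic differential `torusForm`. -/
theorem IsLogPrimitive.circlePoint_eq {q s n : ℝ} (hq : |q| < 1) {μ : ℂ × ℂ → ℂ}
    (h : IsLogPrimitive q (torusForm q s n) μ) {κ : ℂ}
    (hκ : μ (circlePoint q 0) = κ * Complex.exp (s * (circleRadius q 0 / 2 : ℝ) * Complex.I))
    (φ : ℝ) : μ (circlePoint q φ) =
      κ * Complex.exp ((s * (circleRadius q φ / 2) + n * circlePhase q φ : ℝ) * Complex.I) := by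
  set e : ℝ → ℂ := fun φ =>
    Complex.exp (-((s * (circleRadius q φ / 2) + n * circlePhase q φ : ℝ) * Complex.I)) with he
  have hd : ∀ φ, HasDerivAt (fun φ => μ (circlePoint q φ) * e φ) 0 φ := by
    intro φ
    have hR : (circleRadius q φ : ℂ) ≠ 0 := by exact_mod_cast (circleRadius_pos hq φ).ne'
    have h1 := ((((hasDerivAt_circleRadius_comp (hasDerivAt_const φ q) (hasDerivAt_id φ)
      hq).div_const 2).const_mul s).add ((hasDerivAt_circlePhase_right hq φ).const_mul n)).ofReal_comp
    have h2 := (h1.mul_const Complex.I).neg.cexp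
    refine ((h.hasDerivAt_circlePoint hq φ).mul h2).congr_deriv ?_
    rw [torusForm_exp]
    simp only [id, Pi.add_apply, Pi.neg_apply]
    push_cast
    field_simp
    ring
  have hconst := is_const_of_deriv_eq_zero (fun φ => (hd φ).differentiableAt)
    (fun φ => (hd φ).deriv) φ 0
  have h0 : e 0 = Complex.exp (-(s * (circleRadius q 0 / 2 : ℝ) * Complex.I)) := by
    simp [he, circlePhase]
  simp only [h0, hκ, mul_assoc, ← Complex.exp_add] at hconst
  rw [add_neg_cancel, Complex.exp_zero, mul_one] at hconst
  rw [← hconst, mul_assoc, he, ← Complex.exp_add, neg_add_cancel, Complex.exp_zero, mul_one]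

/-! ### The real cycle over the segment between the branch points -/

/-- `√(1 - (1 - q²) sin² x)`. -/
noncomputable def cycleDelta (q x : ℝ) : ℝ := √(1 - (1 - q ^ 2) * Real.sin x ^ 2)

/-- The `l`-coordinate of the real cycle over `[q, q⁻¹]`. -/
noncomputable def cycleX (q x : ℝ) : ℝ := cycleDelta q x ^ 2 / q

/-- The `ν`-coordinate of the real cycle over `[q, q⁻¹]`. -/
noncomputable def cycleY (q x : ℝ) : ℝ :=
  (1 - q ^ 2) * (Real.sin x * Real.cos x) / (2 * cycleDelta q x)

section

variable {q : ℝ}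

theorem cycleDelta_pos (hq : q ≠ 0) (x : ℝ) : 0 < cycleDelta q x :=
  Real.sqrt_pos.2 (one_sub_mul_sin_sq_pos (one_sub_sq_lt_one hq) x)

theorem sq_cycleDelta (hq : q ≠ 0) (x : ℝ) :
    cycleDelta q x ^ 2 = 1 - (1 - q ^ 2) * Real.sin x ^ 2 :=
  Real.sq_sqrt (one_sub_mul_sin_sq_pos (one_sub_sq_lt_one hq) x).le

theorem continuous_cycleDelta (q : ℝ) : Continuous (cycleDelta q) := by
  unfold cycleDelta; fun_prop

theorem cycleX_pos (hq : 0 < q) (x : ℝ) : 0 < cycleX q x :=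
  div_pos (pow_pos (cycleDelta_pos hq.ne' x) 2) hq

theorem cyclePoint_mem (hq : 0 < q) (x : ℝ) :
    (((cycleX q x : ℝ) : ℂ), ((cycleY q x : ℝ) : ℂ)) ∈ spectralCurve q := by
  have hX := cycleX_pos hq x
  have hD := cycleDelta_pos hq.ne' x
  have hD2 := sq_cycleDelta hq.ne' x
  rw [mem_spectralCurve_iff]
  refine ⟨Complex.ofReal_ne_zero.2 hX.ne', ?_⟩
  have : cycleY q x ^ 2 = (cycleX q x - q) * ((cycleX q x)⁻¹ - q) / 4 := by
    rw [cycleX, cycleY]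
    have hc := Real.cos_sq' x
    field_simp
    rw [hD2, hc]
    ring
  simp only [curveSq]
  exact_mod_cast this

theorem hasDerivAt_cycleX (hq : 0 < q) (x : ℝ) :
    HasDerivAt (cycleX q) (cycleY q x * (-4 * cycleDelta q x / q)) x := by
  have h1 : HasDerivAt (fun x => (1 - (1 - q ^ 2) * Real.sin x ^ 2) / q)
      (-((1 - q ^ 2) * (2 * Real.sin x * Real.cos x)) / q) x := by
    refine (((((Real.hasDerivAt_sin x).pow 2).const_mul (1 - q ^ 2)).const_sub 1).div_const
      q).congr_deriv ?_
    simp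
  have h2 : cycleX q = fun x => (1 - (1 - q ^ 2) * Real.sin x ^ 2) / q := by
    funext x; rw [cycleX, sq_cycleDelta hq.ne']
  rw [h2]
  refine h1.congr_deriv ?_
  have hD := cycleDelta_pos hq.ne' x
  rw [cycleY]
  field_simp
  ring

theorem hasDerivAt_cycleY (hq : 0 < q) (x : ℝ) :
    HasDerivAt (cycleY q) (q / 2 * (cycleX q x - (cycleX q x)⁻¹) / cycleDelta q x) x := by
  have hD := cycleDelta_pos hq.ne' x
  have hD2 := sq_cycleDelta hq.ne' x
  have h1 : HasDerivAt (cycleDelta q)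
      (-((1 - q ^ 2) * (Real.sin x * Real.cos x)) / cycleDelta q x) x := by
    have := ((((Real.hasDerivAt_sin x).pow 2).const_mul (1 - q ^ 2)).const_sub 1).sqrt
      (one_sub_mul_sin_sq_pos (one_sub_sq_lt_one hq.ne') x).ne'
    refine this.congr_deriv ?_
    simp only [cycleDelta, Pi.pow_apply]
    push_cast
    field_simp
  refine ((((Real.hasDerivAt_sin x).mul (Real.hasDerivAt_cos x)).const_mul (1 - q ^ 2)).div
    (h1.const_mul 2) (mul_ne_zero two_ne_zero hD.ne')).congr_deriv ?_
  have hc := Real.cos_sq' x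
  simp only [Pi.mul_apply]
  rw [cycleX]
  field_simp
  rw [show cycleDelta q x ^ 4 = (cycleDelta q x ^ 2) ^ 2 by ring, hD2]
  linear_combination ((1 - q ^ 2) * (1 - (1 - q ^ 2) * Real.sin x ^ 2) +
    (1 - q ^ 2) ^ 2 * Real.sin x ^ 2) * hc

theorem hasDerivAt_cycleY' (hq : 0 < q) (x : ℝ) :
    HasDerivAt (fun x => ((cycleY q x : ℝ) : ℂ))
      (curveSqDeriv q (cycleX q x) / 2 * ((-4 * cycleDelta q x / q : ℝ) : ℂ)) x := by
  refine (hasDerivAt_cycleY hq x).ofReal_comp.congr_deriv ?_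
  have hD := cycleDelta_pos hq.ne' x
  have : q / 2 * (cycleX q x - (cycleX q x)⁻¹) / cycleDelta q x =
      q * ((cycleX q x ^ 2)⁻¹ - 1) / 4 / 2 * (-4 * cycleDelta q x / q) := by
    rw [cycleX]; field_simp; ring
  rw [this, curveSqDeriv]
  push_cast; ring

theorem hasDerivAt_cycleX' (hq : 0 < q) (x : ℝ) :
    HasDerivAt (fun x => ((cycleX q x : ℝ) : ℂ))
      ((cycleY q x : ℂ) * ((-4 * cycleDelta q x / q : ℝ) : ℂ)) x := by
  refine (hasDerivAt_cycleX hq x).ofReal_comp.congr_deriv ?_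
  push_cast; ring

theorem cycle_velocity (hq : 0 < q) (x : ℝ) :
    ((-4 * cycleDelta q x / q : ℝ) : ℂ) / (cycleX q x : ℂ) = -4 / (cycleDelta q x : ℂ) := by
  have hD := cycleDelta_pos hq.ne' x
  have : -4 * cycleDelta q x / q / cycleX q x = -4 / cycleDelta q x := by
    rw [cycleX]; field_simp
  exact_mod_cast this

theorem IsLogPrimitive.hasDerivAt_cycle (hq : 0 < q) {ξ : ℂ → ℂ} {μ : ℂ × ℂ → ℂ}
    (h : IsLogPrimitive q ξ μ) (x : ℝ) :
    HasDerivAt (fun x => μ (((cycleX q x : ℝ) : ℂ), ((cycleY q x : ℝ) : ℂ)))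
      (-4 / (cycleDelta q x : ℂ) * ξ (cycleX q x) *
        μ (((cycleX q x : ℝ) : ℂ), ((cycleY q x : ℝ) : ℂ))) x := by
  have h1 := h.hasDerivAt (hasDerivAt_cycleX' hq x) (hasDerivAt_cycleY' hq x)
    (Eventually.of_forall fun v => cyclePoint_mem hq v)
  refine h1.congr_deriv ?_
  rw [← cycle_velocity hq]
  ring

/-- In the coordinate x, dl/(lν) becomes -4 dx/Δ with Δ = `cycleDelta q x`, and l + l⁻¹ contributes
Δ²/q + q/Δ². The integral thus reduces to those of Δ, Δ⁻¹ and Δ⁻³. In particular it vanishes for a =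
q K', b = -2E', which is the normalisation of `normalizedForm`. -/
theorem integral_cycle (hq : 0 < q) (a b : ℝ) :
    ∫ x in (0 : ℝ)..π / 2, -4 / cycleDelta q x * (a * (cycleX q x + (cycleX q x)⁻¹) + b) =
      -4 * (2 * a * ellipticE' q / q + b * ellipticK' q) := by
  have hm := one_sub_sq_lt_one hq.ne'
  have hE : ∫ x in (0 : ℝ)..π / 2, cycleDelta q x = ellipticE' q := by
    rw [ellipticE', completeEllipticE_eq hm, deltaIntegral]
    refine intervalIntegral.integral_congr fun x _ => ?_
    rw [one_mul, ← Real.sqrt_eq_rpow]; rfl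
  have hK : ∫ x in (0 : ℝ)..π / 2, (cycleDelta q x)⁻¹ = ellipticK' q := by
    rw [ellipticK', completeEllipticK_eq hm, deltaIntegral]
    refine intervalIntegral.integral_congr fun x _ => ?_
    rw [one_mul, neg_div, Real.rpow_neg (one_sub_mul_sin_sq_pos hm x).le, ← Real.sqrt_eq_rpow]; rfl
  have hcD := continuous_cycleDelta q
  have hD : ∀ x, cycleDelta q x ≠ 0 := fun x => (cycleDelta_pos hq.ne' x).ne'
  have hI : Continuous fun x => (cycleDelta q x)⁻¹ := hcD.inv₀ hD
  -- The function `cycleY` vanishes at both ends and has derivative Δ/2 - q²/(2Δ³), which expresses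
  -- the integral of Δ⁻³ by that of Δ.
  have hS : ∫ x in (0 : ℝ)..π / 2, (cycleDelta q x)⁻¹ ^ 3 = ellipticE' q / q ^ 2 := by
    have h1 : ∀ x ∈ [[0, π / 2]], HasDerivAt (cycleY q)
        (1 / 2 * cycleDelta q x - q ^ 2 / 2 * (cycleDelta q x)⁻¹ ^ 3) x := by
      intro x _
      refine (hasDerivAt_cycleY hq x).congr_deriv ?_
      have := hD x
      rw [cycleX]; field_simp
    have h2 := intervalIntegral.integral_eq_sub_of_hasDerivAt h1
      (Continuous.intervalIntegrable (by fun_prop) _ _)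
    rw [intervalIntegral.integral_sub (Continuous.intervalIntegrable (by fun_prop) _ _)
      (Continuous.intervalIntegrable (by fun_prop) _ _), intervalIntegral.integral_const_mul,
      intervalIntegral.integral_const_mul, hE] at h2
    simp only [cycleY, Real.cos_pi_div_two, Real.sin_zero, mul_zero, zero_mul, zero_div,
      sub_zero] at h2
    rw [eq_div_iff (by positivity)]
    linarith
  have h3 : ∀ x, -4 / cycleDelta q x * (a * (cycleX q x + (cycleX q x)⁻¹) + b) =
      -4 * a / q * cycleDelta q x + (-4 * a * q * (cycleDelta q x)⁻¹ ^ 3 +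
        -4 * b * (cycleDelta q x)⁻¹) := by
    intro x
    have := hD x
    rw [cycleX]; field_simp; ring
  simp only [h3]
  rw [intervalIntegral.integral_add (Continuous.intervalIntegrable (by fun_prop) _ _)
    (Continuous.intervalIntegrable (by fun_prop) _ _),
    intervalIntegral.integral_add (Continuous.intervalIntegrable (by fun_prop) _ _)
    (Continuous.intervalIntegrable (by fun_prop) _ _), intervalIntegral.integral_const_mul,
    intervalIntegral.integral_const_mul, intervalIntegral.integral_const_mul, hE, hK, hS]
  field_simp
  ring

theorem exists_cycle_eq_circlePoint (h0 : 0 < q) (h1 : q < 1) : ∃ x : ℝ,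
    (((cycleX q x : ℝ) : ℂ), ((cycleY q x : ℝ) : ℂ)) = circlePoint q 0 := by
  -- The parameter with sin² x = 1/(1 + q) gives l = 1, and on 0 ≤ x ≤ π/2 the sign of ν is
  -- nonnegative, which selects the correct sheet.
  have hle : (1 + q)⁻¹ ≤ 1 := inv_le_one_of_one_le₀ (by linarith)
  have hs : Real.sin (Real.arcsin √(1 + q)⁻¹) = √(1 + q)⁻¹ :=
    Real.sin_arcsin (by linarith [Real.sqrt_nonneg (1 + q)⁻¹]) (Real.sqrt_le_one.2 hle)
  have hs2 : Real.sin (Real.arcsin √(1 + q)⁻¹) ^ 2 = (1 + q)⁻¹ := by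
    rw [hs, Real.sq_sqrt (by positivity)]
  set x := Real.arcsin √(1 + q)⁻¹ with hx
  have hX : cycleX q x = 1 := by
    rw [cycleX, sq_cycleDelta h0.ne', hs2]; field_simp; ring
  have hY : 0 ≤ cycleY q x := by
    refine div_nonneg (mul_nonneg (by nlinarith) (mul_nonneg ?_ (Real.cos_arcsin_nonneg _)))
      (by have := cycleDelta_pos h0.ne' x; positivity)
    rw [hs]; positivity
  refine ⟨x, ?_⟩
  have hmem := (mem_spectralCurve_iff.1 (cyclePoint_mem h0 x)).2
  have habs : |q| < 1 := by rwa [abs_of_pos h0]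
  have hmem' := (mem_spectralCurve_iff.1 (circlePoint_mem habs 0)).2
  rw [circlePoint] at *
  simp only [hX, Complex.ofReal_one, Complex.ofReal_zero, zero_mul, Complex.exp_zero] at *
  rw [← hmem'] at hmem
  have h2 : cycleY q x ^ 2 = (circleRadius q 0 / 2) ^ 2 := by exact_mod_cast hmem
  have h3 := (sq_eq_sq₀ hY (by have := circleRadius_pos habs 0; positivity)).1 h2
  rw [h3]

end

/-! ### The differentials of spectral genus one tori -/

section

variable {q : ℝ}

/-- Points over the unit circle are fixed by ϱ, so there the reality condition says that μ is
unimodular. -/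
theorem norm_circlePoint_eq_one (hq : |q| < 1) {μ : ℂ × ℂ → ℂ}
    (h0 : ∀ p ∈ spectralCurve q, μ p ≠ 0)
    (hρ : ∀ p ∈ spectralCurve q, μ (rhoInv p) = (star (μ p))⁻¹) (φ : ℝ) :
    μ (circlePoint q φ) * star (μ (circlePoint q φ)) = 1 := by
  have hm := circlePoint_mem hq φ
  have h := hρ _ hm
  rw [rhoInv_circlePoint] at h
  nth_rw 1 [h]
  exact inv_mul_cancel₀ (star_ne_zero.2 (h0 _ hm))

/-- Differentiating |μ|² = 1 along the circle makes d ln μ imaginary; as dl/(lν) is imaginary there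
too, ξ must be real. -/
theorem im_eq_zero_of_isLogPrimitive (hq : |q| < 1) {ξ : ℂ → ℂ} {μ : ℂ × ℂ → ℂ}
    (h : IsLogPrimitive q ξ μ) (h0 : ∀ p ∈ spectralCurve q, μ p ≠ 0)
    (hρ : ∀ p ∈ spectralCurve q, μ (rhoInv p) = (star (μ p))⁻¹) (φ : ℝ) :
    (ξ (Complex.exp (φ * Complex.I))).im = 0 := by
  have h1 := h.hasDerivAt_circlePoint hq φ
  have h2 := norm_circlePoint_eq_one hq h0 hρ
  have h3 : HasDerivAt (fun _ : ℝ => (1 : ℂ)) _ φ := (h1.mul h1.star).congr_of_eventuallyEq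
    (Eventually.of_forall fun φ => (h2 φ).symm)
  have h4 := h3.unique (hasDerivAt_const φ 1)
  have hR : (circleRadius q φ : ℂ) ≠ 0 := by exact_mod_cast (circleRadius_pos hq φ).ne'
  have h6 := h2 φ
  generalize μ (circlePoint q φ) = m at h4 h6
  generalize ξ (Complex.exp (φ * Complex.I)) = w at h4 ⊢
  have h5 : Complex.I * (w - star w) = 0 := by
    simp only [star_mul', Complex.star_def, map_div₀, Complex.conj_I, Complex.conj_ofReal,
      map_mul, map_ofNat] at h4 h6 ⊢
    field_simp at h4
    linear_combination (1 / 2 : ℂ) * h4 - Complex.I * (w - starRingEnd ℂ w) * h6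
  have h7 := (mul_eq_zero.1 h5).resolve_left Complex.I_ne_zero
  exact Complex.conj_eq_iff_im.1 (sub_eq_zero.1 h7).symm

theorem laurent_real {a₀ a₁ b : ℂ}
    (h : ∀ φ : ℝ, (a₁ * Complex.exp (φ * Complex.I) + b +
      a₀ * (Complex.exp (φ * Complex.I))⁻¹).im = 0) : b.im = 0 ∧ a₁ = star a₀ := by
  have h1 := h 0
  have h2 := h π
  have h3 := h (π / 2)
  rw [Complex.ofReal_zero, zero_mul, Complex.exp_zero] at h1
  rw [Complex.exp_pi_mul_I] at h2
  push_cast at h3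
  rw [Complex.exp_pi_div_two_mul_I] at h3
  simp at h1 h2 h3
  refine ⟨by linarith, Complex.ext ?_ ?_⟩
  · simp; linarith
  · simp; linarith

/-- The logarithmic differential of an eigenvalue function is determined by two real numbers. -/
theorem exists_torusForm (h0 : 0 < q) (h1 : q < 1) {μ : ℂ × ℂ → ℂ} (hμ : HolomorphicOnCurve q μ)
    (hne : ∀ p ∈ spectralCurve q, μ p ≠ 0)
    (hσ : ∀ p ∈ spectralCurve q, μ (sigmaInv p) = (μ p)⁻¹)
    (hρ : ∀ p ∈ spectralCurve q, μ (rhoInv p) = (star (μ p))⁻¹)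
    {c c' : ℂ} (hc : HasSingularPartAtZero q μ c) (hc' : HasSingularPartAtInfinity q μ c') :
    ∃ s n : ℝ, IsLogPrimitive q (torusForm q s n) μ ∧ ∃ κ : ℂ, (κ = 1 ∨ κ = -1) ∧
      μ (circlePoint q 0) = κ * Complex.exp (s * (circleRadius q 0 / 2 : ℝ) * Complex.I) := by
  have hq : |q| < 1 := by rwa [abs_of_pos h0]
  obtain ⟨ξ, hξ, hlog⟩ := exists_isLogPrimitive hμ hne hσ
  have ht0 := hlog.tendsto_of_hasSingularPartAtZero h0.ne' hc
  have ht1 := hlog.inv.tendsto_of_hasSingularPartAtZero h0.ne' hc'.inv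
  obtain ⟨b, hb⟩ := exists_eq_of_tendsto hξ (a₁ := -(q * c' / 8)) ht0
    (by simpa using ht1.neg)
  set a₀ : ℂ := q * c / 8
  -- Reality on the circle leaves three real parameters: Re a₀, Im a₀ and b. The missing period
  -- along the real cycle will determine b from Re a₀.
  obtain ⟨hbim, ha₁⟩ := laurent_real (a₀ := a₀) (a₁ := -(q * c' / 8)) (b := b) (fun φ => by
    rw [← hb _ (Complex.exp_ne_zero _)]
    exact im_eq_zero_of_isLogPrimitive hq hlog hne hρ φ)
  have hK := ellipticK'_pos h0.ne'
  -- the function along the real cycle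
  set f : ℝ → ℝ := fun x => -4 / cycleDelta q x * (a₀.re * (cycleX q x + (cycleX q x)⁻¹) + b.re)
    with hf
  have hfc : Continuous f := by
    have h2 := continuous_cycleDelta q
    have h3 : ∀ x, cycleDelta q x ≠ 0 := fun x => (cycleDelta_pos h0.ne' x).ne'
    have h4 : Continuous (cycleX q) := by unfold cycleX; fun_prop
    have h5 : ∀ x, cycleX q x ≠ 0 := fun x => (cycleX_pos h0 x).ne'
    exact (continuous_const.div h2 h3).mul ((continuous_const.mul (h4.add (h4.inv₀ h5))).add
      continuous_const)
  set R : ℝ → ℝ := fun x => ∫ y in (0 : ℝ)..x, f y with hR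
  have hRd : ∀ x, HasDerivAt R (f x) x := fun x =>
    intervalIntegral.integral_hasDerivAt_right (hfc.intervalIntegrable _ _)
      (hfc.stronglyMeasurableAtFilter _ _) hfc.continuousAt
  -- The part of ξ containing Im a₀ is i(q s/8)(l⁻¹ - l), which is the exact differential i s dν.
  set s : ℝ := 8 * a₀.im / q with hs
  set m : ℝ → ℂ := fun x => μ (((cycleX q x : ℝ) : ℂ), ((cycleY q x : ℝ) : ℂ)) with hm
  -- Along the real cycle, ln μ splits into the real integral R of the normalisable part and the
  -- imaginary term i s ν, so |μ| sees only R.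
  have hmeq : ∀ x, m x = m 0 * Complex.exp (R x + s * cycleY q x * Complex.I) := by
    intro x
    have hd : ∀ x, HasDerivAt (fun x => m x *
        Complex.exp (-((R x : ℂ) + s * cycleY q x * Complex.I))) 0 x := by
      intro x
      have h2 := ((hRd x).ofReal_comp.add (((hasDerivAt_cycleY h0 x).ofReal_comp.const_mul
        (s : ℂ)).mul_const Complex.I)).neg.cexp
      refine ((hlog.hasDerivAt_cycle h0 x).mul h2).congr_deriv ?_
      have hX : (cycleX q x : ℂ) ≠ 0 := by exact_mod_cast (cycleX_pos h0 x).ne'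
      have hD : (cycleDelta q x : ℂ) ≠ 0 := by exact_mod_cast (cycleDelta_pos h0.ne' x).ne'
      have hqc : (q : ℂ) ≠ 0 := by exact_mod_cast h0.ne'
      have hbre : b = (b.re : ℂ) := (Complex.conj_eq_iff_re.1 (Complex.conj_eq_iff_im.2 hbim)).symm
      have hst : star a₀ = (a₀.re : ℂ) - a₀.im * Complex.I := by
        apply Complex.ext <;> simp
      have ha := (Complex.re_add_im a₀).symm
      simp only [hf, hs, Pi.add_apply, Pi.neg_apply]
      rw [hb _ hX, ha₁, hst]
      push_cast
      generalize a₀.re = u at ha ⊢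
      generalize a₀.im = v at ha ⊢
      generalize b.re = w at hbre ⊢
      rw [ha, hbre]
      generalize Complex.exp _ = E
      field_simp
      ring
    have := is_const_of_deriv_eq_zero (fun x => (hd x).differentiableAt) (fun x => (hd x).deriv) x 0
    have hR0 : R 0 = 0 := by simp [hR]
    have hY0 : cycleY q 0 = 0 := by simp [cycleY]
    simp only [hR0, hY0, Complex.ofReal_zero, mul_zero, zero_mul, add_zero, neg_zero,
      Complex.exp_zero, mul_one] at this
    rw [← this, mul_assoc, ← Complex.exp_add, neg_add_cancel, Complex.exp_zero, mul_one]
  -- Branch points are fixed by σ, hence μ² = 1 there. The value at x = 0, over q⁻¹, will be κ.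
  have hfix : ∀ x, cycleY q x = 0 → m x = 1 ∨ m x = -1 := by
    intro x hx
    have h2 := cyclePoint_mem h0 x
    have h3 := hσ _ h2
    have h4 : sigmaInv (((cycleX q x : ℝ) : ℂ), ((cycleY q x : ℝ) : ℂ)) =
        (((cycleX q x : ℝ) : ℂ), ((cycleY q x : ℝ) : ℂ)) := by simp [sigmaInv, hx]
    rw [h4] at h3
    refine mul_self_eq_one_iff.1 ?_
    nth_rw 1 [hm]
    simp only
    rw [h3]
    exact inv_mul_cancel₀ (hne _ h2)
  have hκ := hfix 0 (by simp [cycleY])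
  have hκn : ‖m 0‖ = 1 := by rcases hκ with h | h <;> simp [h]
  have hRnorm : ∀ x, ‖m x‖ = 1 → R x = 0 := by
    intro x hx
    rw [hmeq x, norm_mul, hκn, one_mul, Complex.norm_exp] at hx
    simpa using hx
  have hRpi : R (π / 2) = 0 := by
    refine hRnorm _ ?_
    rcases hfix (π / 2) (by simp [cycleY]) with h | h <;> simp [h]
  have hint := integral_cycle h0 a₀.re b.re
  have hRpi' : R (π / 2) = -4 * (2 * a₀.re * ellipticE' q / q + b.re * ellipticK' q) := hint
  rw [hRpi] at hRpi'
  -- The number n is obtained by matching n q K'/4 with Re a₀; the vanishing period gives b = -n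
  -- E'/2.
  refine ⟨s, 4 * a₀.re / (q * ellipticK' q), hlog.congr fun l hl => ?_, m 0, hκ, ?_⟩
  · have hbre : b = (b.re : ℂ) := (Complex.conj_eq_iff_re.1 (Complex.conj_eq_iff_im.2 hbim)).symm
    have hst : star a₀ = (a₀.re : ℂ) - a₀.im * Complex.I := by
      apply Complex.ext <;> simp
    have hb2 : b.re = -(2 * a₀.re * ellipticE' q / (q * ellipticK' q)) := by
      field_simp at hRpi' ⊢
      linarith
    have ha := (Complex.re_add_im a₀).symm
    rw [hb _ hl, ha₁, hst, torusForm, normalizedForm, hs]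
    have hqc : (q : ℂ) ≠ 0 := by exact_mod_cast h0.ne'
    have hKc : (ellipticK' q : ℂ) ≠ 0 := by exact_mod_cast hK.ne'
    generalize b.re = w at hbre hb2
    rw [hbre, hb2]
    push_cast
    generalize a₀.re = u at ha ⊢
    generalize a₀.im = v at ha ⊢
    rw [ha]
    field_simp
    ring
  · obtain ⟨x, hx⟩ := exists_cycle_eq_circlePoint h0 h1
    have hmx : m x = μ (circlePoint q 0) := by rw [← hx]
    have hY : (cycleY q x : ℂ) = ((circleRadius q 0 / 2 : ℝ) : ℂ) := congrArg Prod.snd hx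
    have hnorm : ‖m x‖ = 1 := by
      have h2 := congrArg norm (norm_circlePoint_eq_one hq hne hρ 0)
      rw [norm_mul, norm_star, norm_one] at h2
      -- Over l = 1 the unit circle meets the real cycle, and |μ| = 1 there; so R vanishes at this
      -- point as well, and only i s ν remains in the exponent.
      rw [hmx]
      exact (mul_self_eq_one_iff.1 h2).resolve_right (by linarith [norm_nonneg (μ (circlePoint q 0))])
    rw [← hmx, hmeq x, hRnorm x hnorm, hY, Complex.ofReal_zero, zero_add]

/-! ### Singular part and circle period of a given differential -/

theorem hasSingularPartAtZero_torusForm_unique (hq : q ≠ 0) {s n : ℝ} {μ : ℂ × ℂ → ℂ}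
    (h : IsLogPrimitive q (torusForm q s n) μ) {c : ℂ} (hc : HasSingularPartAtZero q μ c) :
    c = 2 * n * ellipticK' q + s * Complex.I := by
  have h1 := h.tendsto_of_hasSingularPartAtZero hq hc
  have h2 : Tendsto (fun l : ℂ => n / 4 * (q * ellipticK' q * (l ^ 2 + 1) - 2 * ellipticE' q * l) +
      Complex.I * (q * s / 8) * (1 - l ^ 2)) (𝓝[≠] 0) (𝓝 (n / 4 * (q * ellipticK' q * (0 ^ 2 + 1) -
        2 * ellipticE' q * 0) + Complex.I * (q * s / 8) * (1 - 0 ^ 2))) :=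
    (Continuous.tendsto (by fun_prop) 0).mono_left nhdsWithin_le_nhds
  have h3 := tendsto_nhds_unique h1 (h2.congr' (by
    filter_upwards [self_mem_nhdsWithin] with l hl
    have hl : l ≠ 0 := hl
    rw [torusForm, normalizedForm]
    field_simp))
  have hqc : (q : ℂ) ≠ 0 := by exact_mod_cast hq
  refine mul_left_cancel₀ hqc ?_
  linear_combination 8 * h3

/-- Integrality of the period over the unit circle. -/
theorem exp_circlePhase_pi (hq : |q| < 1) {s n : ℝ} {μ : ℂ × ℂ → ℂ}
    (h : IsLogPrimitive q (torusForm q s n) μ) {κ : ℂ} (hκ0 : κ ≠ 0)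
    (hκ : μ (circlePoint q 0) = κ * Complex.exp (s * (circleRadius q 0 / 2 : ℝ) * Complex.I)) :
    Complex.exp ((2 * (n * circlePhase q π) : ℝ) * Complex.I) = 1 := by
  have h1 := h.circlePoint_eq hq hκ π
  have h2 := h.circlePoint_eq hq hκ (-π)
  -- The angles π and -π describe the same point of the curve. Since the radius is even and the
  -- phase is odd, equality of the two values of μ leaves exp(2i n Φ(π)) = 1.
  have h3 : circlePoint q (-π) = circlePoint q π := by
    simp only [circlePoint, circleRadius, Real.cos_neg, Prod.mk.injEq, and_true]
    rw [Complex.exp_pi_mul_I]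
    push_cast
    rw [neg_mul, Complex.exp_neg, Complex.exp_pi_mul_I]
    norm_num
  have h4 : circleRadius q (-π) = circleRadius q π := by simp [circleRadius]
  rw [h3, h1, circlePhase_neg, h4] at h2
  have h5 := mul_left_cancel₀ hκ0 h2
  have h6 : ((2 * (n * circlePhase q π) : ℝ) : ℂ) * Complex.I =
      (s * (circleRadius q π / 2) + n * circlePhase q π : ℝ) * Complex.I -
      (s * (circleRadius q π / 2) + n * -circlePhase q π : ℝ) * Complex.I := by
    push_cast; ring
  rw [h6, Complex.exp_sub, h5, div_self (Complex.exp_ne_zero _)]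

end

/-! ### Singular parts of logarithmic primitives -/

/-- The punctured disc is the image of a half plane under the exponential. -/
theorem isPreconnected_punctured_ball {r : ℝ} (hr : 0 < r) :
    IsPreconnected (Metric.ball (0 : ℂ) r \ {0}) := by
  have h : Metric.ball (0 : ℂ) r \ {0} = Complex.exp '' {z | z.re < Real.log r} := by
    ext w
    simp only [Set.mem_sdiff, mem_ball_zero_iff, mem_singleton_iff, mem_image, mem_ofPred_eq]
    constructor
    · rintro ⟨hw, hw0⟩
      refine ⟨Complex.log w, ?_, Complex.exp_log hw0⟩
      rw [Complex.log_re]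
      exact Real.log_lt_log (norm_pos_iff.2 hw0) hw
    · rintro ⟨z, hz, rfl⟩
      refine ⟨?_, Complex.exp_ne_zero z⟩
      rw [Complex.norm_exp]
      exact (Real.lt_log_iff_exp_lt hr).1 hz
  rw [h]
  exact (convex_halfSpace_re_lt _).isPreconnected.image _ Complex.continuous_exp.continuousOn

/-- A solution of a linear equation on a punctured disc whose coefficient has a double pole with
vanishing residue. -/
theorem exists_exp_eq_of_hasDerivAt {r : ℝ} (hr : 0 < r) {m D : ℂ → ℂ} {c : ℂ}
    (hD : DifferentiableOn ℂ D (Metric.ball 0 r))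
    (hm : ∀ w ∈ Metric.ball (0 : ℂ) r \ {0}, HasDerivAt m ((D w - c / w ^ 2) * m w) w)
    (hm0 : ∀ w ∈ Metric.ball (0 : ℂ) r \ {0}, m w ≠ 0) :
    ∃ G : ℂ → ℂ, AnalyticAt ℂ G 0 ∧
      ∀ w ∈ Metric.ball (0 : ℂ) r \ {0}, m w = Complex.exp (c * w⁻¹ + G w) := by
  obtain ⟨G, hG⟩ := hD.isExactOn_ball
  have hopen : IsOpen (Metric.ball (0 : ℂ) r \ {0}) := Metric.isOpen_ball.sdiff isClosed_singleton
  have hd : ∀ w ∈ Metric.ball (0 : ℂ) r \ {0},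
      HasDerivAt (fun w => m w * Complex.exp (-(c * w⁻¹ + G w))) 0 w := by
    intro w hw
    have hw0 : w ≠ 0 := hw.2
    have h1 := (((hasDerivAt_inv hw0).const_mul c).add (hG w hw.1)).neg.cexp
    refine ((hm w hw).mul h1).congr_deriv ?_
    simp only [Pi.neg_apply, Pi.add_apply]
    field_simp
    ring
  obtain ⟨a, ha⟩ := hopen.exists_is_const_of_deriv_eq_zero (isPreconnected_punctured_ball hr)
    (fun w hw => (hd w hw).differentiableAt.differentiableWithinAt) (fun w hw => (hd w hw).deriv)
  have ha0 : a ≠ 0 := by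
    have hmem : ((r / 2 : ℝ) : ℂ) ∈ Metric.ball (0 : ℂ) r \ {0} := by
      refine ⟨?_, ?_⟩
      · rw [mem_ball_zero_iff, Complex.norm_real, Real.norm_of_nonneg (by positivity)]
        linarith
      · simpa using hr.ne'
    rw [← ha _ hmem]
    exact mul_ne_zero (hm0 _ hmem) (Complex.exp_ne_zero _)
  have hGan : AnalyticAt ℂ G 0 :=
    DifferentiableOn.analyticAt (s := Metric.ball 0 r)
      (fun w hw => (hG w hw).differentiableAt.differentiableWithinAt) (Metric.ball_mem_nhds 0 hr)
  -- The nonzero constant of integration is absorbed into G.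
  refine ⟨fun w => G w + Complex.log a, hGan.add analyticAt_const, fun w hw => ?_⟩
  rw [← add_assoc, Complex.exp_add, Complex.exp_log ha0, ← ha w hw, mul_left_comm,
    ← Complex.exp_add, add_neg_cancel, Complex.exp_zero, mul_one]

theorem curveSq_inv_eq {q : ℝ} {l : ℂ} (hl : l ≠ 0) :
    (curveSq q l)⁻¹ = 4 * l / ((l - q) * (1 - q * l)) := by
  rw [curveSq, show l⁻¹ - (q : ℂ) = (1 - q * l) / l by field_simp]
  simp only [inv_div, mul_div_assoc', div_div_eq_mul_div]

/-- A parametrisation of the spectral curve near `y⁺` by `w = 1 / ν`, with `l = Λ (w²)`. -/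
theorem exists_local_parameter {q : ℝ} (hq : q ≠ 0) :
    ∃ Λ : ℂ → ℂ, AnalyticAt ℂ Λ 0 ∧ Λ 0 = 0 ∧ HasDerivAt Λ (-q / 4) 0 ∧
      (∀ᶠ u in 𝓝 (0 : ℂ), 4 * Λ u / ((Λ u - q) * (1 - q * Λ u)) = u) ∧
      ∀ᶠ l in 𝓝 (0 : ℂ), Λ (4 * l / ((l - q) * (1 - q * l))) = l := by
  have hqc : (q : ℂ) ≠ 0 := by exact_mod_cast hq
  set z : ℂ → ℂ := fun l => 4 * l / ((l - q) * (1 - q * l)) with hz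
  have hz0 : z 0 = 0 := by simp [hz]
  have hden : ((0 : ℂ) - q) * (1 - q * 0) ≠ 0 := by simpa using hq
  have hzan : AnalyticAt ℂ z 0 := by
    refine AnalyticAt.div (by fun_prop) (by fun_prop) hden
  have hzd : HasDerivAt z (-4 / q) 0 := by
    have h1 : HasDerivAt (fun l : ℂ => 4 * l) 4 0 := by
      simpa using (hasDerivAt_id (0 : ℂ)).const_mul (4 : ℂ)
    have h2 : HasDerivAt (fun l : ℂ => (l - q) * (1 - q * l)) (deriv (fun l : ℂ =>
      (l - q) * (1 - q * l)) 0) 0 := DifferentiableAt.hasDerivAt (by fun_prop)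
    refine (h1.div h2 hden).congr_deriv ?_
    simp only [mul_zero, zero_mul, sub_zero, zero_sub]
    field_simp
  have hne : deriv z 0 ≠ 0 := by
    rw [hzd.deriv]
    exact div_ne_zero (by norm_num) hqc
  have hs := hzan.hasStrictDerivAt
  set Λ := hs.localInverse _ _ _ hne with hΛ
  have hΛan : AnalyticAt ℂ Λ (z 0) := hzan.analyticAt_localInverse hne
  have hΛ0 : Λ (z 0) = 0 := HasStrictFDerivAt.localInverse_apply_image ..
  have hl : ∀ᶠ l in 𝓝 (0 : ℂ), Λ (z l) = l := HasStrictFDerivAt.eventually_left_inverse ..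
  have hr : ∀ᶠ u in 𝓝 (z 0), z (Λ u) = u := HasStrictFDerivAt.eventually_right_inverse ..
  have hd : HasStrictDerivAt Λ (deriv z 0)⁻¹ (z 0) := hs.to_localInverse hne
  rw [hz0] at hΛan hΛ0 hr hd
  refine ⟨Λ, hΛan, hΛ0, hd.hasDerivAt.congr_deriv ?_, hr, hl⟩
  rw [hzd.deriv]
  field_simp

/-- In the parameter w = 1/ν one has l = Λ(w²), and d ln μ becomes Q(w²)/w² dw with Q analytic. This
is even in w, so the double pole has no residue and ln μ is a pole term plus a holomorphic function.
-/
theorem IsLogPrimitive.hasSingularPartAtZero {q : ℝ} (hq : q ≠ 0) {ξ P : ℂ → ℂ} {μ : ℂ × ℂ → ℂ}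
    (h : IsLogPrimitive q ξ μ) (hP : AnalyticAt ℂ P 0) (hξ : ∀ l ≠ 0, ξ l = P l / l)
    (hne : ∀ p ∈ spectralCurve q, μ p ≠ 0) : HasSingularPartAtZero q μ (8 * P 0 / q) := by
  have hqc : (q : ℂ) ≠ 0 := by exact_mod_cast hq
  obtain ⟨Λ, hΛ, hΛ0, hΛd, hright, hleft⟩ := exists_local_parameter hq
  have hden : ∀ᶠ u in 𝓝 (0 : ℂ), (Λ u - q) * (1 - q * Λ u) ≠ 0 := by
    refine ContinuousAt.eventually_ne ?_ (by simpa [hΛ0] using hq)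
    have := hΛ.continuousAt
    fun_prop
  -- For u = w² ≠ 0 small, the last square is (u/Λ(u))²; written in this way Q is visibly analytic
  -- at u = 0.
  set Q : ℂ → ℂ := fun u => 2 * deriv Λ u * P (Λ u) * (4 / ((Λ u - q) * (1 - q * Λ u))) ^ 2
    with hQ
  have hQan : AnalyticAt ℂ Q 0 := by
    have h1 : AnalyticAt ℂ (fun u => P (Λ u)) 0 := AnalyticAt.comp_of_eq hP hΛ hΛ0
    have h2 := hΛ.deriv
    have h3 : AnalyticAt ℂ (fun u => 4 / ((Λ u - q) * (1 - q * Λ u))) 0 :=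
      analyticAt_const.div ((hΛ.sub analyticAt_const).mul
        (analyticAt_const.sub (analyticAt_const.mul hΛ))) hden.self_of_nhds
    exact ((analyticAt_const.mul h2).mul h1).mul (h3.pow 2)
  have hQ0 : Q 0 = -(8 * P 0 / q) := by
    simp only [hQ, hΛ0, hΛd.deriv]
    field_simp
    ring
  obtain ⟨ρ, hρ, hball⟩ := Metric.eventually_nhds_iff_ball.1
    (((hright.and hden).and hΛ.eventually_analyticAt).and hQan.eventually_analyticAt)
  set r := √ρ with hr
  have hr0 : 0 < r := Real.sqrt_pos.2 hρ
  have hsq : ∀ w ∈ Metric.ball (0 : ℂ) r, w ^ 2 ∈ Metric.ball (0 : ℂ) ρ := by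
    intro w hw
    rw [mem_ball_zero_iff] at hw ⊢
    rw [norm_pow, ← Real.sq_sqrt hρ.le]
    exact pow_lt_pow_left₀ hw (norm_nonneg _) (by norm_num)
  have hΛne : ∀ u ∈ Metric.ball (0 : ℂ) ρ, u ≠ 0 → Λ u ≠ 0 := fun u hu hu0 h0 =>
    hu0 (by rw [← (hball u hu).1.1.1, h0]; simp)
  have hcs : ∀ u ∈ Metric.ball (0 : ℂ) ρ, u ≠ 0 → curveSq q (Λ u) = u⁻¹ := fun u hu hu0 => by
    rw [← inv_inv (curveSq q (Λ u)), curveSq_inv_eq (hΛne u hu hu0), (hball u hu).1.1.1]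
  have hmem : ∀ w ∈ Metric.ball (0 : ℂ) r, w ≠ 0 → (Λ (w ^ 2), w⁻¹) ∈ spectralCurve q := by
    intro w hw hw0
    rw [mem_spectralCurve_iff]
    refine ⟨hΛne _ (hsq w hw) (pow_ne_zero 2 hw0), ?_⟩
    simp only
    rw [hcs _ (hsq w hw) (pow_ne_zero 2 hw0), inv_pow]
  have hopen : IsOpen (Metric.ball (0 : ℂ) r \ {0}) := Metric.isOpen_ball.sdiff isClosed_singleton
  have hD : DifferentiableOn ℂ (fun w => dslope Q 0 (w ^ 2)) (Metric.ball 0 r) := by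
    have h1 : DifferentiableOn ℂ (dslope Q 0) (Metric.ball 0 ρ) :=
      (Complex.differentiableOn_dslope (Metric.ball_mem_nhds 0 hρ)).2
        fun u hu => (hball u hu).2.differentiableAt.differentiableWithinAt
    exact h1.comp (by fun_prop) hsq
  have hm : ∀ w ∈ Metric.ball (0 : ℂ) r \ {0}, HasDerivAt (fun w => μ (Λ (w ^ 2), w⁻¹))
      ((dslope Q 0 (w ^ 2) - 8 * P 0 / q / w ^ 2) * μ (Λ (w ^ 2), w⁻¹)) w := by
    intro w hw
    have hw0 : w ≠ 0 := hw.2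
    have hu := hsq w hw.1
    have hu0 := pow_ne_zero 2 hw0
    obtain ⟨⟨⟨hR, hdn⟩, hLan⟩, -⟩ := hball _ hu
    have hLd := hLan.differentiableAt.hasDerivAt
    have hLne := hΛne _ hu hu0
    have hrel : curveSqDeriv q (Λ (w ^ 2)) * deriv Λ (w ^ 2) = -((w ^ 2) ^ 2)⁻¹ := by
      refine ((hasDerivAt_curveSq q hLne).comp (w ^ 2) hLd).unique
        ((hasDerivAt_inv hu0).congr_of_eventuallyEq ?_)
      filter_upwards [Metric.isOpen_ball.mem_nhds hu, isOpen_ne.mem_nhds hu0] with u hu hu0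
        using hcs u hu hu0
    -- The factor r is the quotient of dl/dw = 2wΛ'(w²) by ν = w⁻¹.
    have h1 := h.hasDerivAt (x := fun w => Λ (w ^ 2)) (y := fun w => w⁻¹) (u := w)
      (r := 2 * w ^ 2 * deriv Λ (w ^ 2)) ?_ ?_ ?_
    · refine HasDerivAt.congr_deriv (f := fun w => μ (Λ (w ^ 2), w⁻¹)) h1 ?_
      congr 1
      rw [dslope_of_ne _ hu0, slope_def_field, hQ0, hξ _ hLne, sub_zero]
      have h4 : 4 / ((Λ (w ^ 2) - q) * (1 - q * Λ (w ^ 2))) = w ^ 2 / Λ (w ^ 2) := by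
        rw [eq_div_iff hLne, div_mul_eq_mul_div]
        exact hR
      simp only [hQ]
      rw [h4]
      field_simp
      ring
    · refine (hLd.comp w (hasDerivAt_pow 2 w)).congr_deriv ?_
      field_simp
      push_cast
      ring
    · refine (hasDerivAt_inv hw0).congr_deriv ?_
      have : curveSqDeriv q (Λ (w ^ 2)) / 2 * (2 * w ^ 2 * deriv Λ (w ^ 2)) =
        w ^ 2 * (curveSqDeriv q (Λ (w ^ 2)) * deriv Λ (w ^ 2)) := by ring
      rw [this, hrel]
      field_simp
    · filter_upwards [hopen.mem_nhds hw] with v hv using hmem v hv.1 hv.2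
  obtain ⟨G, hG, hGeq⟩ := exists_exp_eq_of_hasDerivAt hr0 hD hm
    (fun w hw => hne _ (hmem w hw.1 hw.2))
  obtain ⟨δ, hδ, hball'⟩ := Metric.eventually_nhds_iff_ball.1 hleft
  obtain ⟨δ', hδ', hball''⟩ := Metric.eventually_nhds_iff_ball.1
    ((show ContinuousAt (fun l : ℂ => 4 * l / ((l - q) * (1 - q * l))) 0 from
      ContinuousAt.div (by fun_prop) (by fun_prop) (by simpa using hq)).eventually
      (Metric.ball_mem_nhds _ hρ))
  refine ⟨G, hG, min δ δ', lt_min hδ hδ', fun p hp hpδ => ?_⟩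
  obtain ⟨hp0, hp2⟩ := mem_spectralCurve_iff.1 hp
  have hl := hball' p.1 (by simpa using hpδ.trans_le (min_le_left _ _))
  have hb := hball'' p.1 (by simpa using hpδ.trans_le (min_le_right _ _))
  rw [← curveSq_inv_eq hp0, ← hp2] at hl hb
  have hp2ne : p.2 ≠ 0 := by
    intro h0
    rw [h0] at hl
    simp only [ne_eq, OfNat.ofNat_ne_zero, not_false_eq_true, zero_pow, inv_zero, hΛ0] at hl
    exact hp0 hl.symm
  have hw : p.2⁻¹ ∈ Metric.ball (0 : ℂ) r := by
    have hb' : ‖(p.2 ^ 2)⁻¹‖ < ρ := by simpa using hb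
    rw [mem_ball_zero_iff, hr]
    apply Real.lt_sqrt_of_sq_lt
    rwa [← norm_pow, inv_pow]
  have := hGeq p.2⁻¹ ⟨hw, inv_ne_zero hp2ne⟩
  rw [inv_pow, hl, inv_inv] at this
  exact this

theorem hasSingularPartAtZero_torusForm {q s n : ℝ} (hq : q ≠ 0) {μ : ℂ × ℂ → ℂ}
    (h : IsLogPrimitive q (torusForm q s n) μ) (hne : ∀ p ∈ spectralCurve q, μ p ≠ 0) :
    HasSingularPartAtZero q μ (2 * n * ellipticK' q + s * Complex.I) := by
  have hqc : (q : ℂ) ≠ 0 := by exact_mod_cast hq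
  have h1 := h.hasSingularPartAtZero hq (P := fun l : ℂ =>
    n / 4 * (q * ellipticK' q * (l ^ 2 + 1) - 2 * ellipticE' q * l) +
      Complex.I * (q * s / 8) * (1 - l ^ 2)) (by fun_prop) (fun l hl => ?_) hne
  · convert h1 using 1
    field_simp
    ring
  · rw [torusForm, normalizedForm]
    field_simp

/-- The map l ↦ l⁻¹ exchanges y⁺ and y⁻ and keeps ν; it preserves s and changes the sign of n,
because i s dν is preserved while the normalised differential changes sign. -/
theorem hasSingularPartAtInfinity_torusForm {q s n : ℝ} (hq : q ≠ 0) {μ : ℂ × ℂ → ℂ}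
    (h : IsLogPrimitive q (torusForm q s n) μ) (hne : ∀ p ∈ spectralCurve q, μ p ≠ 0) :
    HasSingularPartAtInfinity q μ (-2 * n * ellipticK' q + s * Complex.I) := by
  have h1 : IsLogPrimitive q (torusForm q s (-n)) (fun p => μ (p.1⁻¹, p.2)) := by
    refine h.inv.congr fun l _ => ?_
    simp only [torusForm, normalizedForm, inv_inv]
    push_cast
    ring
  have h2 := hasSingularPartAtZero_torusForm hq h1 fun p hp => ?_
  · refine HasSingularPartAtZero.inv ?_
    convert h2 using 1
    push_cast
    ring
  · rw [mem_spectralCurve_iff] at hp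
    exact hne _ (mem_spectralCurve_iff.2 ⟨inv_ne_zero hp.1, hp.2.trans (curveSq_inv q p.1).symm⟩)

theorem linearIndependent_pair_complex {z : Fin 2 → ℂ} :
    LinearIndependent ℝ z ↔ (z 0).re * (z 1).im - (z 0).im * (z 1).re ≠ 0 := by
  have hz : z = ![z 0, z 1] := by ext i; fin_cases i <;> rfl
  rw [hz, LinearIndependent.pair_iff]
  simp only [Matrix.cons_val_zero, Matrix.cons_val_one]
  generalize z 0 = v
  generalize z 1 = w
  constructor
  · intro h hdet
    have h1 := h w.im (-v.im) (Complex.ext (by simp; linarith) (by simp; ring))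
    have h2 := h w.re (-v.re) (Complex.ext (by simp; ring) (by simp; linarith))
    have hv : v = 0 := Complex.ext (by simpa using h2.2) (by simpa using h1.2)
    have := h 1 0 (by simp [hv])
    exact one_ne_zero this.1
  · intro hdet a b hab
    have hre := congrArg Complex.re hab
    have him := congrArg Complex.im hab
    simp at hre him
    constructor
    · refine (mul_eq_zero.1 ?_).resolve_right hdet
      linear_combination w.im * hre - w.re * him
    · refine (mul_eq_zero.1 ?_).resolve_right hdet
      linear_combination v.re * him - v.im * hre

/-! ### Primitives on slit planes -/

/-- The complex plane without the real points outside `I`. -/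
def slitSet (I : Set ℝ) : Set ℂ := {z | z.im ≠ 0 ∨ z.re ∈ I}

theorem isOpen_slitSet {I : Set ℝ} (hI : IsOpen I) : IsOpen (slitSet I) :=
  (isOpen_ne.preimage Complex.continuous_im).union (hI.preimage Complex.continuous_re)

theorem starConvex_slitSet {I : Set ℝ} (hI : Convex ℝ I) {c : ℝ} (hc : c ∈ I) :
    StarConvex ℝ (c : ℂ) (slitSet I) := by
  intro z hz a b ha hb hab
  rcases hb.eq_or_lt with rfl | hb
  · right
    rw [add_zero] at hab
    simpa [hab] using hc
  · rcases hz with hz | hz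
    · left
      simpa using ⟨hb.ne', hz⟩
    · right
      simpa using hI hc hz ha hb.le hab

theorem slitSet_mono {I I' : Set ℝ} (h : I ⊆ I') : slitSet I ⊆ slitSet I' :=
  fun _ hz => hz.imp_right fun h' => h h'

theorem ne_zero_of_mem_slitSet {I : Set ℝ} (h : (0 : ℝ) ∉ I) {z : ℂ} (hz : z ∈ slitSet I) :
    z ≠ 0 := by
  rintro rfl
  rcases hz with hz | hz
  · exact hz rfl
  · exact h hz

theorem inv_mem_slitSet {I I' : Set ℝ} (h : ∀ x ∈ I, x⁻¹ ∈ I') (h0 : (0 : ℝ) ∉ I) {z : ℂ}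
    (hz : z ∈ slitSet I) : z⁻¹ ∈ slitSet I' := by
  have hz0 := ne_zero_of_mem_slitSet h0 hz
  by_cases him : z.im = 0
  · right
    have hz' : z = (z.re : ℂ) := Complex.ext rfl (by simp [him])
    rw [hz', ← Complex.ofReal_inv, Complex.ofReal_re]
    exact h _ (hz.resolve_left fun h => h him)
  · left
    rw [Complex.inv_im]
    exact div_ne_zero (neg_ne_zero.2 him) (Complex.normSq_pos.2 hz0).ne'

theorem star_mem_slitSet {I : Set ℝ} {z : ℂ} (hz : z ∈ slitSet I) : star z ∈ slitSet I := by
  rcases hz with hz | hz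
  · left; simpa using hz
  · right; simpa using hz

theorem ofReal_mem_slitSet {I : Set ℝ} {x : ℝ} (hx : x ∈ I) : (x : ℂ) ∈ slitSet I :=
  Or.inr (by simpa using hx)

/-- Averages over radial segments solve a first order equation with a regular singularity at the
centre. -/
theorem exists_radial_solution {U : Set ℂ} (hU : IsOpen U) {a : ℂ} (ha : StarConvex ℝ a U)
    {g : ℂ → ℂ} (hg : DifferentiableOn ℂ g U) (k : ℕ) :
    ∃ J : ℂ → ℂ, ∀ l ∈ U, ∃ d, HasDerivAt J d l ∧ k * (l - a) * d + J l = g l := by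
  have hmem : ∀ l ∈ U, ∀ x ∈ [[(0 : ℝ), 1]], a + (x : ℂ) ^ k * (l - a) ∈ U := by
    intro l hl x hx
    rw [uIcc_of_le zero_le_one] at hx
    have := ha.add_smul_sub_mem hl (pow_nonneg hx.1 k) (pow_le_one₀ hx.1 hx.2)
    simpa using this
  have hg' : ContinuousOn (deriv g) U :=
    ((hg.analyticOnNhd hU).deriv).continuousOn
  have hd : ∀ l ∈ U, ∀ x ∈ [[(0 : ℝ), 1]],
      HasDerivAt g (deriv g (a + (x : ℂ) ^ k * (l - a))) (a + (x : ℂ) ^ k * (l - a)) :=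
    fun l hl x hx => (hg.differentiableAt (hU.mem_nhds (hmem l hl x hx))).hasDerivAt
  have hcont : ∀ l ∈ U, ContinuousOn (fun x : ℝ => g (a + (x : ℂ) ^ k * (l - a))) [[0, 1]] :=
    fun l hl => hg.continuousOn.comp (by fun_prop) (hmem l hl)
  have hcont' : ContinuousOn (Function.uncurry fun (l : ℂ) (x : ℝ) =>
      (x : ℂ) ^ k * deriv g (a + (x : ℂ) ^ k * (l - a))) (U ×ˢ [[(0 : ℝ), 1]]) :=
    ContinuousOn.mul (by fun_prop) (hg'.comp (f := fun p : ℂ × ℝ => a + (p.2 : ℂ) ^ k * (p.1 - a))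
      (by fun_prop) fun p hp => hmem p.1 hp.1 p.2 hp.2)
  -- J(l) is the integral over 0 ≤ x ≤ 1 of g(a + x^k (l - a)). The equation follows from
  -- integrating the x-derivative of x g(a + x^k (l - a)).
  refine ⟨fun l => ∫ x in (0 : ℝ)..1, g (a + (x : ℂ) ^ k * (l - a)), fun l hl =>
    ⟨_, hasDerivAt_intervalIntegral_of_continuousOn
      (F := fun l x => g (a + (x : ℂ) ^ k * (l - a)))
      (F' := fun l x => (x : ℂ) ^ k * deriv g (a + (x : ℂ) ^ k * (l - a)))
      hU hcont hcont' (fun l hl x hx => ?_) hl, ?_⟩⟩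
  · have h1 : HasDerivAt (fun l : ℂ => a + (x : ℂ) ^ k * (l - a)) ((x : ℂ) ^ k) l := by
      simpa using (((hasDerivAt_id l).sub_const a).const_mul ((x : ℂ) ^ k)).const_add a
    refine ((hd l hl x hx).comp l h1).congr_deriv ?_
    ring
  · have hc1 := hcont l hl
    have hc2 : ContinuousOn (fun x : ℝ => (x : ℂ) ^ k * deriv g (a + (x : ℂ) ^ k * (l - a)))
        [[0, 1]] := hcont'.comp (f := fun x : ℝ => (l, x)) (by fun_prop) fun x hx => ⟨hl, hx⟩
    have hc3 : ContinuousOn (fun x : ℝ => k * (l - a) *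
        ((x : ℂ) ^ k * deriv g (a + (x : ℂ) ^ k * (l - a)))) [[0, 1]] := continuousOn_const.mul hc2
    have h2 : ∀ x ∈ [[(0 : ℝ), 1]], HasDerivAt
        (fun x : ℝ => (x : ℂ) * g (a + (x : ℂ) ^ k * (l - a)))
        (k * (l - a) * ((x : ℂ) ^ k * deriv g (a + (x : ℂ) ^ k * (l - a))) +
          g (a + (x : ℂ) ^ k * (l - a))) x := by
      intro x hx
      have h3 : HasDerivAt (fun z : ℂ => z * g (a + z ^ k * (l - a)))
          (1 * g (a + (x : ℂ) ^ k * (l - a)) + (x : ℂ) * (deriv g (a + (x : ℂ) ^ k * (l - a)) *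
            (k * (x : ℂ) ^ (k - 1) * (l - a)))) (x : ℂ) := by
        have h4 : HasDerivAt (fun z : ℂ => a + z ^ k * (l - a)) (k * (x : ℂ) ^ (k - 1) * (l - a))
            (x : ℂ) := ((hasDerivAt_pow k (x : ℂ)).mul_const (l - a)).const_add a
        exact (hasDerivAt_id (x : ℂ)).mul ((hd l hl x hx).comp (x : ℂ) h4)
      refine h3.comp_ofReal.congr_deriv ?_
      rcases Nat.eq_zero_or_pos k with rfl | hk
      · simp
      · rw [← Nat.sub_add_cancel hk, pow_succ]
        simp only [Nat.add_sub_cancel]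
        ring
    have h5 := intervalIntegral.integral_eq_sub_of_hasDerivAt h2
      ((hc3.add hc1).intervalIntegrable)
    rw [intervalIntegral.integral_add hc3.intervalIntegrable hc1.intervalIntegrable, intervalIntegral.integral_const_mul] at h5
    simpa using h5

theorem exists_primitive_of_starConvex {U : Set ℂ} (hU : IsOpen U) {a : ℂ} (ha : StarConvex ℝ a U)
    {f : ℂ → ℂ} (hf : DifferentiableOn ℂ f U) :
    ∃ L : ℂ → ℂ, L a = 0 ∧ ∀ l ∈ U, HasDerivAt L (f l) l := by
  obtain ⟨J, hJ⟩ := exists_radial_solution hU ha hf 1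
  refine ⟨fun l => (l - a) * J l, by simp, fun l hl => ?_⟩
  obtain ⟨d, hd, h⟩ := hJ l hl
  refine (((hasDerivAt_id l).sub_const a).mul hd).congr_deriv ?_
  rw [← h]
  simp only [id]
  push_cast
  ring

theorem eqOn_of_hasDerivAt_starConvex {U : Set ℂ} (hU : IsOpen U) {a : ℂ} (haU : a ∈ U)
    (ha : StarConvex ℝ a U) {f g f' : ℂ → ℂ} (hf : ∀ z ∈ U, HasDerivAt f (f' z) z)
    (hg : ∀ z ∈ U, HasDerivAt g (f' z) z) (hfg : f a = g a) : EqOn f g U := by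
  have hd : ∀ z ∈ U, HasDerivAt (fun z => f z - g z) 0 z := fun z hz =>
    ((hf z hz).sub (hg z hz)).congr_deriv (sub_self _)
  intro z hz
  have := hU.is_const_of_deriv_eq_zero (ha.isPathConnected haU).isConnected.isPreconnected
    (fun z hz => (hd z hz).differentiableAt.differentiableWithinAt) (fun z hz => (hd z hz).deriv)
    hz haU
  rw [hfg, sub_self] at this
  exact sub_eq_zero.1 this

/-! ### Odd functions on the spectral curve with given differential -/

/-- At `l`, the differential of `ν T(l)` is `ξ dl / (l ν)`. -/
def IsOddPrimitiveAt (q : ℝ) (ξ T : ℂ → ℂ) (l : ℂ) : Prop :=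
  ∃ d, HasDerivAt T d l ∧ curveSq q l * d + curveSqDeriv q l / 2 * T l = ξ l / l

namespace IsOddPrimitiveAt

variable {q : ℝ} {ξ T : ℂ → ℂ} {l : ℂ}

theorem congr_of_eventuallyEq (h : IsOddPrimitiveAt q ξ T l) {T' : ℂ → ℂ} (hT : T' =ᶠ[𝓝 l] T) :
    IsOddPrimitiveAt q ξ T' l := by
  obtain ⟨d, hd, h⟩ := h
  exact ⟨d, hd.congr_of_eventuallyEq hT, by rwa [hT.eq_of_nhds]⟩

theorem add {ξ' T' : ℂ → ℂ} (h : IsOddPrimitiveAt q ξ T l) (h' : IsOddPrimitiveAt q ξ' T' l) :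
    IsOddPrimitiveAt q (fun l => ξ l + ξ' l) (fun l => T l + T' l) l := by
  obtain ⟨d, hd, h⟩ := h
  obtain ⟨d', hd', h'⟩ := h'
  refine ⟨d + d', hd.add hd', ?_⟩
  rw [add_div, ← h, ← h']
  ring

theorem const_mul (h : IsOddPrimitiveAt q ξ T l) (c : ℂ) :
    IsOddPrimitiveAt q (fun l => c * ξ l) (fun l => c * T l) l := by
  obtain ⟨d, hd, h⟩ := h
  refine ⟨c * d, hd.const_mul c, ?_⟩
  rw [mul_div_assoc, ← h]
  ring

theorem inv (hl : l ≠ 0) (h : IsOddPrimitiveAt q ξ T l⁻¹) :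
    IsOddPrimitiveAt q (fun l => ξ l⁻¹) (fun l => -T l⁻¹) l := by
  obtain ⟨d, hd, h⟩ := h
  refine ⟨_, (hd.comp l (hasDerivAt_inv hl)).neg, ?_⟩
  rw [curveSq_inv, curveSqDeriv_inv q hl] at h
  rw [div_inv_eq_mul] at h
  rw [eq_div_iff hl]
  have h2 : l⁻¹ * l = 1 := inv_mul_cancel₀ hl
  rw [← mul_left_inj' hl, ← h]
  beta_reduce
  generalize T l⁻¹ = t
  field_simp

theorem star (h : IsOddPrimitiveAt q ξ T (star l)) :
    IsOddPrimitiveAt q (fun l => star (ξ (star l))) (fun l => star (T (star l))) l := by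
  obtain ⟨d, hd, h⟩ := h
  refine ⟨Star.star d, ?_, ?_⟩
  · exact hasDerivAt_conj_conj_iff.2 (by simpa using hd)
  · have h1 := congrArg Star.star h
    have h2 : Star.star (curveSqDeriv q (Star.star l)) = curveSqDeriv q l := by
      simp [curveSqDeriv]
    rw [curveSq_star] at h1
    simp only [star_add, star_mul', star_div₀, star_star, h2, star_ofNat] at h1
    exact h1

theorem hasDerivAt_comp {𝕜 : Type*} [NontriviallyNormedField 𝕜] [NormedAlgebra 𝕜 ℂ]
    {x y : 𝕜 → ℂ} {u : 𝕜} {r : ℂ} (h : IsOddPrimitiveAt q ξ T (x u))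
    (hx : HasDerivAt x (y u * r) u) (hy : HasDerivAt y (curveSqDeriv q (x u) / 2 * r) u)
    (hxy : y u ^ 2 = curveSq q (x u)) :
    HasDerivAt (fun v => y v * T (x v)) (r / x u * ξ (x u)) u := by
  obtain ⟨d, hd, h⟩ := h
  have h1 := hd.hasFDerivAt.restrictScalars 𝕜 |>.comp_hasDerivAt u hx
  refine (hy.mul h1).congr_deriv ?_
  rw [show r / x u * ξ (x u) = r * (ξ (x u) / x u) by ring, ← h, ← hxy]
  simp
  ring

end IsOddPrimitiveAt

theorem isOddPrimitiveAt_const (q : ℝ) (c : ℂ) {l : ℂ} (hl : l ≠ 0) :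
    IsOddPrimitiveAt q (fun l => c * (q / 8) * (l⁻¹ - l)) (fun _ => c) l := by
  refine ⟨0, hasDerivAt_const l c, ?_⟩
  rw [curveSqDeriv]
  field_simp
  ring

/-- Locally ln μ is a constant plus νT(l). Allowing T and κ to depend on the point lets functions
over different slit planes be glued. -/
theorem isLogPrimitive_of_isOddPrimitiveAt {q : ℝ} {ξ : ℂ → ℂ} {μ : ℂ × ℂ → ℂ}
    (h : ∀ p ∈ spectralCurve q, ∃ (T : ℂ → ℂ) (κ : ℂ),
      (∀ᶠ l in 𝓝 p.1, IsOddPrimitiveAt q ξ T l) ∧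
      ∀ᶠ z in 𝓝[spectralCurve q] p, μ z = κ * Complex.exp (z.2 * T z.1)) :
    IsLogPrimitive q ξ μ := by
  intro p hp
  obtain ⟨T, κ, hT, hμ⟩ := h p hp
  have hTan : AnalyticAt ℂ T p.1 := by
    rw [Complex.analyticAt_iff_eventually_differentiableAt]
    filter_upwards [hT] with l hl
    obtain ⟨d, hd, -⟩ := hl
    exact hd.differentiableAt
  obtain ⟨d, hd, hodd⟩ := hT.self_of_nhds
  refine ⟨fun z => κ * Complex.exp (z.2 * T z.1),
    analyticAt_const.mul (analyticAt_snd.mul (AnalyticAt.comp_of_eq hTan analyticAt_fst rfl)).cexp,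
    hμ, ?_⟩
  have h1 : HasFDerivAt (fun z : ℂ × ℂ => T z.1) (d • ContinuousLinearMap.fst ℂ ℂ ℂ) p :=
    hd.comp_hasFDerivAt p hasFDerivAt_fst
  have h2 := (((hasFDerivAt_snd (𝕜 := ℂ) (p := p)).mul h1).cexp).const_mul κ
  have h3 : fderiv ℂ (fun z : ℂ × ℂ => κ * Complex.exp (z.2 * T z.1)) p = _ := h2.fderiv
  rw [h3, ← hodd, ← (mem_spectralCurve_iff.1 hp).2]
  simp
  ring

/-! ### Primitives of the normalised differential -/

theorem normalizedForm_inv (q : ℝ) (l : ℂ) : normalizedForm q l⁻¹ = normalizedForm q l := by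
  simp only [normalizedForm, inv_inv, add_comm l]

theorem normalizedForm_star (q : ℝ) (l : ℂ) :
    normalizedForm q (star l) = star (normalizedForm q l) := by
  simp [normalizedForm]

/-- The principal branch of `ν`. -/
noncomputable def principalNu (q : ℝ) (l : ℂ) : ℂ := curveSq q l ^ (2⁻¹ : ℂ)

theorem sq_principalNu (q : ℝ) (l : ℂ) : principalNu q l ^ 2 = curveSq q l := by
  rw [principalNu, ← Complex.cpow_nat_mul]
  norm_num

theorem principalNu_inv (q : ℝ) (l : ℂ) : principalNu q l⁻¹ = principalNu q l := by
  rw [principalNu, curveSq_inv, principalNu]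

section

variable {q : ℝ}

theorem principalNu_exp (hq : |q| < 1) (φ : ℝ) :
    principalNu q (Complex.exp (φ * Complex.I)) = ((circleRadius q φ / 2 : ℝ) : ℂ) := by
  have h := (mem_spectralCurve_iff.1 (circlePoint_mem hq φ)).2
  simp only [circlePoint] at h
  rw [principalNu, ← h]
  refine Complex.sq_cpow_two_inv ?_
  rw [Complex.ofReal_re]
  exact half_pos (circleRadius_pos hq φ)

/-- Off the real axis, ν² is real only on the unit circle, where it is positive; on the real axis it
is positive exactly on the admitted intervals. Hence the principal root is a holomorphic branch of ν
here. -/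
theorem curveSq_mem_slitPlane (h0 : 0 < q) (h1 : q < 1) {l : ℂ}
    (hl : l ∈ slitSet (Iio 0 ∪ Ioo q q⁻¹)) : curveSq q l ∈ Complex.slitPlane := by
  have hl0 : l ≠ 0 := ne_zero_of_mem_slitSet (by simp [h0.le]) hl
  by_cases him : l.im = 0
  · have hl' : l = (l.re : ℂ) := Complex.ext rfl (by simp [him])
    have hre := hl.resolve_left fun h => h him
    rw [hl', curveSq, ← Complex.ofReal_inv]
    left
    have : (((l.re : ℂ) - q) * (((l.re⁻¹ : ℝ) : ℂ) - q) / 4).re =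
        (l.re - q) * (l.re⁻¹ - q) / 4 := by
      rw [show ((l.re : ℂ) - q) * (((l.re⁻¹ : ℝ) : ℂ) - q) / 4 =
        (((l.re - q) * (l.re⁻¹ - q) / 4 : ℝ) : ℂ) by push_cast; ring, Complex.ofReal_re]
    rw [this]
    rcases hre with hre | hre
    · have hre : l.re < 0 := hre
      have h2 := inv_lt_zero.2 hre
      exact div_pos (mul_pos_of_neg_of_neg (by linarith) (by linarith)) (by norm_num)
    · have h2 : q < l.re⁻¹ := (lt_inv_comm₀ (h0.trans hre.1) h0).1 hre.2
      exact div_pos (mul_pos (sub_pos.2 hre.1) (sub_pos.2 h2)) (by norm_num)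
  · by_contra hN
    rw [Complex.mem_slitPlane_iff, not_or, not_not, not_lt] at hN
    obtain ⟨hNre, hNim⟩ := hN
    have hn : 0 < Complex.normSq l := Complex.normSq_pos.2 hl0
    have hexp : curveSq q l = (1 + (q : ℂ) ^ 2 - q * (l + l⁻¹)) / 4 := by
      rw [curveSq]; field_simp; ring
    have h4 : curveSq q l = (((1 + q ^ 2 - q * (l.re + l.re / Complex.normSq l)) / 4 : ℝ) : ℂ) +
        ((-q * (l.im - l.im / Complex.normSq l) / 4 : ℝ) : ℂ) * Complex.I := by
      rw [hexp]
      have h5 := (Complex.re_add_im l).symm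
      have h6 : l⁻¹ = ((l.re / Complex.normSq l : ℝ) : ℂ) -
          ((l.im / Complex.normSq l : ℝ) : ℂ) * Complex.I := by
        apply Complex.ext <;> simp [Complex.inv_re, Complex.inv_im, neg_div]
      rw [h6]
      nth_rw 1 [h5]
      push_cast
      ring
    rw [← Complex.mk_eq_add_mul_I] at h4
    rw [h4] at hNre hNim
    simp only at hNre hNim
    have h7 : Complex.normSq l = 1 := by
      have h8 : q * l.im * (Complex.normSq l - 1) = 0 := by
        field_simp at hNim
        linarith
      have := (mul_eq_zero.1 h8).resolve_left (mul_ne_zero h0.ne' him)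
      linarith
    rw [h7] at hNre
    have h9 : l.re ^ 2 + l.im ^ 2 = 1 := by rw [← h7, Complex.normSq_apply]; ring
    have h10 : l.re ≤ 1 := by nlinarith [sq_nonneg l.im]
    nlinarith [mul_le_of_le_one_right h0.le h10, sq_pos_of_pos (sub_pos.2 h1)]

theorem principalNu_ne_zero (h0 : 0 < q) (h1 : q < 1) {l : ℂ}
    (hl : l ∈ slitSet (Iio 0 ∪ Ioo q q⁻¹)) : principalNu q l ≠ 0 := by
  intro h
  have := sq_principalNu q l
  rw [h] at this
  exact Complex.slitPlane_ne_zero (curveSq_mem_slitPlane h0 h1 hl) (by rw [← this]; norm_num)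

theorem principalNu_star (h0 : 0 < q) (h1 : q < 1) {l : ℂ}
    (hl : l ∈ slitSet (Iio 0 ∪ Ioo q q⁻¹)) : principalNu q (star l) = star (principalNu q l) := by
  have h := Complex.conj_cpow (curveSq q l) 2⁻¹
    (Complex.slitPlane_arg_ne_pi (curveSq_mem_slitPlane h0 h1 hl))
  rw [map_inv₀, map_ofNat] at h
  rw [principalNu, curveSq_star, principalNu]
  exact h

theorem hasDerivAt_principalNu (h0 : 0 < q) (h1 : q < 1) {l : ℂ}
    (hl : l ∈ slitSet (Iio 0 ∪ Ioo q q⁻¹)) :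
    HasDerivAt (principalNu q) (curveSqDeriv q l / 2 * (principalNu q l)⁻¹) l := by
  have hl0 : l ≠ 0 := ne_zero_of_mem_slitSet (by simp [h0.le]) hl
  have hs := curveSq_mem_slitPlane h0 h1 hl
  have hd : DifferentiableAt ℂ (principalNu q) l :=
    ((hasDerivAt_curveSq q hl0).differentiableAt.cpow_const hs)
  refine hd.hasDerivAt.congr_deriv ?_
  have h2 := (hd.hasDerivAt.pow 2).unique
    ((hasDerivAt_curveSq q hl0).congr_of_eventuallyEq (Eventually.of_forall (sq_principalNu q)))
  rw [← h2]
  have := principalNu_ne_zero h0 h1 hl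
  push_cast
  field_simp

theorem IsOddPrimitiveAt.hasDerivAt_principalNu_mul (h0 : 0 < q) (h1 : q < 1) {ξ T : ℂ → ℂ} {l : ℂ}
    (hl : l ∈ slitSet (Iio 0 ∪ Ioo q q⁻¹)) (h : IsOddPrimitiveAt q ξ T l) :
    HasDerivAt (fun l => principalNu q l * T l) (ξ l / (l * principalNu q l)) l := by
  have h2 := principalNu_ne_zero h0 h1 hl
  have h3 := IsOddPrimitiveAt.hasDerivAt_comp (x := fun l => l) (y := principalNu q) (u := l)
    (r := (principalNu q l)⁻¹) h
    ((hasDerivAt_id' l).congr_deriv (mul_inv_cancel₀ h2).symm)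
    (hasDerivAt_principalNu h0 h1 hl) (sq_principalNu q l)
  refine h3.congr_deriv ?_
  rw [div_eq_mul_inv, div_eq_mul_inv, mul_inv]
  ring

theorem isOddPrimitiveAt_div_principalNu (h0 : 0 < q) (h1 : q < 1) {ξ L : ℂ → ℂ} {l : ℂ}
    (hl : l ∈ slitSet (Iio 0 ∪ Ioo q q⁻¹))
    (h : HasDerivAt L (ξ l / (l * principalNu q l)) l) :
    IsOddPrimitiveAt q ξ (fun l => L l / principalNu q l) l := by
  have h2 := principalNu_ne_zero h0 h1 hl
  have hl0 : l ≠ 0 := ne_zero_of_mem_slitSet (by simp [h0.le]) hl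
  refine ⟨_, h.div (hasDerivAt_principalNu h0 h1 hl) h2, ?_⟩
  rw [← sq_principalNu]
  field_simp
  ring

/-- The equation for T has a regular singularity at the branch point q. With w² = l⁻¹ - q and T =
2J/w it becomes 2(l - q)J' + J = 4ξ/(l w), which radial averages centred at q solve without a
singularity. -/
theorem exists_isOddPrimitiveAt_left (h0 : 0 < q) (h1 : q < 1) : ∃ H : ℂ → ℂ, ∀ l ∈ slitSet (Ioo 0 q⁻¹),
    IsOddPrimitiveAt q (normalizedForm q) H l := by
  have hopen : IsOpen (slitSet (Ioo 0 q⁻¹)) := isOpen_slitSet isOpen_Ioo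
  set w : ℂ → ℂ := fun l => (l⁻¹ - q) ^ (2⁻¹ : ℂ) with hw
  have hw2 : ∀ l, w l ^ 2 = l⁻¹ - q := fun l => by
    rw [hw]; simp only; rw [← Complex.cpow_nat_mul]; norm_num
  have hne : ∀ l ∈ slitSet (Ioo 0 q⁻¹), l ≠ 0 := fun l hl => ne_zero_of_mem_slitSet (by simp) hl
  have hslit : ∀ l ∈ slitSet (Ioo 0 q⁻¹), l⁻¹ - (q : ℂ) ∈ Complex.slitPlane := by
    intro l hl
    have h2 : l⁻¹ ∈ slitSet (Ioi q) := inv_mem_slitSet (I := Ioo 0 q⁻¹)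
      (fun x hx => (lt_inv_comm₀ hx.1 h0).1 hx.2) (by simp) hl
    rcases h2 with h2 | h2
    · right; simpa using h2
    · left; simpa using h2
  have hwne : ∀ l ∈ slitSet (Ioo 0 q⁻¹), w l ≠ 0 := fun l hl h => by
    have := hw2 l
    rw [h] at this
    exact Complex.slitPlane_ne_zero (hslit l hl) (by rw [← this]; norm_num)
  have hwd : ∀ l ∈ slitSet (Ioo 0 q⁻¹), HasDerivAt w (-(l ^ 2)⁻¹ / (2 * w l)) l := by
    intro l hl
    have h2 : HasDerivAt (fun l : ℂ => l⁻¹ - (q : ℂ)) (-(l ^ 2)⁻¹) l :=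
      (hasDerivAt_inv (hne l hl)).sub_const _
    have hd : DifferentiableAt ℂ w l := h2.differentiableAt.cpow_const (hslit l hl)
    refine hd.hasDerivAt.congr_deriv ?_
    have h3 := (hd.hasDerivAt.pow 2).unique
      (h2.congr_of_eventuallyEq (Eventually.of_forall hw2))
    rw [← h3]
    have := hwne l hl
    push_cast
    field_simp
  have hg : DifferentiableOn ℂ (fun l => 4 * normalizedForm q l / (l * w l))
      (slitSet (Ioo 0 q⁻¹)) := by
    intro l hl
    have hl0 := hne l hl
    have hd := (hwd l hl).differentiableAt
    have hwl := hwne l hl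
    unfold normalizedForm
    have : l * w l ≠ 0 := mul_ne_zero hl0 hwl
    exact DifferentiableAt.differentiableWithinAt (by fun_prop (disch := assumption))
  have hq : q ∈ Ioo 0 q⁻¹ := ⟨h0, h1.trans (one_lt_inv_iff₀.2 ⟨h0, h1⟩)⟩
  obtain ⟨J, hJ⟩ := exists_radial_solution hopen (starConvex_slitSet (convex_Ioo _ _) hq) hg 2
  refine ⟨fun l => 2 * J l / w l, fun l hl => ?_⟩
  obtain ⟨d, hd, hJl⟩ := hJ l hl
  have hwl := hwne l hl
  have hl0 := hne l hl
  refine ⟨_, (hd.const_mul 2).div (hwd l hl) hwl, ?_⟩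
  have h4 : curveSq q l = (l - q) * w l ^ 2 / 4 := by rw [hw2, curveSq]
  have h5 : curveSqDeriv q l = (w l ^ 2 - (l - q) * (l ^ 2)⁻¹) / 4 := by
    rw [hw2, curveSqDeriv]; field_simp; ring
  have h6 : normalizedForm q l = (2 * (l - q) * d + J l) * (l * w l) / 4 := by
    push_cast at hJl
    rw [hJl]; field_simp
  rw [h4, h5, h6]
  field_simp
  ring

theorem lt_cycleX (h0 : 0 < q) (h1 : q < 1) {x : ℝ} (hx : Real.cos x ≠ 0) : q < cycleX q x := by
  have h := Real.sin_sq_add_cos_sq x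
  have h2 : cycleX q x = q + (1 - q ^ 2) * Real.cos x ^ 2 / q := by
    rw [cycleX, sq_cycleDelta h0.ne', Real.sin_sq]; field_simp; ring
  have h3 : 0 < 1 - q ^ 2 := by nlinarith
  rw [h2]
  have : 0 < (1 - q ^ 2) * Real.cos x ^ 2 / q := by positivity
  linarith

theorem cycleX_lt (h0 : 0 < q) (h1 : q < 1) {x : ℝ} (hx : Real.sin x ≠ 0) : cycleX q x < q⁻¹ := by
  have h3 : 0 < 1 - q ^ 2 := by nlinarith
  rw [cycleX, sq_cycleDelta h0.ne', ← one_div]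
  have : 0 < (1 - q ^ 2) * Real.sin x ^ 2 := by positivity
  gcongr
  linarith

/-- The integral of the normalised differential along the real cycle. -/
noncomputable def cycleIntegral (q x : ℝ) : ℝ :=
  ∫ y in (0 : ℝ)..x, -4 / cycleDelta q y *
    (q * ellipticK' q * (cycleX q y + (cycleX q y)⁻¹) + -2 * ellipticE' q)

theorem hasDerivAt_cycleIntegral (h0 : 0 < q) (x : ℝ) : HasDerivAt (cycleIntegral q)
    (-4 / cycleDelta q x * (q * ellipticK' q * (cycleX q x + (cycleX q x)⁻¹) + -2 * ellipticE' q))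
      x := by
  have hfc : Continuous fun x => -4 / cycleDelta q x *
      (q * ellipticK' q * (cycleX q x + (cycleX q x)⁻¹) + -2 * ellipticE' q) := by
    have h2 := continuous_cycleDelta q
    have h3 : ∀ x, cycleDelta q x ≠ 0 := fun x => (cycleDelta_pos h0.ne' x).ne'
    have h4 : Continuous (cycleX q) := by unfold cycleX; fun_prop
    have h5 : ∀ x, cycleX q x ≠ 0 := fun x => (cycleX_pos h0 x).ne'
    exact (continuous_const.div h2 h3).mul ((continuous_const.mul (h4.add (h4.inv₀ h5))).add
      continuous_const)
  exact intervalIntegral.integral_hasDerivAt_right (hfc.intervalIntegrable _ _)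
      (hfc.stronglyMeasurableAtFilter _ _) hfc.continuousAt

theorem cycleIntegral_zero : cycleIntegral q 0 = 0 := intervalIntegral.integral_same

theorem cycleIntegral_pi_div_two (h0 : 0 < q) : cycleIntegral q (π / 2) = 0 := by
  rw [cycleIntegral, integral_cycle h0]
  field_simp
  ring

/-- Both sides have the same derivative along the cycle and vanish at the branch point c; thus νT is
the integral of the normalised differential, whichever of the two branch points it starts from. -/
theorem cycleY_mul_eq (h0 : 0 < q) {T : ℂ → ℂ} {a b : ℝ}
    (hT : ∀ x ∈ Ioo a b, IsOddPrimitiveAt q (normalizedForm q) T (cycleX q x)) {c x : ℝ}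
    (hc : c ∈ Ioo a b) (hx : x ∈ Ioo a b) (hYc : cycleY q c = 0) (hIc : cycleIntegral q c = 0) :
    (cycleY q x : ℂ) * T (cycleX q x) = (cycleIntegral q x : ℂ) := by
  have hd : ∀ x ∈ Ioo a b, HasDerivAt
      (fun x => (cycleY q x : ℂ) * T (cycleX q x) - (cycleIntegral q x : ℂ)) 0 x := by
    intro x hx
    have h2 := IsOddPrimitiveAt.hasDerivAt_comp (x := fun x : ℝ => ((cycleX q x : ℝ) : ℂ))
      (y := fun x : ℝ => ((cycleY q x : ℝ) : ℂ)) (hT x hx) (hasDerivAt_cycleX' h0 x) (hasDerivAt_cycleY' h0 x)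
      (mem_spectralCurve_iff.1 (cyclePoint_mem h0 x)).2
    rw [cycle_velocity h0] at h2
    refine (h2.sub (hasDerivAt_cycleIntegral h0 x).ofReal_comp).congr_deriv ?_
    rw [normalizedForm]
    push_cast
    ring
  have := isOpen_Ioo.is_const_of_deriv_eq_zero isPreconnected_Ioo
    (fun x hx => (hd x hx).differentiableAt.differentiableWithinAt) (fun x hx => (hd x hx).deriv)
    hx hc
  simp only [hYc, hIc, Complex.ofReal_zero, zero_mul, sub_zero] at this
  exact sub_eq_zero.1 this

/-- The normalised differential has an odd primitive over the plane without the negative axis. -/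
theorem exists_isOddPrimitiveAt (h0 : 0 < q) (h1 : q < 1) : ∃ H : ℂ → ℂ,
    (∀ l ∈ slitSet (Ioi 0), IsOddPrimitiveAt q (normalizedForm q) H l) ∧
    (∀ l ∈ slitSet (Ioi 0), H l⁻¹ = -H l) ∧ ∀ l, H (star l) = star (H l) := by
  have hq1 : (1 : ℝ) < q⁻¹ := one_lt_inv_iff₀.2 ⟨h0, h1⟩
  obtain ⟨H₁, hH₁⟩ := exists_isOddPrimitiveAt_left h0 h1
  -- symmetrisation
  obtain ⟨H₀, hH₀, hstar⟩ : ∃ H₀ : ℂ → ℂ, (∀ l ∈ slitSet (Ioo 0 q⁻¹),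
      IsOddPrimitiveAt q (normalizedForm q) H₀ l) ∧ ∀ l, H₀ (star l) = star (H₀ l) := by
    refine ⟨fun l => 2⁻¹ * (H₁ l + star (H₁ (star l))), fun l hl => ?_, fun l => ?_⟩
    · have h2 := ((hH₁ l hl).add (hH₁ _ (star_mem_slitSet hl)).star).const_mul 2⁻¹
      have h3 : (fun l => 2⁻¹ * (normalizedForm q l + star (normalizedForm q (star l)))) =
          normalizedForm q := by
        funext l; rw [normalizedForm_star, star_star]; ring
      rwa [h3] at h2
    · simp [add_comm]
  have hleft : ∀ l ∈ slitSet (Ioi q), l⁻¹ ∈ slitSet (Ioo 0 q⁻¹) := fun l hl =>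
    inv_mem_slitSet (I := Ioi q) (I' := Ioo 0 q⁻¹) (fun x hx =>
      ⟨inv_pos.2 (h0.trans hx), (inv_lt_inv₀ (h0.trans hx) h0).2 hx⟩) (by simp [h0.le]) hl
  have hright : ∀ l ∈ slitSet (Ioo 0 q⁻¹), l⁻¹ ∈ slitSet (Ioi q) := fun l hl =>
    inv_mem_slitSet (I := Ioo 0 q⁻¹) (fun x hx => (lt_inv_comm₀ hx.1 h0).1 hx.2) (by simp) hl
  have hinv : ∀ l ∈ slitSet (Ioi q), IsOddPrimitiveAt q (normalizedForm q) (fun l => -H₀ l⁻¹) l := by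
    intro l hl
    have hl0 := ne_zero_of_mem_slitSet (by simp [h0.le]) hl
    have h2 := (hH₀ l⁻¹ (hleft l hl)).inv hl0
    simpa only [normalizedForm_inv] using h2
  -- H₀ is the solution regular at q, and l ↦ -H₀(l⁻¹) the one regular at q⁻¹. Over l = 1 they agree
  -- because the period between the two branch points vanishes; the same principle then identifies
  -- them on the whole overlap.
  have hone : H₀ 1 = -H₀ 1 := by
    have hcont : ContinuousOn (cycleX q) (Icc 0 (π / 2)) := by
      have := continuous_cycleDelta q
      unfold cycleX; fun_prop
    have hX0 : cycleX q 0 = q⁻¹ := by rw [cycleX, sq_cycleDelta h0.ne']; simp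
    have hX1 : cycleX q (π / 2) = q := by
      rw [cycleX, sq_cycleDelta h0.ne', Real.sin_pi_div_two]; field_simp; ring
    obtain ⟨x, hx, hXx⟩ : (1 : ℝ) ∈ cycleX q '' Ioo 0 (π / 2) := by
      refine intermediate_value_Ioo' (by positivity) hcont ?_
      rw [hX0, hX1]
      exact ⟨h1, hq1⟩
    have hpi := Real.pi_pos
    have hs : 0 < Real.sin x := Real.sin_pos_of_pos_of_lt_pi hx.1 (by linarith [hx.2])
    have hc : 0 < Real.cos x := Real.cos_pos_of_mem_Ioo ⟨by linarith [hx.1], hx.2⟩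
    have hY : cycleY q x ≠ 0 := by
      have := cycleDelta_pos h0.ne' x
      have : 0 < 1 - q ^ 2 := by nlinarith
      unfold cycleY
      positivity
    have h2 := cycleY_mul_eq h0 (T := H₀) (a := 0) (b := π) (c := π / 2) (x := x) (fun y hy =>
      hH₀ _ (ofReal_mem_slitSet ⟨cycleX_pos h0 y,
        cycleX_lt h0 h1 (Real.sin_pos_of_pos_of_lt_pi hy.1 hy.2).ne'⟩))
      ⟨by linarith, by linarith⟩ ⟨hx.1, by linarith [hx.2]⟩ (by simp [cycleY])
      (cycleIntegral_pi_div_two h0)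
    have h3 := cycleY_mul_eq h0 (T := fun l => -H₀ l⁻¹) (a := -(π / 2)) (b := π / 2) (c := 0)
      (x := x) (fun y hy => hinv _ (ofReal_mem_slitSet (lt_cycleX h0 h1
        (Real.cos_pos_of_mem_Ioo hy).ne')))
      ⟨by linarith, by linarith⟩ ⟨by linarith [hx.1], hx.2⟩ (by simp [cycleY]) cycleIntegral_zero
    rw [← h3, hXx] at h2
    simpa using mul_left_cancel₀ (by exact_mod_cast hY) h2
  have heq : ∀ l ∈ slitSet (Ioo q q⁻¹), H₀ l = -H₀ l⁻¹ := by
    intro l hl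
    have hmem : (1 : ℝ) ∈ Ioo q q⁻¹ := ⟨h1, hq1⟩
    have hsub : slitSet (Ioo q q⁻¹) ⊆ slitSet (Iio 0 ∪ Ioo q q⁻¹) := slitSet_mono subset_union_right
    have h2 := eqOn_of_hasDerivAt_starConvex (isOpen_slitSet isOpen_Ioo)
      (ofReal_mem_slitSet hmem) (starConvex_slitSet (convex_Ioo _ _) hmem)
      (fun l hl => (hH₀ l (slitSet_mono (Ioo_subset_Ioo_left h0.le) hl)).hasDerivAt_principalNu_mul h0 h1 (hsub hl))
      (fun l hl => (hinv l (slitSet_mono Ioo_subset_Ioi_self hl)).hasDerivAt_principalNu_mul h0 h1 (hsub hl)) (by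
        rw [Complex.ofReal_one, inv_one, ← hone]) hl
    exact mul_left_cancel₀ (principalNu_ne_zero h0 h1 (hsub hl)) h2
  classical
  have hcover : ∀ l ∈ slitSet (Ioi 0), l ∉ slitSet (Ioo 0 q⁻¹) → l ∈ slitSet (Ioi q) := by
    intro l hl hl'
    rcases hl with hl | hl
    · exact absurd (Or.inl hl) hl'
    · right
      have hn : q⁻¹ ≤ l.re := not_lt.1 fun h => hl' (Or.inr ⟨hl, h⟩)
      exact (h1.trans hq1).trans_le hn
  -- The gluing extends the solution regular at q across the other branch point q⁻¹.
  set H : ℂ → ℂ := fun l => if l ∈ slitSet (Ioo 0 q⁻¹) then H₀ l else -H₀ l⁻¹ with hH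
  have hHl : ∀ l ∈ slitSet (Ioo 0 q⁻¹), H l = H₀ l := fun l hl => if_pos hl
  have hHr : ∀ l ∈ slitSet (Ioi q), H l = -H₀ l⁻¹ := by
    intro l hl
    by_cases hl' : l ∈ slitSet (Ioo 0 q⁻¹)
    · rw [hHl l hl']
      refine heq l ?_
      rcases hl with hl | hl
      · exact Or.inl hl
      · rcases hl' with hl' | hl'
        · exact Or.inl hl'
        · exact Or.inr ⟨hl, hl'.2⟩
    · exact if_neg hl'
  refine ⟨H, fun l hl => ?_, fun l hl => ?_, fun l => ?_⟩
  · by_cases hl' : l ∈ slitSet (Ioo 0 q⁻¹)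
    · refine (hH₀ l hl').congr_of_eventuallyEq ?_
      filter_upwards [(isOpen_slitSet isOpen_Ioo).mem_nhds hl'] with l hl using hHl l hl
    · have hl'' := hcover l hl hl'
      refine (hinv l hl'').congr_of_eventuallyEq ?_
      filter_upwards [(isOpen_slitSet isOpen_Ioi).mem_nhds hl''] with l hl using hHr l hl
  · by_cases hl' : l ∈ slitSet (Ioo 0 q⁻¹)
    · rw [hHl l hl', hHr _ (hright l hl'), inv_inv]
    · have hl'' := hcover l hl hl'
      rw [hHr l hl'', hHl _ (hleft l hl''), neg_neg]
  · by_cases hl' : l ∈ slitSet (Ioo 0 q⁻¹)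
    · rw [hHl l hl', hHl _ (star_mem_slitSet hl'), hstar]
    · have h2 : star l ∉ slitSet (Ioo 0 q⁻¹) := fun h => hl' (by simpa using star_mem_slitSet h)
      rw [hH]
      simp only
      rw [if_neg hl', if_neg h2, star_neg, ← hstar, star_inv₀]

end

/-! ### Functions with prescribed logarithmic differential -/

section

variable {q : ℝ}

theorem slitSet_Iio_subset : slitSet (Iio 0) ⊆ slitSet (Iio 0 ∪ Ioo q q⁻¹) :=
  slitSet_mono subset_union_left

theorem inv_mem_slitSet_Ioi {l : ℂ} (hl : l ∈ slitSet (Ioi 0)) : l⁻¹ ∈ slitSet (Ioi 0) :=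
  inv_mem_slitSet (I := Ioi 0) (I' := Ioi 0) (fun _ hx => mem_Ioi.2 (inv_pos.2 hx)) (by simp) hl

theorem inv_mem_slitSet_Iio {l : ℂ} (hl : l ∈ slitSet (Iio 0)) : l⁻¹ ∈ slitSet (Iio 0) :=
  inv_mem_slitSet (I := Iio 0) (I' := Iio 0) (fun _ hx => mem_Iio.2 (inv_lt_zero.2 hx)) (by simp) hl

/-- Without the positive axis there is no branch point, so a single-valued branch of ν exists and
the differential can be integrated directly. The base point -1 is fixed by inversion and
conjugation, which yields both symmetries by uniqueness. -/
theorem exists_primitive_negative (h0 : 0 < q) (h1 : q < 1) : ∃ L : ℂ → ℂ,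
    (∀ l ∈ slitSet (Iio 0), HasDerivAt L (normalizedForm q l / (l * principalNu q l)) l) ∧
    L (-1) = 0 ∧ (∀ l ∈ slitSet (Iio 0), L l⁻¹ = -L l) ∧
    ∀ l ∈ slitSet (Iio 0), L (star l) = star (L l) := by
  have hopen : IsOpen (slitSet (Iio 0)) := isOpen_slitSet isOpen_Iio
  have hm1 : (-1 : ℝ) ∈ Iio (0 : ℝ) := by norm_num
  have hstarc := starConvex_slitSet (convex_Iio (0 : ℝ)) hm1
  have hmem := ofReal_mem_slitSet hm1
  have hne : ∀ l ∈ slitSet (Iio 0), l ≠ 0 := fun l hl => ne_zero_of_mem_slitSet (by simp) hl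
  have hg : DifferentiableOn ℂ (fun l => normalizedForm q l / (l * principalNu q l))
      (slitSet (Iio 0)) := by
    intro l hl
    have hl0 := hne l hl
    have hd := (hasDerivAt_principalNu h0 h1 (slitSet_Iio_subset hl)).differentiableAt
    have : l * principalNu q l ≠ 0 :=
      mul_ne_zero hl0 (principalNu_ne_zero h0 h1 (slitSet_Iio_subset hl))
    unfold normalizedForm
    exact DifferentiableAt.differentiableWithinAt (by fun_prop (disch := assumption))
  obtain ⟨L, hL0, hL⟩ := exists_primitive_of_starConvex hopen hstarc hg
  refine ⟨L, hL, by simpa using hL0, ?_, ?_⟩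
  · have h2 : EqOn (fun l => -L l⁻¹) L (slitSet (Iio 0)) := by
      refine eqOn_of_hasDerivAt_starConvex hopen hmem hstarc (fun l hl => ?_) hL ?_
      · have hl0 := hne l hl
        have h3 := ((hL l⁻¹ (inv_mem_slitSet_Iio hl)).comp l
          (hasDerivAt_inv hl0)).neg
        refine h3.congr_deriv ?_
        rw [normalizedForm_inv, principalNu_inv]
        field_simp
      · have h4 : (((-1 : ℝ) : ℂ))⁻¹ = ((-1 : ℝ) : ℂ) := by norm_num
        rw [h4, hL0, neg_zero]
    intro l hl
    rw [← h2 hl, neg_neg]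
  · have h2 : EqOn (fun l => star (L (star l))) L (slitSet (Iio 0)) := by
      refine eqOn_of_hasDerivAt_starConvex hopen hmem hstarc (fun l hl => ?_) hL ?_
      · have h3 := hL (star l) (star_mem_slitSet hl)
        rw [normalizedForm_star, principalNu_star h0 h1 (slitSet_Iio_subset hl), ← star_mul',
          ← star_div₀] at h3
        exact hasDerivAt_conj_conj_iff.2 h3
      · have h4 : star ((-1 : ℝ) : ℂ) = ((-1 : ℝ) : ℂ) := Complex.conj_ofReal _
        rw [h4, hL0, star_zero]
    intro l hl
    have := h2 hl
    simp only at this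
    rw [← this, star_star]

theorem exp_mul_I_mem_slitSet {I : Set ℝ} {φ : ℝ} (h : Real.sin φ ≠ 0 ∨ Real.cos φ ∈ I) :
    Complex.exp (φ * Complex.I) ∈ slitSet I := by
  refine h.imp (fun h => ?_) fun h => ?_
  · rwa [Complex.exp_ofReal_mul_I_im]
  · rwa [Complex.exp_ofReal_mul_I_re]

theorem exp_mul_I_mem_slitSet_Ioi {φ : ℝ} (hφ : φ ∈ Ioo (-π) π) :
    Complex.exp (φ * Complex.I) ∈ slitSet (Ioi 0) := by
  refine exp_mul_I_mem_slitSet ?_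
  by_cases h : Real.sin φ = 0
  · right
    rw [(Real.sin_eq_zero_iff_of_lt_of_lt hφ.1 hφ.2).1 h]
    simp
  · exact Or.inl h

/-- On the circle dl/(lν) = (2i/R) dφ and the normalised form equals 2(q K' cos φ - E'); hence the
factor 4i. -/
theorem circleRadius_mul_eq (hq : |q| < 1) {H : ℂ → ℂ}
    (hH : ∀ l ∈ slitSet (Ioi 0), IsOddPrimitiveAt q (normalizedForm q) H l) (hH1 : H 1 = 0)
    {φ : ℝ} (hφ : φ ∈ Ioo (-π) π) :
    ((circleRadius q φ / 2 : ℝ) : ℂ) * H (Complex.exp (φ * Complex.I)) =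
      4 * circlePhase q φ * Complex.I := by
  have hpi := Real.pi_pos
  have hd : ∀ φ ∈ Ioo (-π) π, HasDerivAt (fun φ : ℝ => ((circleRadius q φ / 2 : ℝ) : ℂ) *
      H (Complex.exp (φ * Complex.I)) - 4 * circlePhase q φ * Complex.I) 0 φ := by
    intro φ hφ
    have hR : (circleRadius q φ : ℂ) ≠ 0 := by exact_mod_cast (circleRadius_pos hq φ).ne'
    have he := Complex.exp_ne_zero (φ * Complex.I)
    have h2 := IsOddPrimitiveAt.hasDerivAt_comp (x := fun φ : ℝ => Complex.exp (φ * Complex.I))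
      (y := fun φ : ℝ => ((circleRadius q φ / 2 : ℝ) : ℂ))
      (hH _ (exp_mul_I_mem_slitSet_Ioi hφ)) (hasDerivAt_exp_circle hq φ)
      (hasDerivAt_circleRadius_div_two hq φ) (mem_spectralCurve_iff.1 (circlePoint_mem hq φ)).2
    refine (h2.sub (((hasDerivAt_circlePhase_right hq φ).ofReal_comp.const_mul
      (4 : ℂ)).mul_const Complex.I)).congr_deriv ?_
    have h3 := torusForm_exp q 0 4 φ
    have h4 : torusForm q 0 4 (Complex.exp (φ * Complex.I)) =
        normalizedForm q (Complex.exp (φ * Complex.I)) := by simp [torusForm]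
    rw [h4] at h3
    rw [h3]
    push_cast
    field_simp
    ring
  have h0 : (0 : ℝ) ∈ Ioo (-π) π := ⟨by linarith, hpi⟩
  have := isOpen_Ioo.is_const_of_deriv_eq_zero isPreconnected_Ioo
    (fun x hx => (hd x hx).differentiableAt.differentiableWithinAt) (fun x hx => (hd x hx).deriv)
    hφ h0
  have hP : circlePhase q 0 = 0 := intervalIntegral.integral_same
  simp only [hP, Complex.ofReal_zero, zero_mul, Complex.exp_zero, hH1, mul_zero, sub_zero] at this
  exact sub_eq_zero.1 this

/-- Comparison of the primitives over the plane without the positive or the negative axis. -/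
theorem principalNu_mul_sub_eq (h0 : 0 < q) (h1 : q < 1) {H L : ℂ → ℂ}
    (hH : ∀ l ∈ slitSet (Ioi 0), IsOddPrimitiveAt q (normalizedForm q) H l) (hH1 : H 1 = 0)
    (hL : ∀ l ∈ slitSet (Iio 0), HasDerivAt L (normalizedForm q l / (l * principalNu q l)) l)
    (hL1 : L (-1) = 0) {l : ℂ} (hl : 0 < l.im) :
    principalNu q l * H l = L l + 4 * circlePhase q π * Complex.I := by
  have hq : |q| < 1 := by rwa [abs_of_pos h0]
  have hpi := Real.pi_pos
  set C : ℂ := principalNu q Complex.I * H Complex.I - L Complex.I with hC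
  have hmemI : Complex.I ∈ {z : ℂ | 0 < z.im} := by simp
  have heq : EqOn (fun l => principalNu q l * H l) (fun l => L l + C) {z : ℂ | 0 < z.im} := by
    refine eqOn_of_hasDerivAt_starConvex (isOpen_lt continuous_const Complex.continuous_im) hmemI
      ((convex_halfSpace_im_gt 0).starConvex hmemI)
      (fun z hz => (hH z (Or.inl (ne_of_gt hz))).hasDerivAt_principalNu_mul h0 h1
        (Or.inl (ne_of_gt hz)))
      (fun z hz => (hL z (Or.inl (ne_of_gt hz))).add_const C) ?_
    simp only [hC]
    ring
  -- The constant is read off in the limit along the circle from the upper half plane to -1, where L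
  -- vanishes.
  have hval : C = 4 * circlePhase q π * Complex.I := by
    have hc1 : Tendsto (fun φ : ℝ => 4 * (circlePhase q φ : ℂ) * Complex.I) (𝓝[<] π)
        (𝓝 (4 * (circlePhase q π : ℂ) * Complex.I)) := by
      have h2 : ContinuousAt (fun φ : ℝ => 4 * (circlePhase q φ : ℂ) * Complex.I) π := by
        have := (hasDerivAt_circlePhase_right hq π).continuousAt
        fun_prop
      exact h2.tendsto.mono_left nhdsWithin_le_nhds
    have hc2 : Tendsto (fun φ : ℝ => L (Complex.exp (φ * Complex.I)) + C) (𝓝[<] π) (𝓝 C) := by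
      have hexp : Complex.exp (π * Complex.I) = -1 := Complex.exp_pi_mul_I
      have h2 : ContinuousAt (fun φ : ℝ => L (Complex.exp (φ * Complex.I)) + C) π := by
        have h3 : ContinuousAt L (Complex.exp (π * Complex.I)) := by
          rw [hexp]
          exact (hL (-1) (Or.inr (by simp))).continuousAt
        have h4 : ContinuousAt (fun φ : ℝ => Complex.exp (φ * Complex.I)) π := by fun_prop
        exact (ContinuousAt.comp (f := fun φ : ℝ => Complex.exp (φ * Complex.I)) h3 h4).add_const C
      have h5 := h2.tendsto
      rw [hexp, hL1, zero_add] at h5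
      exact h5.mono_left nhdsWithin_le_nhds
    refine tendsto_nhds_unique hc2 (hc1.congr' ?_)
    filter_upwards [Ioo_mem_nhdsLT hpi] with φ hφ
    have him : 0 < (Complex.exp (φ * Complex.I)).im := by
      rw [Complex.exp_ofReal_mul_I_im]
      exact Real.sin_pos_of_pos_of_lt_pi hφ.1 hφ.2
    have h2 := heq him
    simp only at h2
    rw [← h2, principalNu_exp hq, circleRadius_mul_eq hq hH hH1 ⟨by linarith [hφ.1], hφ.2⟩]
  rw [← hval]
  exact heq hl

/-- Existence of eigenvalue functions with prescribed logarithmic differential. -/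
theorem exists_isLogPrimitive_torusForm (h0 : 0 < q) (h1 : q < 1) (s n : ℝ)
    (hn : Complex.exp ((2 * (n * circlePhase q π) : ℝ) * Complex.I) = 1) :
    ∃ μ : ℂ × ℂ → ℂ, IsLogPrimitive q (torusForm q s n) μ ∧
      (∀ p, μ p ≠ 0) ∧ (∀ p, μ (sigmaInv p) = (μ p)⁻¹) ∧
      (∀ p ∈ spectralCurve q, μ (etaInv p) = star (μ p)) ∧
      μ (circlePoint q 0) = Complex.exp (s * (circleRadius q 0 / 2 : ℝ) * Complex.I) := by
  have hq : |q| < 1 := by rwa [abs_of_pos h0]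
  obtain ⟨H, hH, hHinv, hHstar⟩ := exists_isOddPrimitiveAt h0 h1
  obtain ⟨L, hL, hL1, hLinv, hLstar⟩ := exists_primitive_negative h0 h1
  have hone : (1 : ℂ) ∈ slitSet (Ioi 0) := Or.inr (by simp)
  have hH1 : H 1 = 0 := by
    have := hHinv 1 hone
    rw [inv_one] at this
    exact self_eq_neg.1 this
  have hform : ∀ (T : ℂ → ℂ) (l : ℂ), l ≠ 0 → IsOddPrimitiveAt q (normalizedForm q) T l →
      IsOddPrimitiveAt q (torusForm q s n) (fun l => s * Complex.I + n / 4 * T l) l := by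
    intro T l hl h
    have h2 := (isOddPrimitiveAt_const q (s * Complex.I) hl).add (h.const_mul (n / 4 : ℂ))
    convert h2 using 2 with l
    rw [torusForm]
    ring
  -- ε is the jump of μ between the two slit planes. Integrality of the period makes it ±1, so it
  -- does not matter from which side of the axis or on which sheet it is computed.
  set ε : ℂ := Complex.exp ((n * circlePhase q π : ℝ) * Complex.I) with hε
  have hε2 : ε * ε = 1 := by
    rw [hε, ← Complex.exp_add, ← hn]
    push_cast
    ring_nf
  have hε1 : ε = 1 ∨ ε = -1 := mul_self_eq_one_iff.1 hε2
  have hεinv : ε⁻¹ = ε := by rcases hε1 with h | h <;> rw [h] <;> norm_num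
  have hεstar : star ε = ε := by rcases hε1 with h | h <;> rw [h] <;> simp
  have hε0 : ε ≠ 0 := Complex.exp_ne_zero _
  set T : ℂ → ℂ := fun l => s * Complex.I + n / 4 * H l with hT
  set T' : ℂ → ℂ := fun l => s * Complex.I + n / 4 * (L l / principalNu q l) with hT'
  classical
  set μ : ℂ × ℂ → ℂ := fun p =>
    if p.1 ∈ slitSet (Ioi 0) then Complex.exp (p.2 * T p.1) else ε * Complex.exp (p.2 * T' p.1)
    with hμ
  have hμ1 : ∀ p : ℂ × ℂ, p.1 ∈ slitSet (Ioi 0) → μ p = Complex.exp (p.2 * T p.1) :=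
    fun p hp => if_pos hp
  have hμ2 : ∀ p : ℂ × ℂ, p.1 ∉ slitSet (Ioi 0) → μ p = ε * Complex.exp (p.2 * T' p.1) :=
    fun p hp => if_neg hp
  have hcover : ∀ l : ℂ, l ≠ 0 → l ∉ slitSet (Ioi 0) → l.im = 0 ∧ l.re < 0 := by
    intro l hl0 hl
    have h2 : l.im = 0 := not_not.1 fun h => hl (Or.inl h)
    refine ⟨h2, lt_of_le_of_ne (not_lt.1 fun h => hl (Or.inr h)) fun h => hl0 (Complex.ext h h2)⟩
  have hnu0 : ∀ l ∈ slitSet (Iio 0), principalNu q l ≠ 0 := fun l hl =>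
    principalNu_ne_zero h0 h1 (slitSet_Iio_subset hl)
  -- comparison of both formulas
  have hagree : ∀ p ∈ spectralCurve q, p.1 ∈ slitSet (Iio 0) →
      μ p = ε * Complex.exp (p.2 * T' p.1) := by
    intro p hp hpn
    by_cases hps : p.1 ∈ slitSet (Ioi 0)
    · have him : p.1.im ≠ 0 := by
        rcases hps with h | h
        · exact h
        · rcases hpn with h' | h'
          · exact h'
          · exact absurd (lt_trans (mem_Ioi.1 h) (mem_Iio.1 h')) (lt_irrefl _)
      have hν := hnu0 _ hpn
      -- The primitives differ by a constant on each half plane; conjugation shows that the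
      -- constants have opposite signs.
      have hdiff : ∃ δ : ℂ, (δ = 1 ∨ δ = -1) ∧ principalNu q p.1 * H p.1 =
          L p.1 + δ * (4 * circlePhase q π * Complex.I) := by
        rcases lt_or_gt_of_ne him with h | h
        · refine ⟨-1, Or.inr rfl, ?_⟩
          have h2 := congrArg star (principalNu_mul_sub_eq h0 h1 hH hH1 hL hL1 (l := star p.1)
            (by simpa using h))
          rw [principalNu_star h0 h1 (slitSet_Iio_subset hpn), hHstar, hLstar _ hpn] at h2
          simp only [star_mul', star_add, Complex.star_def, Complex.conj_I,
            Complex.conj_ofReal, map_ofNat] at h2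
          simp only [Complex.conj_conj] at h2
          rw [h2]
          ring
        · exact ⟨1, Or.inl rfl, by
            rw [one_mul]; exact principalNu_mul_sub_eq h0 h1 hH hH1 hL hL1 h⟩
      obtain ⟨δ, hδ, hdiff⟩ := hdiff
      have hsgn : ∃ τ : ℂ, (τ = 1 ∨ τ = -1) ∧ p.2 = τ * principalNu q p.1 := by
        have h2 := (mem_spectralCurve_iff.1 hp).2
        rw [← sq_principalNu] at h2
        rcases sq_eq_sq_iff_eq_or_eq_neg.1 h2 with h | h
        · exact ⟨1, Or.inl rfl, by rw [h, one_mul]⟩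
        · exact ⟨-1, Or.inr rfl, by rw [h, neg_one_mul]⟩
      obtain ⟨τ, hτ, hp2⟩ := hsgn
      have hHp : H p.1 = L p.1 / principalNu q p.1 +
          δ * (4 * circlePhase q π * Complex.I) / principalNu q p.1 := by
        rw [← add_div, ← hdiff, mul_div_cancel_left₀ _ hν]
      have hexp : p.2 * T p.1 = τ * δ * ((n * circlePhase q π : ℝ) * Complex.I) + p.2 * T' p.1 := by
        rw [hT, hT']
        simp only
        rw [hHp, hp2]
        push_cast
        field_simp
        ring
      rw [hμ1 p hps, hexp, Complex.exp_add]
      -- The sign τδ combines sheet and half plane; it may invert ε, but ε⁻¹ = ε.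
      congr 1
      have hτδ : τ * δ = 1 ∨ τ * δ = -1 := by
        rcases hτ with h | h <;> rcases hδ with h' | h' <;> simp [h, h']
      rcases hτδ with h | h
      · rw [h, one_mul]
      · rw [h, neg_one_mul, Complex.exp_neg, ← hε, hεinv]
    · exact hμ2 p hps
  refine ⟨μ, isLogPrimitive_of_isOddPrimitiveAt fun p hp => ?_, fun p => ?_, fun p => ?_,
    fun p hp => ?_, ?_⟩
  · by_cases hps : p.1 ∈ slitSet (Ioi 0)
    · have hnhds := (isOpen_slitSet isOpen_Ioi).mem_nhds hps
      refine ⟨T, 1, ?_, ?_⟩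
      · filter_upwards [hnhds] with l hl
        exact hform H l (ne_zero_of_mem_slitSet (by simp) hl) (hH l hl)
      · filter_upwards [nhdsWithin_le_nhds (continuous_fst.continuousAt.preimage_mem_nhds hnhds)]
          with z hz
        rw [one_mul, hμ1 z hz]
    · obtain ⟨him, hre⟩ := hcover _ (mem_spectralCurve_iff.1 hp).1 hps
      have hnhds := (isOpen_slitSet isOpen_Iio).mem_nhds
        (show p.1 ∈ slitSet (Iio 0) from Or.inr hre)
      refine ⟨T', ε, ?_, ?_⟩
      · filter_upwards [hnhds] with l hl
        exact hform _ l (ne_zero_of_mem_slitSet (by simp) hl)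
          (isOddPrimitiveAt_div_principalNu h0 h1 (slitSet_Iio_subset hl) (hL l hl))
      · filter_upwards [nhdsWithin_le_nhds (continuous_fst.continuousAt.preimage_mem_nhds hnhds),
          self_mem_nhdsWithin] with z hz hzc
        exact hagree z hzc hz
  · by_cases hps : p.1 ∈ slitSet (Ioi 0)
    · rw [hμ1 p hps]; exact Complex.exp_ne_zero _
    · rw [hμ2 p hps]; exact mul_ne_zero hε0 (Complex.exp_ne_zero _)
  · by_cases hps : p.1 ∈ slitSet (Ioi 0)
    · rw [hμ1 p hps, hμ1 (sigmaInv p) hps]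
      simp only [sigmaInv]
      rw [neg_mul, Complex.exp_neg]
    · rw [hμ2 p hps, hμ2 (sigmaInv p) hps]
      simp only [sigmaInv]
      rw [neg_mul, Complex.exp_neg, mul_inv, hεinv]
  · by_cases hps : p.1 ∈ slitSet (Ioi 0)
    · have h3 : (star p.1)⁻¹ ∈ slitSet (Ioi 0) :=
        inv_mem_slitSet_Ioi (star_mem_slitSet hps)
      rw [hμ1 p hps, hμ1 (etaInv p) h3, Complex.star_def, ← Complex.exp_conj]
      congr 1
      simp only [etaInv, hT]
      rw [hHinv _ (star_mem_slitSet hps), hHstar]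
      simp
      rw [map_ofNat]
      ring
    · obtain ⟨him, hre⟩ := hcover _ (mem_spectralCurve_iff.1 hp).1 hps
      have hpn : p.1 ∈ slitSet (Iio 0) := Or.inr hre
      have h3 : (star p.1)⁻¹ ∈ slitSet (Iio 0) :=
        inv_mem_slitSet_Iio (star_mem_slitSet hpn)
      have h4 : (star p.1)⁻¹ ∉ slitSet (Ioi 0) := fun h => hps (by
        have := star_mem_slitSet (inv_mem_slitSet_Ioi h)
        simpa using this)
      rw [hμ2 p hps, hμ2 (etaInv p) h4, star_mul', hεstar, Complex.star_def, ← Complex.exp_conj]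
      congr 2
      simp only [etaInv, hT']
      rw [hLinv _ (star_mem_slitSet hpn), hLstar _ hpn, principalNu_inv,
        principalNu_star h0 h1 (slitSet_Iio_subset hpn)]
      simp
      rw [map_ofNat]
      ring
  · have h2 : (circlePoint q 0).1 = 1 := by simp [circlePoint]
    rw [hμ1 _ (by rw [h2]; exact hone), hT]
    simp only [h2, hH1]
    congr 1
    simp only [circlePoint]
    ring

end

/-! ### Spectral data with prescribed differentials -/

theorem IsLogPrimitive.const_mul {q : ℝ} {ξ : ℂ → ℂ} {μ : ℂ × ℂ → ℂ} (h : IsLogPrimitive q ξ μ)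
    (κ : ℂ) : IsLogPrimitive q ξ (fun p => κ * μ p) := by
  intro p hp
  obtain ⟨F, hF, hμ, hD⟩ := h p hp
  refine ⟨fun z => κ * F z, analyticAt_const.mul hF, ?_, ?_⟩
  · filter_upwards [hμ] with z hz
    rw [hz]
  · have h1 : fderiv ℂ (fun z => κ * F z) p = _ :=
      (hF.differentiableAt.hasFDerivAt.const_mul κ).fderiv
    rw [h1, smul_apply, hD, smul_eq_mul]
    ring

theorem etaInv_mem {q : ℝ} {p : ℂ × ℂ} (hp : p ∈ spectralCurve q) : etaInv p ∈ spectralCurve q := by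
  rw [mem_spectralCurve_iff] at hp ⊢
  refine ⟨inv_ne_zero (star_ne_zero.2 hp.1), ?_⟩
  simp only [etaInv]
  rw [curveSq_inv, curveSq_star, ← hp.2, neg_sq, star_pow]

theorem symPoint_eq (θ : ℝ) : symPoint θ = Complex.exp ((2 * θ : ℝ) * Complex.I) := by
  rw [symPoint]; push_cast; rfl

theorem eq_circlePoint_or {q φ : ℝ} (hq : |q| < 1) {z : ℂ × ℂ} (hz : z ∈ spectralCurve q)
    (h : z.1 = Complex.exp (φ * Complex.I)) :
    z = circlePoint q φ ∨ z = sigmaInv (circlePoint q φ) := by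
  have h1 := (mem_spectralCurve_iff.1 hz).2
  have h2 := (mem_spectralCurve_iff.1 (circlePoint_mem hq φ)).2
  rw [h, show Complex.exp (φ * Complex.I) = (circlePoint q φ).1 from rfl, ← h2] at h1
  rcases sq_eq_sq_iff_eq_or_eq_neg.1 h1 with h3 | h3
  · exact Or.inl (Prod.ext h h3)
  · exact Or.inr (Prod.ext h h3)

/-- An eigenvalue function on the spectral curve with logarithmic differential `torusForm`. -/
structure IsTorusEigenvalue (q s n : ℝ) (κ : ℂ) (μ : ℂ × ℂ → ℂ) : Prop where
  log : IsLogPrimitive q (torusForm q s n) μ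
  ne_zero : ∀ p ∈ spectralCurve q, μ p ≠ 0
  sigma_eq : ∀ p ∈ spectralCurve q, μ (sigmaInv p) = (μ p)⁻¹
  eta_eq : ∀ p ∈ spectralCurve q, μ (etaInv p) = star (μ p)
  value : μ (circlePoint q 0) = κ * Complex.exp (s * (circleRadius q 0 / 2 : ℝ) * Complex.I)

theorem exists_isTorusEigenvalue {q : ℝ} (h0 : 0 < q) (h1 : q < 1) (s n : ℝ)
    (hn : Complex.exp ((2 * (n * circlePhase q π) : ℝ) * Complex.I) = 1) {κ : ℂ}
    (hκ : κ = 1 ∨ κ = -1) : ∃ μ, IsTorusEigenvalue q s n κ μ := by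
  obtain ⟨μ, hlog, hne, hσ, hη, hv⟩ := exists_isLogPrimitive_torusForm h0 h1 s n hn
  have hκ0 : κ ≠ 0 := by rcases hκ with h | h <;> rw [h] <;> norm_num
  have hκi : κ⁻¹ = κ := by rcases hκ with h | h <;> rw [h] <;> norm_num
  have hκs : star κ = κ := by rcases hκ with h | h <;> rw [h] <;> simp
  refine ⟨fun p => κ * μ p, hlog.const_mul κ, fun p _ => mul_ne_zero hκ0 (hne p),
    fun p _ => ?_, fun p hp => ?_, ?_⟩
  · rw [hσ, mul_inv, hκi]
  · rw [hη p hp, star_mul', hκs]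
  · rw [hv]

/-- The logarithm of an eigenvalue function over a point of the unit circle. -/
noncomputable def circleExponent (q s n φ : ℝ) : ℝ :=
  s * (circleRadius q φ / 2) + n * circlePhase q φ

/-- The two points over a sym point carry inverse values of μ, which coincide when the value is ±1.
Hence the sheet is irrelevant in the closing condition. -/
theorem IsTorusEigenvalue.eq_of_mem {q s n : ℝ} {κ : ℂ} {μ : ℂ × ℂ → ℂ}
    (h : IsTorusEigenvalue q s n κ μ) (hq : |q| < 1) {φ : ℝ} {z : ℂ × ℂ}
    (hz : z ∈ spectralCurve q) (hφ : z.1 = Complex.exp (φ * Complex.I))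
    (hv : κ * Complex.exp (circleExponent q s n φ * Complex.I) = 1 ∨
      κ * Complex.exp (circleExponent q s n φ * Complex.I) = -1) :
    μ z = κ * Complex.exp (circleExponent q s n φ * Complex.I) := by
  have h1 := h.log.circlePoint_eq hq h.value φ
  rw [← circleExponent] at h1
  rcases eq_circlePoint_or hq hz hφ with h2 | h2
  · rw [h2, h1]
  · rw [h2, h.sigma_eq _ (circlePoint_mem hq φ), h1]
    rcases hv with h3 | h3 <;> rw [h3] <;> norm_num

/-- At both punctures the determinant of the two singular parts is, up to sign, 2K'(n₀s₁ - n₁s₀).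
Thus linear independence is governed by one determinant, since K' > 0. -/
theorem isSpectralGenusOneCMCTorus_of_isTorusEigenvalue {q : ℝ} (h0 : 0 < q) (h1 : q < 1)
    {θ : Fin 2 → ℝ} (hθ : symPoint (θ 0) ≠ symPoint (θ 1)) {s n : Fin 2 → ℝ}
    (hdet : n 0 * s 1 - n 1 * s 0 ≠ 0) {κ : Fin 2 → ℂ} {μ : Fin 2 → ℂ × ℂ → ℂ}
    (h : ∀ i, IsTorusEigenvalue q (s i) (n i) (κ i) (μ i))
    (hv : ∀ i j, κ i * Complex.exp (circleExponent q (s i) (n i) (2 * θ j) * Complex.I) = 1 ∨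
      κ i * Complex.exp (circleExponent q (s i) (n i) (2 * θ j) * Complex.I) = -1) :
    IsSpectralGenusOneCMCTorus q θ μ := by
  have hq : |q| < 1 := by rwa [abs_of_pos h0]
  have hK := ellipticK'_pos h0.ne'
  refine ⟨h0.ne', hq, hθ, fun i => (h i).log.holomorphicOnCurve, fun i => (h i).ne_zero,
    fun i => (h i).sigma_eq, fun i => (h i).eta_eq, fun i p hp => ?_,
    ⟨fun i => 2 * n i * ellipticK' q + s i * Complex.I, ?_,
      fun i => hasSingularPartAtZero_torusForm h0.ne' (h i).log (h i).ne_zero⟩,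
    ⟨fun i => -2 * n i * ellipticK' q + s i * Complex.I, ?_,
      fun i => hasSingularPartAtInfinity_torusForm h0.ne' (h i).log (h i).ne_zero⟩,
    fun i j p hp hpj => ?_⟩
  · have h2 : rhoInv p = sigmaInv (etaInv p) := by simp [rhoInv, sigmaInv, etaInv]
    rw [h2, (h i).sigma_eq _ (etaInv_mem hp), (h i).eta_eq p hp]
  · rw [linearIndependent_pair_complex]
    simp
    intro h2
    refine hdet (mul_left_cancel₀ (mul_ne_zero two_ne_zero hK.ne') ?_)
    linear_combination h2
  · rw [linearIndependent_pair_complex]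
    simp
    intro h2
    refine hdet (mul_left_cancel₀ (mul_ne_zero two_ne_zero hK.ne') ?_)
    linear_combination -h2
  · rw [symPoint_eq] at hpj
    rw [(h i).eq_of_mem hq hp hpj (hv i j)]
    exact hv i j

theorem IsSpectralGenusOneCMCTorus.exists_isTorusEigenvalue {q : ℝ} {θ : Fin 2 → ℝ}
    {μ : Fin 2 → ℂ × ℂ → ℂ} (h : IsSpectralGenusOneCMCTorus q θ μ) (h0 : 0 < q) :
    ∃ (s n : Fin 2 → ℝ) (κ : Fin 2 → ℂ), n 0 * s 1 - n 1 * s 0 ≠ 0 ∧ (∀ i, κ i = 1 ∨ κ i = -1) ∧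
      (∀ i, IsTorusEigenvalue q (s i) (n i) (κ i) (μ i)) ∧
      ∀ i j, κ i * Complex.exp (circleExponent q (s i) (n i) (2 * θ j) * Complex.I) = 1 ∨
        κ i * Complex.exp (circleExponent q (s i) (n i) (2 * θ j) * Complex.I) = -1 := by
  have h1 : q < 1 := lt_of_abs_lt h.abs_q_lt_one
  obtain ⟨c, hc, hcs⟩ := h.singular_zero
  obtain ⟨c', -, hcs'⟩ := h.singular_infinity
  choose s n hlog κ hκ hv using fun i => exists_torusForm h0 h1 (h.holomorphic i) (h.ne_zero i)
    (h.sigma_eq i) (h.rho_eq i) (hcs i) (hcs' i)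
  have hci : ∀ i, c i = 2 * n i * ellipticK' q + s i * Complex.I := fun i =>
    hasSingularPartAtZero_torusForm_unique h0.ne' (hlog i) (hcs i)
  refine ⟨s, n, κ, fun hdet => ?_, hκ, fun i => ⟨hlog i, h.ne_zero i, h.sigma_eq i, h.eta_eq i,
    hv i⟩, fun i j => ?_⟩
  · rw [linearIndependent_pair_complex, hci, hci] at hc
    simp at hc
    exact hc (by linear_combination 2 * ellipticK' q * hdet)
  · have h2 := (hlog i).circlePoint_eq h.abs_q_lt_one (hv i) (2 * θ j)
    rw [← circleExponent] at h2
    rw [← h2]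
    exact h.closing i j _ (circlePoint_mem h.abs_q_lt_one _) (symPoint_eq (θ j)).symm

/-! ### Deformations -/

/-- Spectral data lie on an integral curve of `extendedTorusFlow` consisting of spectral data. -/
def HasTorusDeformation (q₀ : ℝ) (θ₀ : Fin 2 → ℝ) (μ₀ : Fin 2 → ℂ × ℂ → ℂ) : Prop :=
  ∃ ε > (0 : ℝ), ∃ (q : ℝ → ℝ) (θ : ℝ → Fin 2 → ℝ) (μ : ℝ → Fin 2 → ℂ × ℂ → ℂ),
    q 0 = q₀ ∧ θ 0 = θ₀ ∧ (∀ i, EqOn (μ 0 i) (μ₀ i) (spectralCurve q₀)) ∧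
    ContDiffOn ℝ ∞ q (Ioo (-ε) ε) ∧ ContDiffOn ℝ ∞ θ (Ioo (-ε) ε) ∧
    (∃ c : ℝ → Fin 2 → ℂ, ContDiffOn ℝ ∞ c (Ioo (-ε) ε) ∧
      ∀ t ∈ Ioo (-ε) ε, ∀ i, HasSingularPartAtZero (q t) (μ t i) (c t i)) ∧
    IsIntegralCurveOn (fun t => torusCoords (q t) (θ t)) (fun _ => extendedTorusFlow)
      (Ioo (-ε) ε) ∧
    ∀ t ∈ Ioo (-ε) ε,
      IsSpectralGenusOneCMCTorus (q t) (θ t) (μ t) ∧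
      ∀ i j, ∀ z ∈ spectralCurve (q t), ∀ z₀ ∈ spectralCurve q₀,
        z.1 = symPoint (θ t j) → z₀.1 = symPoint (θ₀ j) → μ t i z = μ₀ i z₀

theorem IsAngleFlow.mono {q α β : ℝ → ℝ} {s s' : Set ℝ} (h : IsAngleFlow q α β s) (hs : s' ⊆ s) :
    IsAngleFlow q α β s' :=
  ⟨fun t ht => h.pos t (hs ht), fun t ht => h.lt_one t (hs ht), fun t ht => h.deriv_q t (hs ht),
    fun t ht => h.deriv_α t (hs ht), fun t ht => h.deriv_β t (hs ht)⟩

theorem IsAngleFlow.hasDerivAt_coords {q α β : ℝ → ℝ} {s : Set ℝ} (h : IsAngleFlow q α β s) {t : ℝ}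
    (ht : t ∈ s) : HasDerivAt (fun t => (q t, Real.cos (α t), Real.cos (β t)))
      (extendedTorusFlow (q t, Real.cos (α t), Real.cos (β t))) t := by
  refine ((h.deriv_q t ht).prodMk ((hasDerivAt_cos_of_angleFlow (h.deriv_α t ht)).prodMk
    (hasDerivAt_cos_of_angleFlow (h.deriv_β t ht)))).congr_deriv ?_
  simp only [extendedTorusFlow]
  congr 2
  ring

theorem IsSpectralGenusOneCMCTorus.hasTorusDeformation_of_pos {q₀ : ℝ} {θ₀ : Fin 2 → ℝ}
    {μ₀ : Fin 2 → ℂ × ℂ → ℂ} (h : IsSpectralGenusOneCMCTorus q₀ θ₀ μ₀) (h0 : 0 < q₀) :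
    HasTorusDeformation q₀ θ₀ μ₀ := by
  have h1 : q₀ < 1 := lt_of_abs_lt h.abs_q_lt_one
  obtain ⟨s₀, n, κ, hdet, hκ, hμ₀, hv₀⟩ := h.exists_isTorusEigenvalue h0
  obtain ⟨ε₁, hε₁, q, α, β, hq0, hα0, hβ0, hq₁, hα₁, hβ₁, hflow₁⟩ :=
    exists_angleFlow h0 h1 (θ₀ 0 + θ₀ 1) (θ₀ 0 - θ₀ 1)
  -- The lifted flow uses the sum and difference of the angles; the sym points themselves have
  -- arguments 2θ = α ± β.
  set θ : ℝ → Fin 2 → ℝ := fun t => ![(α t + β t) / 2, (α t - β t) / 2] with hθ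
  have hθ0 : ∀ t, 2 * θ t 0 = α t + β t := fun t => by simp [hθ]; ring
  have hθ1 : ∀ t, 2 * θ t 1 = α t - β t := fun t => by simp [hθ]; ring
  have hθinit : θ 0 = θ₀ := by
    funext j
    fin_cases j
    · simp [hθ, hα0, hβ0]
    · simp [hθ, hα0, hβ0]
  obtain ⟨ε, hε, hεε, hsym⟩ : ∃ ε > (0 : ℝ), ε ≤ ε₁ ∧
      ∀ t ∈ Ioo (-ε) ε, symPoint (θ t 0) ≠ symPoint (θ t 1) := by
    have h0mem : Ioo (-ε₁) ε₁ ∈ 𝓝 (0 : ℝ) := Ioo_mem_nhds (by linarith) hε₁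
    have hcα : ContinuousAt α 0 := hα₁.continuousOn.continuousAt h0mem
    have hcβ : ContinuousAt β 0 := hβ₁.continuousOn.continuousAt h0mem
    have hc : ContinuousAt (fun t => symPoint (θ t 0) - symPoint (θ t 1)) 0 := by
      simp only [symPoint_eq, hθ0, hθ1]
      fun_prop
    have hne : symPoint (θ 0 0) - symPoint (θ 0 1) ≠ 0 := by
      rw [hθinit]
      exact sub_ne_zero.2 h.symPoint_ne
    obtain ⟨δ, hδ, hball⟩ := Metric.eventually_nhds_iff_ball.1 (hc.eventually_ne hne)
    refine ⟨min δ ε₁, lt_min hδ hε₁, min_le_right _ _, fun t ht => sub_ne_zero.1 (hball t ?_)⟩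
    rw [Real.ball_eq_Ioo, zero_sub, zero_add]
    exact Ioo_subset_Ioo (neg_le_neg (min_le_left _ _)) (min_le_left _ _) ht
  have hsub : Ioo (-ε) ε ⊆ Ioo (-ε₁) ε₁ := Ioo_subset_Ioo (neg_le_neg hεε) hεε
  have hflow := hflow₁.mono hsub
  have hq := hq₁.mono hsub
  have hα := hα₁.mono hsub
  have hβ := hβ₁.mono hsub
  have hmem0 : (0 : ℝ) ∈ Ioo (-ε) ε := ⟨by linarith, hε⟩
  set R : ℝ → ℝ := fun t => circleRadius (q t) (α t + β t) with hR
  set Φ : ℝ → ℝ := fun t => circlePhase (q t) (α t + β t) with hΦ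
  have hRpos : ∀ t ∈ Ioo (-ε) ε, 0 < R t := fun t ht => circleRadius_pos (hflow.abs_lt_one ht) _
  -- Solved from the requirement that s R/2 + nΦ be constant at the angle α + β. The constant n
  -- keeps the circle period fixed.
  set s : ℝ → Fin 2 → ℝ := fun t i => (s₀ i * R 0 + 2 * (n i * (Φ 0 - Φ t))) / R t with hs
  have hs0 : s 0 = s₀ := by
    funext i
    simp only [hs, sub_self, mul_zero, add_zero]
    rw [mul_div_assoc, div_self (hRpos 0 hmem0).ne', mul_one]
  have hdett : ∀ t ∈ Ioo (-ε) ε, n 0 * s t 1 - n 1 * s t 0 ≠ 0 := by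
    intro t ht
    have h2 : n 0 * s t 1 - n 1 * s t 0 = (n 0 * s₀ 1 - n 1 * s₀ 0) * R 0 / R t := by
      simp only [hs]; ring
    rw [h2]
    exact div_ne_zero (mul_ne_zero hdet (hRpos 0 hmem0).ne') (hRpos t ht).ne'
  -- the exponents over the sym points are constant
  have hexp0 : ∀ t ∈ Ioo (-ε) ε, ∀ i, circleExponent (q t) (s t i) (n i) (α t + β t) =
      s₀ i * R 0 / 2 + n i * Φ 0 := by
    intro t ht i
    have h2 := (hRpos t ht).ne'
    have h3 : circleExponent (q t) (s t i) (n i) (α t + β t) = s t i * (R t / 2) + n i * Φ t := rfl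
    rw [h3]
    simp only [hs]
    field_simp
    ring
  set r : ℝ := circleRadius (q 0) (α 0 - β 0) / circleRadius (q 0) (α 0 + β 0) with hr
  have hrt : ∀ t ∈ Ioo (-ε) ε, circleRadius (q t) (α t - β t) = r * R t := by
    intro t ht
    rw [hr, ← hflow.circleRadius_div ht]
    exact (div_mul_cancel₀ _ (hRpos t ht).ne').symm
  have hexp1 : ∀ t ∈ Ioo (-ε) ε, ∀ i, circleExponent (q t) (s t i) (n i) (α t - β t) =
      circleExponent (q 0) (s 0 i) (n i) (α 0 - β 0) := by
    intro t ht i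
    -- As R(α - β) = r R(α + β), the term in s is eliminated: the second exponent is r times the
    -- first plus n times the conserved phase combination.
    have h2 : ∀ t ∈ Ioo (-ε) ε, circleExponent (q t) (s t i) (n i) (α t - β t) =
        r * circleExponent (q t) (s t i) (n i) (α t + β t) +
          n i * (circlePhase (q t) (α t - β t) - r * circlePhase (q t) (α t + β t)) := by
      intro t ht
      rw [circleExponent, circleExponent, hrt t ht]
      ring
    rw [h2 t ht, h2 0 hmem0, hexp0 t ht, hexp0 0 hmem0, hflow.circlePhase_sub ht hrt]
  have hexp : ∀ t ∈ Ioo (-ε) ε, ∀ i j, circleExponent (q t) (s t i) (n i) (2 * θ t j) =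
      circleExponent q₀ (s₀ i) (n i) (2 * θ₀ j) := by
    intro t ht i j
    rw [← hq0, ← hs0, ← hθinit]
    fin_cases j
    · simp only [Fin.zero_eta, hθ0]
      rw [hexp0 t ht, hexp0 0 hmem0]
    · simp only [Fin.mk_one, hθ1]
      exact hexp1 t ht i
  -- the eigenvalue functions
  have hex : ∀ t i, ∃ μ : ℂ × ℂ → ℂ, (t ∈ Ioo (-ε) ε →
      IsTorusEigenvalue (q t) (s t i) (n i) (κ i) μ) ∧ (t = 0 → μ = μ₀ i) := by
    intro t i
    rcases eq_or_ne t 0 with rfl | ht0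
    · refine ⟨μ₀ i, fun _ => ?_, fun _ => rfl⟩
      rw [hq0, hs0]
      exact hμ₀ i
    · by_cases ht : t ∈ Ioo (-ε) ε
      · obtain ⟨μ, hμ⟩ := _root_.exists_isTorusEigenvalue (hflow.pos t ht) (hflow.lt_one t ht)
          (s t i) (n i) (by
            rw [hflow.circlePhase_pi ht, hq0]
            exact exp_circlePhase_pi h.abs_q_lt_one (hμ₀ i).log
              (by rcases hκ i with h | h <;> rw [h] <;> norm_num) (hμ₀ i).value) (hκ i)
        exact ⟨μ, fun _ => hμ, fun h => absurd h ht0⟩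
      · exact ⟨μ₀ i, fun h => absurd h ht, fun h => absurd h ht0⟩
  choose μ hμ hμinit using hex
  have hv : ∀ t ∈ Ioo (-ε) ε, ∀ i j,
      κ i * Complex.exp (circleExponent (q t) (s t i) (n i) (2 * θ t j) * Complex.I) = 1 ∨
        κ i * Complex.exp (circleExponent (q t) (s t i) (n i) (2 * θ t j) * Complex.I) = -1 := by
    intro t ht i j
    rw [hexp t ht]
    exact hv₀ i j
  have hcoords : ∀ t, torusCoords (q t) (θ t) =
      (q t, Real.cos (α t), Real.cos (β t)) := by
    intro t
    simp only [torusCoords]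
    rw [show θ t 0 + θ t 1 = α t by linarith [hθ0 t, hθ1 t],
      show θ t 0 - θ t 1 = β t by linarith [hθ0 t, hθ1 t] ]
  refine ⟨ε, hε, q, θ, μ, hq0, hθinit, fun i => ?_, hq, ?_, ?_, fun t ht => ?_, fun t ht =>
    ⟨isSpectralGenusOneCMCTorus_of_isTorusEigenvalue (hflow.pos t ht) (hflow.lt_one t ht)
      (hsym t ht) (hdett t ht) (fun i => hμ t i ht) (hv t ht), ?_⟩⟩
  · rw [hμinit 0 i rfl]
    exact eqOn_refl _ _
  · rw [contDiffOn_pi]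
    intro j
    fin_cases j
    · exact (hα.add hβ).div_const 2
    · exact (hα.sub hβ).div_const 2
  · refine ⟨fun t i => 2 * n i * ellipticK' (q t) + s t i * Complex.I, ?_, fun t ht i =>
      hasSingularPartAtZero_torusForm (hflow.pos t ht).ne' (hμ t i ht).log (hμ t i ht).ne_zero⟩
    rw [contDiffOn_pi]
    intro i
    have hRc : ContDiffOn ℝ ∞ R (Ioo (-ε) ε) :=
      contDiffOn_circleRadius hq (hα.add hβ) fun t ht => hflow.abs_lt_one ht
    have hΦc : ContDiffOn ℝ ∞ Φ (Ioo (-ε) ε) := hflow.contDiffOn_circlePhase hq hα hβ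
    have hsc : ContDiffOn ℝ ∞ (fun t => s t i) (Ioo (-ε) ε) :=
      (contDiffOn_const.add (contDiffOn_const.mul (contDiffOn_const.mul
        (contDiffOn_const.sub hΦc)))).div hRc fun t ht => (hRpos t ht).ne'
    have hKc := contDiffOn_ellipticK' hq fun t ht => (hflow.pos t ht).ne'
    exact (contDiffOn_const.mul (Complex.ofRealCLM.contDiff.comp_contDiffOn hKc)).add
      ((Complex.ofRealCLM.contDiff.comp_contDiffOn hsc).mul contDiffOn_const)
  · simp only [hcoords]
    exact (hflow.hasDerivAt_coords ht).hasDerivWithinAt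
  · intro i j z hz z₀ hz₀ hzj hz₀j
    rw [symPoint_eq] at hzj hz₀j
    rw [(hμ t i ht).eq_of_mem (hflow.abs_lt_one ht) hz hzj (hv t ht i j),
      (hμ₀ i).eq_of_mem h.abs_q_lt_one hz₀ hz₀j (hv₀ i j), hexp t ht]

/-! ### The symmetry `l ↦ -l` -/

theorem neg_mem_spectralCurve {q : ℝ} {p : ℂ × ℂ} :
    (-p.1, p.2) ∈ spectralCurve q ↔ p ∈ spectralCurve (-q) := by
  have h : curveSq q (-p.1) = curveSq (-q) p.1 := by
    simp only [curveSq, inv_neg]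
    push_cast
    ring
  rw [mem_spectralCurve_iff, mem_spectralCurve_iff, neg_ne_zero, h]

theorem HasSingularPartAtZero.neg {q : ℝ} {μ : ℂ × ℂ → ℂ} {c : ℂ}
    (h : HasSingularPartAtZero q μ c) :
    HasSingularPartAtZero (-q) (fun p => μ (-p.1, p.2)) c := by
  obtain ⟨G, hG, δ, hδ, h⟩ := h
  exact ⟨G, hG, δ, hδ, fun p hp hpδ => h _ (neg_mem_spectralCurve.2 hp) (by rwa [norm_neg])⟩

theorem HasSingularPartAtInfinity.neg {q : ℝ} {μ : ℂ × ℂ → ℂ} {c : ℂ}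
    (h : HasSingularPartAtInfinity q μ c) :
    HasSingularPartAtInfinity (-q) (fun p => μ (-p.1, p.2)) c := by
  obtain ⟨G, hG, R, hR, h⟩ := h
  exact ⟨G, hG, R, hR, fun p hp hpR => h _ (neg_mem_spectralCurve.2 hp) (by rwa [norm_neg])⟩

theorem IsSpectralGenusOneCMCTorus.neg {q : ℝ} {θ θ' : Fin 2 → ℝ} {μ : Fin 2 → ℂ × ℂ → ℂ}
    (h : IsSpectralGenusOneCMCTorus q θ μ) (hθ : ∀ j, symPoint (θ' j) = -symPoint (θ j)) :
    IsSpectralGenusOneCMCTorus (-q) θ' (fun i p => μ i (-p.1, p.2)) where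
  q_ne_zero := neg_ne_zero.2 h.q_ne_zero
  abs_q_lt_one := by rw [abs_neg]; exact h.abs_q_lt_one
  symPoint_ne := by rw [hθ, hθ]; exact fun h2 => h.symPoint_ne (neg_injective h2)
  holomorphic i p hp := by
    obtain ⟨F, hF, hμ⟩ := h.holomorphic i _ (neg_mem_spectralCurve.2 hp)
    have hi : AnalyticAt ℂ (fun z : ℂ × ℂ => (-z.1, z.2)) p := analyticAt_fst.neg.prod analyticAt_snd
    refine ⟨fun z => F (-z.1, z.2), AnalyticAt.comp_of_eq hF hi rfl, ?_⟩
    refine (tendsto_nhdsWithin_iff.2 ⟨hi.continuousAt.continuousWithinAt, ?_⟩).eventually hμ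
    filter_upwards [self_mem_nhdsWithin] with z hz using neg_mem_spectralCurve.2 hz
  ne_zero i p hp := h.ne_zero i _ (neg_mem_spectralCurve.2 hp)
  sigma_eq i p hp := h.sigma_eq i _ (neg_mem_spectralCurve.2 hp)
  eta_eq i p hp := by
    have h2 := h.eta_eq i _ (neg_mem_spectralCurve.2 hp)
    simpa [etaInv, inv_neg] using h2
  rho_eq i p hp := by
    have h2 := h.rho_eq i _ (neg_mem_spectralCurve.2 hp)
    simpa [rhoInv, inv_neg] using h2
  singular_zero := by
    obtain ⟨c, hc, h2⟩ := h.singular_zero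
    exact ⟨c, hc, fun i => (h2 i).neg⟩
  singular_infinity := by
    obtain ⟨c, hc, h2⟩ := h.singular_infinity
    exact ⟨c, hc, fun i => (h2 i).neg⟩
  closing i j p hp hpj := h.closing i j _ (neg_mem_spectralCurve.2 hp)
    (by rw [hpj, hθ, neg_neg])

theorem symPoint_add_pi_div_two (θ : ℝ) : symPoint (θ + π / 2) = -symPoint θ := by
  rw [symPoint, symPoint, ← mul_neg_one, ← Complex.exp_pi_mul_I, ← Complex.exp_add]
  push_cast
  ring_nf

theorem symPoint_sub_pi_div_two (θ : ℝ) : symPoint (θ - π / 2) = -symPoint θ := by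
  rw [← neg_eq_iff_eq_neg, ← symPoint_add_pi_div_two, sub_add_cancel]

/-- Under (q, k, h) ↦ (-q, -k, h) the field becomes its negative, so integral curves are mapped to
integral curves run backwards. -/
theorem extendedTorusFlow_neg (q k h : ℝ) : extendedTorusFlow (-q, -k, h) =
    ((extendedTorusFlow (q, k, h)).1, (extendedTorusFlow (q, k, h)).2.1,
      -(extendedTorusFlow (q, k, h)).2.2) := by
  simp only [extendedTorusFlow, ellipticE', ellipticK', kCoeff, hCoeff, neg_sq, Prod.mk.injEq]
  refine ⟨by ring, trivial, by ring⟩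

theorem IsSpectralGenusOneCMCTorus.hasTorusDeformation {q₀ : ℝ} {θ₀ : Fin 2 → ℝ}
    {μ₀ : Fin 2 → ℂ × ℂ → ℂ} (h : IsSpectralGenusOneCMCTorus q₀ θ₀ μ₀) :
    HasTorusDeformation q₀ θ₀ μ₀ := by
  rcases lt_or_gt_of_ne h.q_ne_zero with hneg | hpos
  swap
  · exact h.hasTorusDeformation_of_pos hpos
  -- Adding π/2 to both angles negates both sym points; it shifts the sum of the angles by π, hence
  -- k ↦ -k, and leaves the difference, hence h, unchanged.
  obtain ⟨ε, hε, q, θ, μ, hq0, hθ0, hμ0, hq, hθ, ⟨c, hc, hcs⟩, hint, htor⟩ :=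
    (h.neg (θ' := fun j => θ₀ j + π / 2) fun j =>
      symPoint_add_pi_div_two (θ₀ j)).hasTorusDeformation_of_pos (neg_pos.2 hneg)
  have hmaps : MapsTo (fun t : ℝ => -t) (Ioo (-ε) ε) (Ioo (-ε) ε) := fun t ht =>
    ⟨neg_lt_neg ht.2, neg_lt.1 ht.1⟩
  have hnegc : ContDiffOn ℝ ∞ (fun t : ℝ => -t) (Ioo (-ε) ε) := contDiff_neg.contDiffOn
  refine ⟨ε, hε, fun t => -q (-t), fun t j => θ (-t) j - π / 2, fun t i p => μ (-t) i (-p.1, p.2),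
    ?_, ?_, fun i p hp => ?_, (hq.comp hnegc hmaps).neg, ?_, ⟨fun t => c (-t),
      hc.comp hnegc hmaps, fun t ht i => (hcs _ (hmaps ht) i).neg⟩, fun t ht => ?_, fun t ht =>
      ⟨(htor _ (hmaps ht)).1.neg fun j => symPoint_sub_pi_div_two _, fun i j z hz z₀ hz₀ hzj hz₀j => ?_⟩⟩
  · simp [hq0]
  · funext j
    simp [hθ0]
  · have hp' : (-p.1, p.2) ∈ spectralCurve (-q₀) := neg_mem_spectralCurve.2 (by rwa [neg_neg])
    have h2 := hμ0 i hp'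
    simpa using h2
  · rw [contDiffOn_pi] at hθ ⊢
    exact fun j => ((hθ j).comp hnegc hmaps).sub contDiffOn_const
  · have h2 := (hint _ (hmaps ht)).hasDerivAt (isOpen_Ioo.mem_nhds (hmaps ht))
    have h3 : HasDerivAt (fun t => torusCoords (q (-t)) (θ (-t))) _ t :=
      h2.scomp t (hasDerivAt_neg t)
    have h4 : (fun t => torusCoords (-q (-t)) fun j => θ (-t) j - π / 2) = fun t =>
        (-(torusCoords (q (-t)) (θ (-t))).1, -(torusCoords (q (-t)) (θ (-t))).2.1,
          (torusCoords (q (-t)) (θ (-t))).2.2) := by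
      funext t
      simp only [torusCoords, Prod.mk.injEq, true_and]
      constructor
      · rw [← Real.cos_sub_pi]; ring_nf
      · ring_nf
    have h5 : HasDerivAt (fun t => (torusCoords (q (-t)) (θ (-t))).1) _ t :=
      (ContinuousLinearMap.fst ℝ ℝ (ℝ × ℝ)).hasFDerivAt.comp_hasDerivAt t h3
    have h6 : HasDerivAt (fun t => (torusCoords (q (-t)) (θ (-t))).2) _ t :=
      (ContinuousLinearMap.snd ℝ ℝ (ℝ × ℝ)).hasFDerivAt.comp_hasDerivAt t h3
    have h7 : HasDerivAt (fun t => (torusCoords (q (-t)) (θ (-t))).2.1) _ t :=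
      (ContinuousLinearMap.fst ℝ ℝ ℝ).hasFDerivAt.comp_hasDerivAt t h6
    have h8 : HasDerivAt (fun t => (torusCoords (q (-t)) (θ (-t))).2.2) _ t :=
      (ContinuousLinearMap.snd ℝ ℝ ℝ).hasFDerivAt.comp_hasDerivAt t h6
    refine HasDerivAt.hasDerivWithinAt ?_
    rw [h4]
    refine (h5.neg.prodMk (h7.neg.prodMk h8)).congr_deriv ?_
    simp only [torusCoords]
    rw [extendedTorusFlow_neg]
    simp
  · refine ((htor _ (hmaps ht)).2 i j (-z.1, z.2) (neg_mem_spectralCurve.2 hz) (-z₀.1, z₀.2)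
      (neg_mem_spectralCurve.2 (by rwa [neg_neg])) ?_ ?_).trans ?_
    · rw [hzj, symPoint_sub_pi_div_two, neg_neg]
    · rw [hz₀j, symPoint_add_pi_div_two]
    · simp

theorem mainTheorem9 :
    ∃ V : ℝ × ℝ × ℝ → ℝ × ℝ × ℝ,
      (∀ p : ℝ × ℝ × ℝ, p.1 ≠ 0 → p.1 ^ 2 ≠ 1 → V p = torusFlow p) ∧
      AnalyticOnNhd ℝ V {p | p.1 ≠ 0} ∧
      {p : ℝ × ℝ × ℝ | p.1 ≠ 0 ∧ V p = 0} =
        {p : ℝ × ℝ × ℝ | p.1 ≠ 0 ∧ p.1 ^ 2 = 1 ∧ p.2.1 = p.1 * p.2.2} ∧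
      ∀ (q₀ : ℝ) (θ₀ : Fin 2 → ℝ) (μ₀ : Fin 2 → ℂ × ℂ → ℂ),
        IsSpectralGenusOneCMCTorus q₀ θ₀ μ₀ →
        ∃ ε > (0 : ℝ), ∃ (q : ℝ → ℝ) (θ : ℝ → Fin 2 → ℝ) (μ : ℝ → Fin 2 → ℂ × ℂ → ℂ),
          q 0 = q₀ ∧ θ 0 = θ₀ ∧ (∀ i, EqOn (μ 0 i) (μ₀ i) (spectralCurve q₀)) ∧
          ContDiffOn ℝ ∞ q (Ioo (-ε) ε) ∧ ContDiffOn ℝ ∞ θ (Ioo (-ε) ε) ∧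
          (∃ c : ℝ → Fin 2 → ℂ, ContDiffOn ℝ ∞ c (Ioo (-ε) ε) ∧
            ∀ t ∈ Ioo (-ε) ε, ∀ i, HasSingularPartAtZero (q t) (μ t i) (c t i)) ∧
          IsIntegralCurveOn (fun t => torusCoords (q t) (θ t)) (fun _ => V) (Ioo (-ε) ε) ∧
          ∀ t ∈ Ioo (-ε) ε,
            IsSpectralGenusOneCMCTorus (q t) (θ t) (μ t) ∧
            ∀ i j, ∀ z ∈ spectralCurve (q t), ∀ z₀ ∈ spectralCurve q₀,
              z.1 = symPoint (θ t j) → z₀.1 = symPoint (θ₀ j) → μ t i z = μ₀ i z₀ :=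
  ⟨extendedTorusFlow, fun _ h0 h1 => extendedTorusFlow_eq h0 h1, analyticOnNhd_extendedTorusFlow,
    zeros_extendedTorusFlow, fun _ _ _ h => h.hasTorusDeformation⟩
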